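/- **Setting.** Let $\mathcal{T}=\mathbb{R}/2\pi R_1\mathbb{Z}\times\dots\times\mathbb{R}/2\pi R_d\mathbb{Z}$ with $R_1,\dots,R_d>0$. A set $\mathcal{A}\subset C^0(\mathcal{T})$ is *admissible* if - for all $u\in\mathcal{A}$ and $v\in C^0(\mathcal{T})$, if there is an isotopy $(\phi_t)_{t\in[0,1]}$ of $\mathcal{T}$ (a continuous family of homeomorphisms) with $\phi_0=\mathrm{id}$ and $\phi_1(\{v\ge 0\})=\{u\ge 0\}$, then $v\in\mathcal{A}$; - for all $u\in\mathcal{A}$ and $v\in C^0(\mathcal{T})$ with $u\le v$, $v\in\mathcal{A}$; - $\mathcal{A}$ and its complement are non-empty. For such $\mathcal{A}$ and $u\in C^0(\mathcal{T})$, let $\mathrm{T}_{\mathcal{A}}(u)=\inf\{\ell\in\mathbb{R} : u+\ell\in\mathcal{A}\}$. Let $\mathcal{M}$ be the set of perfect Morse functions, i.e. of $u\in C^2(\mathcal{T})$ whose critical points all have a non-degenerate Hessian and whose values at distinct critical points are distinct. For $u\in\mathcal{M}$, $\mathrm{S}_{\mathcal{A}}(u)\in\mathcal{T}$ denotes the unique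 critical point $x$ of $u$ at which the threshold is attained, i.e. with $u(x)+\mathrm{T}_{\mathcal{A}}(u)=0$. For a centered Gaussian field $f$ on $\mathcal{T}$, with values in $C^0(\mathcal{T})$, let $G$ be the closed linear span in $L^2$ of the variables $f(x)$, $x\in\mathcal{T}$. The Cameron–Martin space $H$ of $f$ is the space of functions $h_\xi:x\mapsto\mathbb{E}[\xi f(x)]$, $\xi\in G$, with scalar product $\langle h_\xi,h_\eta\rangle=\mathbb{E}[\xi\eta]$. **Proposition.** There exists an absolute constant $C<+\infty$ such that the following holds for all $d$, all $R_1,\dots,R_d>0$ and every admissible $\mathcal{A}\subset C^0(\mathcal{T})$. Let $f$ be a centered Gaussian field on $\mathcal{T}$ with covariance $K$ and finite-dimensional Cameron–Martin space $H\ne\{0\}$, and let $(\psi_k)_k$ be an orthogonal basis of $H$. Assume that $f\in\mathcal{M}$ almost surely. Then $\mathrm{S}_{\mathcal{A}}(f)$ is almost surely well defined, $\mathrm{T}_{\mathcal{A}}(f)$ and all $\psi_k(\mathrm{S}_{\mathcal{A}}(f))$ are square integrable, $K(\mathrm{S}_{\mathcal{A}}(f),\mathrm{S}_{\mathcal{A}}(f))$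 is integrable, and $$\mathrm{Var}(\mathrm{T}_{\mathcal{A}}(f))\le C\,\mathbb{E}\big[K(\mathrm{S}_{\mathcal{A}}(f),\mathrm{S}_{\mathcal{A}}(f))\big]\,\max_k\left[1+\ln\left(\frac{\sqrt{\mathbb{E}[\psi_k(\mathrm{S}_{\mathcal{A}}(f))^2]}}{\mathbb{E}[|\psi_k(\mathrm{S}_{\mathcal{A}}(f))|]}\right)\right]^{-1},$$ where the factor of index $k$ is understood to be $0$ if $\psi_k(\mathrm{S}_{\mathcal{A}}(f))=0$ almost surely. -/

import Mathlib

open MeasureTheory ProbabilityTheory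

/-! ### The torus, critical points and perfect Morse functions -/

/-- The torus `ℝ/2πR₁ℤ × ⋯ × ℝ/2πR_dℤ`. -/
abbrev Torus {d : ℕ} (R : Fin d → ℝ) : Type :=
  (i : Fin d) → AddCircle (2 * Real.pi * R i)

namespace Torus

variable {d : ℕ} {R : Fin d → ℝ}

/-- The covering map `ℝ^d → Torus R`. -/
noncomputable def proj (R : Fin d → ℝ) (v : EuclideanSpace ℝ (Fin d)) : Torus R :=
  fun i => (v i : AddCircle (2 * Real.pi * R i))

/-- The function `u` read in the flat chart `v ↦ p + proj v` centered at `p`. -/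
noncomputable def chart (u : C(Torus R, ℝ)) (p : Torus R) (v : EuclideanSpace ℝ (Fin d)) : ℝ :=
  u (p + proj R v)

/-- `p` is a critical point of `u`. -/
def IsCritical (u : C(Torus R, ℝ)) (p : Torus R) : Prop :=
  fderiv ℝ (chart u p) 0 = 0

/-- The Hessian of `u` at `p` is non-degenerate, as a bilinear form on `ℝ^d`. -/
def HessianNondegenerate (u : C(Torus R, ℝ)) (p : Torus R) : Prop :=
  Function.Injective (fderiv ℝ (fderiv ℝ (chart u p)) 0)

/-- `u` is of class `C²`, all its critical points are non-degenerate, and distinct critical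
points have distinct critical values. -/
structure IsPerfectMorse (u : C(Torus R, ℝ)) : Prop where
  contDiff : ContDiff ℝ 2 (chart u 0)
  nondegenerate : ∀ p, IsCritical u p → HessianNondegenerate u p
  values_ne : ∀ p q, IsCritical u p → IsCritical u q → p ≠ q → u p ≠ u q

/-! ### Admissible sets, the threshold map and the saddle map -/

/-- There is an isotopy `(φ_t)` of the torus (a jointly continuous family of
homeomorphisms) with `φ_0 = id` and `φ_1(E) = F`. -/
def IsotopicTo (E F : Set (Torus R)) : Prop :=
  ∃ φ : unitInterval → (Torus R ≃ₜ Torus R),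
    Continuous (fun z : unitInterval × Torus R => φ z.1 z.2) ∧
    (∀ x, φ 0 x = x) ∧ φ 1 '' E = F

/-- Admissible sets of continuous functions: increasing topological threshold sets which,
together with their complement, are non-empty. -/
structure IsAdmissible (A : Set C(Torus R, ℝ)) : Prop where
  topological : ∀ u ∈ A, ∀ v : C(Torus R, ℝ),
    IsotopicTo {x | 0 ≤ v x} {x | 0 ≤ u x} → v ∈ A
  increasing : ∀ u ∈ A, ∀ v : C(Torus R, ℝ), u ≤ v → v ∈ A
  nonempty : A.Nonempty
  compl_nonempty : Aᶜ.Nonempty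

/-- The threshold map: the infimum of the levels `ℓ` such that `u + ℓ ∈ A`. -/
noncomputable def threshold (A : Set C(Torus R, ℝ)) (u : C(Torus R, ℝ)) : ℝ :=
  sInf {ℓ : ℝ | u + ContinuousMap.const (Torus R) ℓ ∈ A}

/-- The threshold `T` of `u` is reached at `p`: `p` is a critical point of `u` lying on the
boundary level of `{u + T ≥ 0}`, that is `u p + T = 0`. -/
def ReachedAt (A : Set C(Torus R, ℝ)) (u : C(Torus R, ℝ)) (p : Torus R) : Prop :=
  IsCritical u p ∧ u p + threshold A u = 0

open scoped Classical in
/-- The saddle map: the unique critical point at which the threshold is reached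
(and `0` if there is no such unique point). -/
noncomputable def saddle (A : Set C(Torus R, ℝ)) (u : C(Torus R, ℝ)) : Torus R :=
  if h : ∃! p, ReachedAt A u p then h.choose else 0

end Torus

/-! ### Gaussian fields and their Cameron-Martin space -/

section CameronMartin

variable {Ω T : Type*} [MeasurableSpace Ω] {μ : Measure Ω} {f : T → Ω → ℝ}

/-- The values of a Gaussian process are square integrable. -/
theorem memLp_two_of_gaussian (hf : IsGaussianProcess f μ) (x : T) : MemLp (f x) 2 μ :=
  (hf.hasGaussianLaw_eval x).memLp_two

/-- The variable `f x`, as an element of `L²`. -/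
noncomputable def gaussianVar (hf : IsGaussianProcess f μ) (x : T) : Lp ℝ 2 μ :=
  (memLp_two_of_gaussian hf x).toLp (f x)

/-- The Gaussian space `G`: the closed linear subspace of `L²` spanned by the `f x`. -/
noncomputable def gaussianSpace (hf : IsGaussianProcess f μ) : Submodule ℝ (Lp ℝ 2 μ) :=
  (Submodule.span ℝ (Set.range (gaussianVar hf))).topologicalClosure

/-- The linear map `ξ ↦ h_ξ`, where `h_ξ(x) = 𝔼[ξ f(x)]`. -/
noncomputable def cmMap (hf : IsGaussianProcess f μ) : Lp ℝ 2 μ →ₗ[ℝ] (T → ℝ) :=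
  LinearMap.pi fun x => (innerSL ℝ (gaussianVar hf x)).toLinearMap

theorem cmMap_apply (hf : IsGaussianProcess f μ) (ξ : Lp ℝ 2 μ) (x : T) :
    cmMap hf ξ x = ∫ ω, ξ ω * f x ω ∂μ := by
  have h : cmMap hf ξ x = inner ℝ (gaussianVar hf x) ξ := rfl
  rw [h, L2.inner_def]
  refine integral_congr_ae ?_
  filter_upwards [(memLp_two_of_gaussian hf x).coeFn_toLp] with ω hω
  simp [gaussianVar, hω]

/-- The Cameron-Martin space `H`: the functions `h_ξ` with `ξ ∈ G`. -/
noncomputable def cameronMartin (hf : IsGaussianProcess f μ) : Submodule ℝ (T → ℝ) :=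
  (gaussianSpace hf).map (cmMap hf)

theorem cmMap_injOn (hf : IsGaussianProcess f μ) :
    Set.InjOn (cmMap hf) (gaussianSpace hf) := by
  intro ξ hξ η hη h
  have hd : ξ - η ∈ gaussianSpace hf := sub_mem hξ hη
  have horth : gaussianSpace hf ≤ (ℝ ∙ (ξ - η))ᗮ := by
    refine Submodule.topologicalClosure_minimal _ ?_ (Submodule.isClosed_orthogonal _)
    rw [Submodule.span_le]
    rintro _ ⟨x, rfl⟩
    rw [SetLike.mem_coe, Submodule.mem_orthogonal_singleton_iff_inner_left, inner_sub_right]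
    exact sub_eq_zero.2 (congrFun h x)
  have h0 := Submodule.mem_orthogonal_singleton_iff_inner_left.1 (horth hd)
  exact sub_eq_zero.1 (inner_self_eq_zero.1 h0)

/-- The bijection `G ≃ H`, `ξ ↦ h_ξ`. -/
noncomputable def cmEquiv (hf : IsGaussianProcess f μ) :
    gaussianSpace hf ≃ₗ[ℝ] cameronMartin hf :=
  LinearEquiv.ofBijective ((cmMap hf).submoduleMap (gaussianSpace hf))
    ⟨fun a b h => Subtype.ext (cmMap_injOn hf a.2 b.2 (congrArg Subtype.val h)),
      LinearMap.submoduleMap_surjective _ _⟩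

/-- The scalar product of `H`: `⟨h_ξ, h_η⟩ = 𝔼[ξ η]` for `ξ, η ∈ G`. -/
noncomputable def cmInner (hf : IsGaussianProcess f μ) (g h : cameronMartin hf) : ℝ :=
  ∫ ω, ((cmEquiv hf).symm g : Lp ℝ 2 μ) ω * ((cmEquiv hf).symm h : Lp ℝ 2 μ) ω ∂μ

/-- The covariance function `K(x, y) = Cov(f(x), f(y))` of a random field. -/
noncomputable def covKernel (f : T → Ω → ℝ) (μ : Measure Ω) (x y : T) : ℝ :=
  cov[f x, f y; μ]

open scoped Classical in
/-- For a random variable `X`, the number `[1 + ln(√𝔼[X²] / 𝔼|X|)]⁻¹`, which is understood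
to be `0` when `𝔼|X| = 0`. -/
noncomputable def logFactor (X : Ω → ℝ) (μ : Measure Ω) : ℝ :=
  if ∫ ω, |X ω| ∂μ = 0 then 0
  else (1 + Real.log (√(∫ ω, X ω ^ 2 ∂μ) / ∫ ω, |X ω| ∂μ))⁻¹

end CameronMartin

/-!
The Cameron–Martin space being finite-dimensional, the normalized basis `e_k = ψ_k / ‖ψ_k‖` gives an
expansion `f = ∑ Ξ_k e_k` with `Ξ` a standard Gaussian vector of `ℝⁿ`
(`exists_gaussian_coordinates`), so that the threshold of `f` is `F(Ξ)` with
`F(y) = T_A(∑ y_k e_k)`. The inequality is Talagrand's `L¹`–`L²` inequality on Gauss space,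

  `Var F ≤ 4 ∑ ‖∂_k F‖₂² / (1 + log (‖∂_k F‖₂ / ‖∂_k F‖₁))`,

applied to this Lipschitz function (`variance_le_of_lipschitzWith`), combined with the identity
`∂_k F(Ξ) = -e_k(S_A(f))` almost surely and with `K(x, x) = ∑ e_k(x)²`. The factors
`1 / (1 + log …)` are invariant under scaling, so they may be computed with `ψ_k` instead of `e_k`.

*Talagrand's inequality.* For `F` of class `C¹` the variance is
`∫₀^{π/2} sin θ ∑ 𝔼[∂_k F(X) ∂_k F(X_θ)] dθ`, where `X_θ` is a copy of `X` of correlation `cos θ`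
(`hasDerivAt_integral_mul_rotation`). The autocorrelation of a function `g` decays with the
correlation: at correlation `1/2` it is at most `‖g‖₂² (‖g‖₁ / ‖g‖₂)^(2/3)` by hypercontractivity
(`autocorr_half_le`), and its monotonicity and log-convexity extend this to all correlations
(`autocorr_le_of_autocorr_half_le`). Hypercontractivity is needed only for one exponent, in the form
`𝔼[u(X)^(2/3) v(Y)^(2/3)] ≤ 𝔼[u(X)]^(2/3) 𝔼[v(Y)]^(2/3)` for correlation `1/2`. On the line it
follows from the monotonicity of the left-hand side along the Ornstein–Uhlenbeck flow
(`IsSmoothPos.integral_rpow_mul_rpow_le`), and it tensorizes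
(`integral_rpow_mul_rpow_le_stdGauss`). Mollification takes care of Lipschitz functions.

*The derivative of the threshold.* The threshold is `1`-Lipschitz for the uniform norm. For `u` of
class `C²` it is reached at a critical point (`Torus.IsAdmissible.exists_reachedAt`): otherwise the
map `p ↦ p - s ∇u(p)`, which for small `s` is isotopic to the identity, would identify an excursion
set of level slightly below `-T` with a subset of one of level slightly above `-T`. If `u` is a perfect Morse function, this point `S` is unique,
and the points where the threshold of `u + t v` is reached are within `O(t)` of it because the
Hessian is non-degenerate; as `S` is critical, this gives the derivative `-v(S)`
(`Torus.IsAdmissible.hasDerivAt_threshold`).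

*Regularity of the `e_k`.* A linear subspace of `ℝⁿ` that contains `Ξ` almost surely is all of `ℝⁿ`
(`eq_top_of_ae_mem`). Hence the almost sure continuity and `C²` regularity of `f` pass to each `e_k`.
-/

set_option linter.unusedSectionVars false

/-! ### Rotation invariance of Gaussian measures and the Mehler semigroup -/

section Mehler

variable {E : Type*} [NormedAddCommGroup E] [NormedSpace ℝ E] [MeasurableSpace E] [BorelSpace E]
  [CompleteSpace E] [SecondCountableTopology E] {γ : Measure E} [IsGaussian γ]

theorem map_neg_eq_self_of_centered (hγ : ∫ x, x ∂γ = 0) : γ.map (fun x => -x) = γ := by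
  have h := IsGaussian.map_rotation_eq_self (μ := γ) hγ Real.pi
  have h1 : (γ.prod γ).map Prod.fst = γ := measurePreserving_fst.map_eq
  conv_rhs => rw [← h1, ← h]
  rw [Measure.map_map measurable_fst (by fun_prop)]
  conv_lhs => rw [← h1]
  rw [Measure.map_map measurable_neg measurable_fst]
  congr 1
  ext p
  simp [ContinuousLinearMap.rotation_apply Real.pi p]

/-- If `c = cos θ` and `s = sin θ`, then the orthogonal reflection `(x, z) ↦ (cx + sz, sx - cz)`
preserves the product of two copies of a centered Gaussian measure. -/
theorem measurePreserving_reflection (hγ : ∫ x, x ∂γ = 0) {c s : ℝ} (hs : 0 ≤ s)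
    (hcs : c ^ 2 + s ^ 2 = 1) :
    MeasurePreserving (fun p : E × E => (c • p.1 + s • p.2, s • p.1 - c • p.2))
      (γ.prod γ) (γ.prod γ) := by
  have hc1 : -1 ≤ c := by nlinarith
  have hc2 : c ≤ 1 := by nlinarith
  have hcos : Real.cos (Real.arccos c) = c := Real.cos_arccos hc1 hc2
  have hsin : Real.sin (Real.arccos c) = s := by
    rw [Real.sin_arccos, show 1 - c ^ 2 = s ^ 2 by linarith, Real.sqrt_sq hs]
  have h1 : MeasurePreserving (ContinuousLinearMap.rotation (E := E) (Real.arccos c))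
      (γ.prod γ) (γ.prod γ) :=
    ⟨by fun_prop, IsGaussian.map_rotation_eq_self hγ _⟩
  have h2 : MeasurePreserving (fun x : E => -x) γ γ :=
    ⟨measurable_neg, map_neg_eq_self_of_centered hγ⟩
  have h3 := ((MeasurePreserving.id γ).prod h2).comp h1
  convert h3 using 1
  ext p
  · simp [ContinuousLinearMap.rotation_apply _ p, hcos, hsin]
  · simp [ContinuousLinearMap.rotation_apply _ p, hcos, hsin]
    abel

/-- The Mehler (Ornstein–Uhlenbeck) operator of correlation `ρ`: `g` is sent to
`x ↦ 𝔼[g(ρ x + √(1 - ρ²) Z)]`, where `Z` has law `γ`. -/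
noncomputable def mehler (γ : Measure E) (ρ : ℝ) (g : E → ℝ) (x : E) : ℝ :=
  ∫ z, g (ρ • x + √(1 - ρ ^ 2) • z) ∂γ

variable {g h : E → ℝ} {M N : ℝ} {ρ : ℝ}

theorem integrable_of_abs_le {α : Type*} [MeasurableSpace α] {μ : Measure α} [IsFiniteMeasure μ]
    {q : α → ℝ} {M : ℝ} (hq : Measurable q) (hM : ∀ x, |q x| ≤ M) : Integrable q μ :=
  Integrable.of_bound hq.aestronglyMeasurable M (Filter.Eventually.of_forall hM)

theorem measurable_mehler (hg : Measurable g) : Measurable (mehler γ ρ g) := by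
  have : Measurable (fun p : E × E => g (ρ • p.1 + √(1 - ρ ^ 2) • p.2)) := by fun_prop
  exact this.stronglyMeasurable.integral_prod_right'.measurable

theorem abs_mehler_le (hM : ∀ x, |g x| ≤ M) (x : E) : |mehler γ ρ g x| ≤ M := by
  have := norm_integral_le_of_norm_le_const (μ := γ) (C := M)
    (f := fun z => g (ρ • x + √(1 - ρ ^ 2) • z)) (Filter.Eventually.of_forall fun z => hM _)
  simpa [mehler] using this

theorem integral_mul_mehler (hg : Measurable g) (hh : Measurable h) (hM : ∀ x, |g x| ≤ M)
    (hN : ∀ x, |h x| ≤ N) :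
    ∫ x, g x * mehler γ ρ h x ∂γ
      = ∫ p : E × E, g p.1 * h (ρ • p.1 + √(1 - ρ ^ 2) • p.2) ∂γ.prod γ := by
  rw [integral_prod]
  · simp_rw [mehler, integral_const_mul]
  · refine integrable_of_abs_le (M := M * N) (by fun_prop) fun p => ?_
    rw [abs_mul]
    exact mul_le_mul (hM _) (hN _) (abs_nonneg _) ((abs_nonneg _).trans (hM 0))

/-- The Mehler operator is self-adjoint, by invariance under reflections. -/
theorem integral_mul_mehler_comm (hγ : ∫ x, x ∂γ = 0) (hg : Measurable g) (hh : Measurable h)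
    (hM : ∀ x, |g x| ≤ M) (hN : ∀ x, |h x| ≤ N) (hρ : ρ ^ 2 ≤ 1) :
    ∫ x, g x * mehler γ ρ h x ∂γ = ∫ x, h x * mehler γ ρ g x ∂γ := by
  have hsq : √(1 - ρ ^ 2) ^ 2 = 1 - ρ ^ 2 := Real.sq_sqrt (by linarith)
  rw [integral_mul_mehler hg hh hM hN, integral_mul_mehler hh hg hN hM,
    ← (measurePreserving_reflection hγ (Real.sqrt_nonneg (1 - ρ ^ 2))
      (by rw [hsq]; ring : ρ ^ 2 + √(1 - ρ ^ 2) ^ 2 = 1)).map_eq, integral_map]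
  · rw [(measurePreserving_reflection hγ (Real.sqrt_nonneg (1 - ρ ^ 2))
      (by rw [hsq]; ring : ρ ^ 2 + √(1 - ρ ^ 2) ^ 2 = 1)).map_eq]
    refine integral_congr_ae (Filter.Eventually.of_forall fun p => ?_)
    have : ρ • (ρ • p.1 + √(1 - ρ ^ 2) • p.2) + √(1 - ρ ^ 2) • (√(1 - ρ ^ 2) • p.1 - ρ • p.2)
        = p.1 := by
      have : ρ • (ρ • p.1 + √(1 - ρ ^ 2) • p.2) + √(1 - ρ ^ 2) • (√(1 - ρ ^ 2) • p.1 - ρ • p.2)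
        = (ρ ^ 2 + √(1 - ρ ^ 2) ^ 2) • p.1 := by module
      rw [this, hsq]; simp
    simp only [this]
    ring
  · fun_prop
  · exact Measurable.aestronglyMeasurable (by fun_prop)

/-- For independent `Z, Z'` of law `γ`, `α Z + β Z'` has the law of `√(α² + β²) Z`. -/
theorem integral_comp_linear_combination (hγ : ∫ x, x ∂γ = 0) (hg : Measurable g) {α β κ : ℝ}
    (hβ : 0 ≤ β) (hκ : 0 ≤ κ) (h : α ^ 2 + β ^ 2 = κ ^ 2) (x : E) :
    ∫ p : E × E, g (x + (α • p.1 + β • p.2)) ∂γ.prod γ = ∫ z, g (x + κ • z) ∂γ := by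
  rcases hκ.eq_or_lt with rfl | hκ
  · have h1 : α = 0 := by nlinarith [sq_nonneg α, sq_nonneg β]
    have h2 : β = 0 := by nlinarith [sq_nonneg α, sq_nonneg β]
    simp [h1, h2]
  · have h1 : (α / κ) ^ 2 + (β / κ) ^ 2 = 1 := by
      field_simp
      exact h
    have hR := measurePreserving_reflection hγ (div_nonneg hβ hκ.le) h1
    have h2 : MeasurePreserving (fun p : E × E => (α / κ) • p.1 + (β / κ) • p.2)
        (γ.prod γ) γ := measurePreserving_fst.comp hR
    rw [← h2.map_eq, integral_map h2.measurable.aemeasurable]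
    · rw [h2.map_eq]
      refine integral_congr_ae (Filter.Eventually.of_forall fun p => ?_)
      simp only [smul_add, smul_smul]
      congr 4 <;> field_simp
    · exact Measurable.aestronglyMeasurable (by fun_prop)

/-- The semigroup property: correlations multiply. -/
theorem mehler_mehler (hγ : ∫ x, x ∂γ = 0) (hg : Measurable g) (hM : ∀ x, |g x| ≤ M) {a b : ℝ}
    (ha : a ^ 2 ≤ 1) (hb : b ^ 2 ≤ 1) (x : E) :
    mehler γ a (mehler γ b g) x = mehler γ (b * a) g x := by
  have hab : (b * a) ^ 2 ≤ 1 := by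
    rw [mul_pow]
    exact mul_le_one₀ hb (sq_nonneg a) ha
  have h1 : (b * √(1 - a ^ 2)) ^ 2 + √(1 - b ^ 2) ^ 2 = √(1 - (b * a) ^ 2) ^ 2 := by
    rw [mul_pow, Real.sq_sqrt (by linarith), Real.sq_sqrt (by linarith),
      Real.sq_sqrt (by linarith)]
    ring
  unfold mehler
  rw [← integral_comp_linear_combination hγ hg (Real.sqrt_nonneg _) (Real.sqrt_nonneg _) h1,
    integral_prod]
  · simp only [smul_add, smul_smul, add_assoc]
  · exact integrable_of_abs_le (M := M) (by fun_prop) fun p => hM _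

theorem integral_mehler (hγ : ∫ x, x ∂γ = 0) (hg : Measurable g) (hM : ∀ x, |g x| ≤ M)
    (hρ : ρ ^ 2 ≤ 1) : ∫ x, mehler γ ρ g x ∂γ = ∫ x, g x ∂γ := by
  have := integral_mul_mehler_comm (g := fun _ => (1 : ℝ)) (M := 1) hγ measurable_const hg
    (by simp) hM hρ
  simpa [mehler] using this

/-- Jensen's inequality for the Mehler operator. -/
theorem sq_mehler_le (hg : Measurable g) (hM : ∀ x, |g x| ≤ M) (x : E) :
    mehler γ ρ g x ^ 2 ≤ mehler γ ρ (fun y => g y ^ 2) x := by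
  have hmeas : Measurable fun z => g (ρ • x + √(1 - ρ ^ 2) • z) := by fun_prop
  have h1 : MemLp (fun z => g (ρ • x + √(1 - ρ ^ 2) • z)) 2 γ :=
    MemLp.of_bound hmeas.aestronglyMeasurable M (Filter.Eventually.of_forall fun z => hM _)
  have h2 := variance_nonneg (fun z => g (ρ • x + √(1 - ρ ^ 2) • z)) γ
  rw [variance_eq_sub h1] at h2
  simpa [mehler] using h2

theorem integral_sq_mehler_le (hγ : ∫ x, x ∂γ = 0) (hg : Measurable g) (hM : ∀ x, |g x| ≤ M)
    (hρ : ρ ^ 2 ≤ 1) : ∫ x, mehler γ ρ g x ^ 2 ∂γ ≤ ∫ x, g x ^ 2 ∂γ := by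
  have hM2 : ∀ x, |g x ^ 2| ≤ M ^ 2 := fun x => by
    rw [abs_pow]; exact pow_le_pow_left₀ (abs_nonneg _) (hM x) 2
  rw [← integral_mehler hγ (hg.pow_const 2) hM2 hρ]
  refine integral_mono ?_ ?_ fun x => sq_mehler_le hg hM x
  · refine integrable_of_abs_le (M := M ^ 2) ((measurable_mehler hg).pow_const 2) fun x => ?_
    rw [abs_pow]; exact pow_le_pow_left₀ (abs_nonneg _) (abs_mehler_le hM x) 2
  · exact integrable_of_abs_le (measurable_mehler (hg.pow_const 2)) (abs_mehler_le hM2)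

/-- The autocorrelation `𝔼[g(X) g(X_ρ)]`, where `(X, X_ρ)` is a `ρ`-correlated pair. -/
noncomputable def autocorr (γ : Measure E) (g : E → ℝ) (ρ : ℝ) : ℝ :=
  ∫ x, g x * mehler γ ρ g x ∂γ

/-- Splitting the correlation `ρ` as `√ρ * √ρ` shows that the autocorrelation is a square. -/
theorem autocorr_eq_integral_sq (hγ : ∫ x, x ∂γ = 0) (hg : Measurable g) (hM : ∀ x, |g x| ≤ M)
    (h0 : 0 ≤ ρ) (h1 : ρ ≤ 1) :
    autocorr γ g ρ = ∫ x, mehler γ (√ρ) g x ^ 2 ∂γ := by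
  have hr : √ρ ^ 2 ≤ 1 := by rwa [Real.sq_sqrt h0]
  have h2 : mehler γ ρ g = mehler γ (√ρ) (mehler γ (√ρ) g) := by
    ext x
    rw [mehler_mehler hγ hg hM hr hr, Real.mul_self_sqrt h0]
  rw [autocorr, h2, integral_mul_mehler_comm hγ hg (measurable_mehler hg) hM (abs_mehler_le hM) hr]
  simp_rw [sq]

theorem autocorr_one :
    autocorr γ g 1 = ∫ x, g x ^ 2 ∂γ := by
  simp [autocorr, mehler, sq]

theorem autocorr_mono (hγ : ∫ x, x ∂γ = 0) (hg : Measurable g) (hM : ∀ x, |g x| ≤ M)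
    {ρ' : ℝ} (h0 : 0 ≤ ρ) (hρ : ρ ≤ ρ') (h1 : ρ' ≤ 1) : autocorr γ g ρ ≤ autocorr γ g ρ' := by
  have h0' : 0 ≤ ρ' := h0.trans hρ
  rw [autocorr_eq_integral_sq hγ hg hM h0 (hρ.trans h1), autocorr_eq_integral_sq hγ hg hM h0' h1]
  rcases h0'.eq_or_lt with h | h
  · have : ρ = ρ' := le_antisymm hρ (h ▸ h0)
    rw [this]
  · have hq : √(ρ / ρ') ^ 2 ≤ 1 := by
      rw [Real.sq_sqrt (by positivity)]
      exact div_le_one_of_le₀ hρ h0'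
    have : mehler γ (√ρ) g = mehler γ (√(ρ / ρ')) (mehler γ (√ρ') g) := by
      ext x
      rw [mehler_mehler hγ hg hM hq (by rwa [Real.sq_sqrt h0']), ← Real.sqrt_mul h0',
        mul_div_cancel₀ _ h.ne']
    rw [this]
    exact integral_sq_mehler_le hγ (measurable_mehler hg) (abs_mehler_le hM) hq

/-- The Cauchy–Schwarz inequality for integrals. -/
theorem sq_integral_mul_le {α : Type*} [MeasurableSpace α] {μ : Measure α} {p q : α → ℝ}
    (hp : MemLp p 2 μ) (hq : MemLp q 2 μ) :
    (∫ x, p x * q x ∂μ) ^ 2 ≤ (∫ x, p x ^ 2 ∂μ) * ∫ x, q x ^ 2 ∂μ := by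
  have h1 := real_inner_mul_inner_self_le (hp.toLp p) (hq.toLp q)
  have h2 : ∀ {a b : α → ℝ} (ha : MemLp a 2 μ) (hb : MemLp b 2 μ),
      inner ℝ (ha.toLp a) (hb.toLp b) = ∫ x, a x * b x ∂μ := by
    intro a b ha hb
    rw [L2.inner_def]
    refine integral_congr_ae ?_
    filter_upwards [ha.coeFn_toLp, hb.coeFn_toLp] with x hx hx'
    simp [hx, hx', mul_comm]
  rw [h2, h2, h2] at h1
  simpa [sq] using h1

/-- The square root of the correlation costs a square root of the autocorrelation: this is the
Cauchy–Schwarz inequality, and encodes the log-convexity of the autocorrelation in `log ρ`. -/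
theorem sq_autocorr_sqrt_le (hγ : ∫ x, x ∂γ = 0) (hg : Measurable g) (hM : ∀ x, |g x| ≤ M)
    (h0 : 0 ≤ ρ) (h1 : ρ ≤ 1) :
    autocorr γ g (√ρ) ^ 2 ≤ (∫ x, g x ^ 2 ∂γ) * autocorr γ g ρ := by
  rw [autocorr_eq_integral_sq hγ hg hM h0 h1, autocorr]
  refine sq_integral_mul_le ?_ ?_
  · exact MemLp.of_bound hg.aestronglyMeasurable M (Filter.Eventually.of_forall hM)
  · exact MemLp.of_bound (measurable_mehler hg).aestronglyMeasurable M
      (Filter.Eventually.of_forall (abs_mehler_le hM))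

/-- Decay of the autocorrelation. One value at correlation `1/2` propagates along the correlations
`2^(-2^(-m))` by repeated square roots, and monotonicity fills the gaps. -/
theorem autocorr_le_of_autocorr_half_le (hγ : ∫ x, x ∂γ = 0) (hg : Measurable g)
    (hM : ∀ x, |g x| ≤ M) {r : ℝ} (hr0 : 0 < r) (hr1 : r ≤ 1)
    (hhalf : autocorr γ g (1 / 2) ≤ (∫ x, g x ^ 2 ∂γ) * r ^ (2 / 3 : ℝ))
    (h0 : 0 ≤ ρ) (h1 : ρ ≤ 1) :
    autocorr γ g ρ
      ≤ (∫ x, g x ^ 2 ∂γ) * (ρ ^ (-Real.log r / (3 * Real.log 2)) + r ^ (2 / 3 : ℝ)) := by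
  set A := ∫ x, g x ^ 2 ∂γ with hA
  have hA0 : 0 ≤ A := by positivity
  have hlog2 : 0 < Real.log 2 := Real.log_pos one_lt_two
  have hp1 : 0 ≤ ρ ^ (-Real.log r / (3 * Real.log 2)) := Real.rpow_nonneg h0 _
  have hp2 : 0 ≤ r ^ (2 / 3 : ℝ) := Real.rpow_nonneg hr0.le _
  rcases le_total ρ (1 / 2) with hρ | hρ
  · refine (autocorr_mono hγ hg hM h0 hρ (by norm_num)).trans (hhalf.trans ?_)
    gcongr
    linarith
  rcases h1.eq_or_lt with rfl | hlt
  · rw [autocorr_one, ← hA, Real.one_rpow]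
    nlinarith
  have key : ∀ m : ℕ, autocorr γ g ((1 / 2 : ℝ) ^ ((1 / 2 : ℝ) ^ m))
      ≤ A * r ^ (2 / 3 * (1 / 2 : ℝ) ^ m) := by
    intro m
    induction m with
    | zero => simpa using hhalf
    | succ m ih =>
      have hρm0 : (0 : ℝ) ≤ (1 / 2 : ℝ) ^ ((1 / 2 : ℝ) ^ m) := by positivity
      have hρm1 : (1 / 2 : ℝ) ^ ((1 / 2 : ℝ) ^ m) ≤ 1 :=
        Real.rpow_le_one (by norm_num) (by norm_num) (by positivity)
      have hsq : √((1 / 2 : ℝ) ^ ((1 / 2 : ℝ) ^ m)) = (1 / 2 : ℝ) ^ ((1 / 2 : ℝ) ^ (m + 1)) := by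
        rw [Real.sqrt_eq_rpow, ← Real.rpow_mul (by norm_num), pow_succ]
      rw [← hsq]
      have h3 := sq_autocorr_sqrt_le hγ hg hM hρm0 hρm1
      rw [← hA] at h3
      refine (le_abs_self _).trans (abs_le_of_sq_le_sq (h3.trans ?_) (by positivity))
      calc A * autocorr γ g ((1 / 2 : ℝ) ^ ((1 / 2 : ℝ) ^ m))
          ≤ A * (A * r ^ (2 / 3 * (1 / 2 : ℝ) ^ m)) := by gcongr
        _ = (A * r ^ (2 / 3 * (1 / 2 : ℝ) ^ (m + 1))) ^ 2 := by
            rw [mul_pow, ← Real.rpow_natCast (r ^ _) 2, ← Real.rpow_mul hr0.le]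
            push_cast
            rw [pow_succ]
            ring_nf
  have hρ0 : 0 < ρ := by linarith
  -- write `ρ = 2 ^ (-τ)` and round `τ` down to a power of `1/2`; the factor `2` lost there turns the
  -- exponent `2/3` into `1/3`
  set τ := -Real.log ρ / Real.log 2 with hτ
  have hτ0 : 0 < τ := div_pos (neg_pos.2 (Real.log_neg hρ0 hlt)) hlog2
  have hτ1 : τ ≤ 1 := by
    rw [hτ, div_le_one hlog2]
    have := Real.log_le_log (by norm_num) hρ
    rw [one_div, Real.log_inv] at this
    linarith
  have hρτ : ρ = (1 / 2 : ℝ) ^ τ := by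
    rw [Real.rpow_def_of_pos (by norm_num), one_div, Real.log_inv, hτ,
      show -Real.log 2 * (-Real.log ρ / Real.log 2) = Real.log ρ by field_simp, Real.exp_log hρ0]
  obtain ⟨m, hm1, hm2⟩ := exists_nat_pow_near_of_lt_one hτ0 hτ1 (y := (1 / 2 : ℝ))
    (by norm_num) (by norm_num)
  have h4 : ρ ≤ (1 / 2 : ℝ) ^ ((1 / 2 : ℝ) ^ (m + 1)) := by
    rw [hρτ]
    exact Real.rpow_le_rpow_of_exponent_ge (by norm_num) (by norm_num) hm1.le
  have h5 : (1 / 2 : ℝ) ^ ((1 / 2 : ℝ) ^ (m + 1)) ≤ 1 :=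
    Real.rpow_le_one (by norm_num) (by norm_num) (by positivity)
  calc autocorr γ g ρ ≤ A * r ^ (2 / 3 * (1 / 2 : ℝ) ^ (m + 1)) :=
        (autocorr_mono hγ hg hM h0 h4 h5).trans (key _)
    _ ≤ A * r ^ (τ / 3) := by
        refine mul_le_mul_of_nonneg_left ?_ hA0
        refine Real.rpow_le_rpow_of_exponent_ge hr0 hr1 ?_
        rw [pow_succ]
        linarith
    _ = A * ρ ^ (-Real.log r / (3 * Real.log 2)) := by
        rw [Real.rpow_def_of_pos hr0, Real.rpow_def_of_pos hρ0, hτ]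
        congr 2
        field_simp
    _ ≤ _ := by gcongr; linarith

end Mehler

/-! ### Hypercontractivity of the Gaussian measure on the line -/

section OneDim

theorem integrable_gaussianReal_iff {q : ℝ → ℝ} :
    Integrable q (gaussianReal 0 1) ↔ Integrable (fun x => gaussianPDFReal 0 1 x * q x) := by
  rw [gaussianReal_of_var_ne_zero _ one_ne_zero,
    integrable_withDensity_iff_integrable_smul' (measurable_gaussianPDF 0 1)
      (Filter.Eventually.of_forall fun _ => gaussianPDF_lt_top)]
  simp [toReal_gaussianPDF]

theorem hasDerivAt_gaussianPDFReal_zero_one (x : ℝ) :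
    HasDerivAt (gaussianPDFReal 0 1) (-x * gaussianPDFReal 0 1 x) x := by
  have h1 : HasDerivAt (fun x : ℝ => -(x - 0) ^ 2 / (2 * ((1 : NNReal) : ℝ))) (-x) x := by
    have h := (((hasDerivAt_id x).sub_const 0).pow 2).neg.div_const (2 * ((1 : NNReal) : ℝ))
    refine h.congr_deriv ?_
    simp
    ring
  have h2 := h1.exp.const_mul (√(2 * Real.pi * ((1 : NNReal) : ℝ)))⁻¹
  rw [gaussianPDFReal_def]
  refine h2.congr_deriv ?_
  ring

theorem integrable_id_gaussianReal : Integrable (fun x : ℝ => x) (gaussianReal 0 1) :=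
  (memLp_id_gaussianReal 1).integrable (by norm_num)

theorem integrable_sq_gaussianReal : Integrable (fun x : ℝ => x ^ 2) (gaussianReal 0 1) :=
  (memLp_id_gaussianReal 2).integrable_sq

/-- Stein's formula (Gaussian integration by parts) on the line. -/
theorem integral_id_mul_gaussianReal {q q' : ℝ → ℝ} {C : ℝ} (hq : ∀ x, HasDerivAt q (q' x) x)
    (hC : ∀ x, |q' x| ≤ C) :
    ∫ x, x * q x ∂gaussianReal 0 1 = ∫ x, q' x ∂gaussianReal 0 1 := by
  have hqc : Continuous q := continuous_iff_continuousAt.2 fun x => (hq x).continuousAt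
  have hq'm : Measurable q' := by
    have : q' = deriv q := funext fun x => (hq x).deriv.symm
    rw [this]
    exact measurable_deriv q
  have hC0 : 0 ≤ C := (abs_nonneg _).trans (hC 0)
  have hlin : ∀ x, |q x| ≤ |q 0| + C * |x| := by
    intro x
    have h := (convex_univ (𝕜 := ℝ) (E := ℝ)).norm_image_sub_le_of_norm_hasDerivWithin_le
      (f := q) (f' := q') (C := C) (fun y _ => (hq y).hasDerivWithinAt) (fun y _ => hC y)
      (Set.mem_univ 0) (Set.mem_univ x)
    simp only [Real.norm_eq_abs, sub_zero] at h
    have h2 := abs_sub_abs_le_abs_sub (q x) (q 0)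
    linarith
  have i1 : Integrable q (gaussianReal 0 1) := by
    refine Integrable.mono' ((integrable_const |q 0|).add (integrable_id_gaussianReal.abs.const_mul C))
      hqc.aestronglyMeasurable (Filter.Eventually.of_forall fun x => ?_)
    exact hlin x
  have i2 : Integrable (fun x => x * q x) (gaussianReal 0 1) := by
    refine Integrable.mono' ((integrable_id_gaussianReal.abs.const_mul |q 0|).add
      (integrable_sq_gaussianReal.const_mul C)) (by fun_prop)
      (Filter.Eventually.of_forall fun x => ?_)
    simp only [Real.norm_eq_abs, abs_mul, Pi.add_apply]
    calc |x| * |q x| ≤ |x| * (|q 0| + C * |x|) := by gcongr; exact hlin x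
      _ = |q 0| * |x| + C * x ^ 2 := by rw [← sq_abs x]; ring
  have i3 : Integrable q' (gaussianReal 0 1) := integrable_of_abs_le hq'm hC
  rw [integrable_gaussianReal_iff] at i1 i2 i3
  rw [integral_gaussianReal_eq_integral_smul one_ne_zero,
    integral_gaussianReal_eq_integral_smul one_ne_zero]
  simp only [smul_eq_mul]
  have h := integral_mul_deriv_eq_deriv_mul_of_integrable (u := q) (u' := q')
    (v := gaussianPDFReal 0 1) (v' := fun x => -x * gaussianPDFReal 0 1 x)
    (fun x _ => hq x) (fun x _ => hasDerivAt_gaussianPDFReal_zero_one x)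
    (by convert i2.neg using 1; ext x; simp; ring)
    (by convert i3 using 1; ext x; simp; ring) (by convert i1 using 1; ext x; simp; ring)
  calc ∫ x, gaussianPDFReal 0 1 x * (x * q x)
      = -∫ x, q x * (-x * gaussianPDFReal 0 1 x) := by
        rw [← integral_neg]; congr 1; ext x; ring
    _ = ∫ x, gaussianPDFReal 0 1 x * q' x := by
        rw [h, neg_neg]; congr 1; ext x; ring

theorem hasDerivAt_rpow_mul_rpow {u v : ℝ → ℝ} {u' v' k t : ℝ} (hu : HasDerivAt u u' t)
    (hv : HasDerivAt v v' t) (hu0 : 0 < u t) (hv0 : 0 < v t) :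
    HasDerivAt (fun t => u t ^ k * v t ^ k)
      (k * (u t ^ k * v t ^ k) * (u' / u t + v' / v t)) t := by
  have h := (hu.rpow_const (p := k) (Or.inl hu0.ne')).mul
    (hv.rpow_const (p := k) (Or.inl hv0.ne'))
  refine h.congr_deriv ?_
  rw [Real.rpow_sub_one hu0.ne', Real.rpow_sub_one hv0.ne']
  field_simp

/-- The second component of the pair `(x, x/2 + (√3/2) z)`, of correlation `1/2` with the first. -/
noncomputable def halfCorr (p : ℝ × ℝ) : ℝ := 1 / 2 * p.1 + √3 / 2 * p.2

theorem measurable_halfCorr : Measurable halfCorr := by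
  unfold halfCorr; fun_prop

/-- A pair of standard Gaussian variables of correlation `1/2` is exchangeable. -/
theorem integral_halfCorr_swap {q : ℝ × ℝ → ℝ} (hq : Measurable q) :
    ∫ p, q (p.1, halfCorr p) ∂(gaussianReal 0 1).prod (gaussianReal 0 1)
      = ∫ p, q (halfCorr p, p.1) ∂(gaussianReal 0 1).prod (gaussianReal 0 1) := by
  have h3 : √(3 : ℝ) ^ 2 = 3 := Real.sq_sqrt (by norm_num)
  have hR := measurePreserving_reflection (γ := gaussianReal 0 1) (c := 1 / 2) (s := √3 / 2)
    integral_id_gaussianReal (by positivity) (by rw [div_pow √3, h3]; norm_num)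
  conv_lhs => rw [← hR.map_eq]
  rw [integral_map hR.measurable.aemeasurable]
  · refine integral_congr_ae (Filter.Eventually.of_forall fun p => ?_)
    have : halfCorr ((1 / 2 : ℝ) • p.1 + (√3 / 2) • p.2, (√3 / 2) • p.1 - (1 / 2 : ℝ) • p.2)
        = p.1 := by
      simp only [halfCorr, smul_eq_mul]
      linear_combination (p.1 / 4) * h3
    simp only [this]
    rfl
  · exact (hq.comp (measurable_fst.prodMk measurable_halfCorr)).aestronglyMeasurable

/-- A positive bounded function `U` whose first two derivatives are `c A` and `c² A2`, where `A`
and `A2` are bounded. The model case is `U = P u`, `A = P u'`, `A2 = P u''` with `P` the Mehler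
operator of correlation `c`. -/
structure IsFlowProfile (c δ M : ℝ) (U A A2 : ℝ → ℝ) : Prop where
  deriv_zero : ∀ x, HasDerivAt U (c * A x) x
  deriv_one : ∀ x, HasDerivAt A (c * A2 x) x
  measurable_two : Measurable A2
  lower : ∀ x, δ ≤ U x
  upper : ∀ x, U x ≤ M
  bound_one : ∀ x, |A x| ≤ M
  bound_two : ∀ x, |A2 x| ≤ M

namespace IsFlowProfile

variable {U A A2 V B B2 : ℝ → ℝ} {c δ M : ℝ}

theorem measurable_zero (h : IsFlowProfile c δ M U A A2) : Measurable U :=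
  (continuous_iff_continuousAt.2 fun x => (h.deriv_zero x).continuousAt).measurable

theorem measurable_one (h : IsFlowProfile c δ M U A A2) : Measurable A :=
  (continuous_iff_continuousAt.2 fun x => (h.deriv_one x).continuousAt).measurable

theorem M_nonneg (h : IsFlowProfile c δ M U A A2) : 0 ≤ M := (abs_nonneg _).trans (h.bound_one 0)

theorem pos (h : IsFlowProfile c δ M U A A2) (hδ : 0 < δ) (x : ℝ) : 0 < U x :=
  hδ.trans_le (h.lower x)

theorem abs_div_le (h : IsFlowProfile c δ M U A A2) (hδ : 0 < δ) (x : ℝ) : |A x / U x| ≤ M / δ := by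
  rw [abs_div, abs_of_pos (h.pos hδ x)]
  exact div_le_div₀ h.M_nonneg (h.bound_one x) hδ (h.lower x)

theorem abs_div_le' (h : IsFlowProfile c δ M U A A2) (hδ : 0 < δ) (x : ℝ) :
    |A2 x / U x| ≤ M / δ := by
  rw [abs_div, abs_of_pos (h.pos hδ x)]
  exact div_le_div₀ h.M_nonneg (h.bound_two x) hδ (h.lower x)

theorem abs_rpow_mul_le (h : IsFlowProfile c δ M U A A2) (h' : IsFlowProfile c δ M V B B2)
    (hδ : 0 < δ) (x y : ℝ) :
    |U x ^ (2 / 3 : ℝ) * V y ^ (2 / 3 : ℝ)| ≤ M ^ (2 / 3 : ℝ) * M ^ (2 / 3 : ℝ) := by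
  have h1 := Real.rpow_nonneg (h.pos hδ x).le (2 / 3)
  have h2 := Real.rpow_nonneg (h'.pos hδ y).le (2 / 3)
  have hM := h.M_nonneg
  rw [abs_of_nonneg (mul_nonneg h1 h2)]
  exact mul_le_mul (Real.rpow_le_rpow (h.pos hδ x).le (h.upper x) (by norm_num))
    (Real.rpow_le_rpow (h'.pos hδ y).le (h'.upper y) (by norm_num)) h2 (by positivity)

theorem integrable_of_bounded_factor (h : IsFlowProfile c δ M U A A2)
    (h' : IsFlowProfile c δ M V B B2) (hδ : 0 < δ) {w : ℝ × ℝ → ℝ} {K : ℝ} (hw : Measurable w)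
    (hK : ∀ p, |w p| ≤ K) :
    Integrable (fun p => U p.1 ^ (2 / 3 : ℝ) * V (halfCorr p) ^ (2 / 3 : ℝ) * w p)
      ((gaussianReal 0 1).prod (gaussianReal 0 1)) := by
  have hUm := h.measurable_zero
  have hVm := h'.measurable_zero
  have hym := measurable_halfCorr
  have hM := h.M_nonneg
  refine integrable_of_abs_le (M := M ^ (2 / 3 : ℝ) * M ^ (2 / 3 : ℝ) * K) (by fun_prop) fun p => ?_
  rw [abs_mul]
  exact mul_le_mul (h.abs_rpow_mul_le h' hδ _ _) (hK p) (abs_nonneg _) (by positivity)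

/-- Gaussian integration by parts along the flow, in the first of two variables of
correlation `1/2`. -/
theorem integral_by_parts (h : IsFlowProfile c δ M U A A2) (h' : IsFlowProfile c δ M V B B2)
    (hδ : 0 < δ) (hc : |c| ≤ 1) (s : ℝ) :
    ∫ p, U p.1 ^ (2 / 3 : ℝ) * V (halfCorr p) ^ (2 / 3 : ℝ) *
        ((-s * (p.1 * A p.1) + c * s * A2 p.1) / U p.1)
        ∂(gaussianReal 0 1).prod (gaussianReal 0 1)
      = c * s / 3 * ∫ p, U p.1 ^ (2 / 3 : ℝ) * V (halfCorr p) ^ (2 / 3 : ℝ) *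
          ((A p.1 / U p.1) ^ 2 - (A p.1 / U p.1) * (B (halfCorr p) / V (halfCorr p)))
        ∂(gaussianReal 0 1).prod (gaussianReal 0 1) := by
  have hUm := h.measurable_zero
  have hVm := h'.measurable_zero
  have hAm := h.measurable_one
  have hBm := h'.measurable_one
  have hA2m := h.measurable_two
  have hym := measurable_halfCorr
  have hM := h.M_nonneg
  have hU0 := h.pos hδ
  have hV0 := h'.pos hδ
  set N := M ^ (2 / 3 : ℝ) * M ^ (2 / 3 : ℝ) with hN
  have hN0 : 0 ≤ N := by positivity
  have hJ := h.abs_rpow_mul_le h' hδ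
  have hAU := h.abs_div_le hδ
  have hA2U := h.abs_div_le' hδ
  have hBV := h'.abs_div_le hδ
  set K := M / δ with hK
  have hK0 : 0 ≤ K := by positivity
  have hbr : ∀ x y, |A2 x / U x - 1 / 3 * ((A x / U x) ^ 2 - (A x / U x) * (B y / V y))|
      ≤ K + K ^ 2 + K ^ 2 := by
    intro x y
    have h2 := hA2U x
    have h4 : |(A x / U x) ^ 2| ≤ K ^ 2 := by
      rw [abs_pow]; exact pow_le_pow_left₀ (abs_nonneg _) (hAU x) 2
    have h5 : |(A x / U x) * (B y / V y)| ≤ K ^ 2 := by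
      rw [abs_mul, sq]; exact mul_le_mul (hAU x) (hBV y) (abs_nonneg _) hK0
    rw [abs_le] at h2 h4 h5 ⊢
    constructor <;> nlinarith [sq_nonneg K]
  have i1 : Integrable (fun p : ℝ × ℝ => U p.1 ^ (2 / 3 : ℝ) * V (halfCorr p) ^ (2 / 3 : ℝ) *
      (p.1 * A p.1 / U p.1)) ((gaussianReal 0 1).prod (gaussianReal 0 1)) := by
    refine Integrable.mono' ((integrable_id_gaussianReal.comp_fst (gaussianReal 0 1)).abs.const_mul
      (N * K)) (Measurable.aestronglyMeasurable (by fun_prop))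
      (Filter.Eventually.of_forall fun p => ?_)
    rw [Real.norm_eq_abs, abs_mul, mul_div_assoc, abs_mul p.1]
    calc _ ≤ N * (|p.1| * K) := by
          refine mul_le_mul (hJ _ _) ?_ (by positivity) hN0
          gcongr
          exact hAU _
      _ = _ := by ring
  have i2 := h.integrable_of_bounded_factor h' hδ (w := fun p => A2 p.1 / U p.1) (by fun_prop)
    (fun p => hA2U p.1)
  have i3 := h.integrable_of_bounded_factor h' hδ
    (w := fun p => A2 p.1 / U p.1 - 1 / 3 * ((A p.1 / U p.1) ^ 2
      - (A p.1 / U p.1) * (B (halfCorr p) / V (halfCorr p)))) (by fun_prop) (fun p => hbr _ _)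
  have key : ∫ p, U p.1 ^ (2 / 3 : ℝ) * V (halfCorr p) ^ (2 / 3 : ℝ) * (p.1 * A p.1 / U p.1)
        ∂(gaussianReal 0 1).prod (gaussianReal 0 1)
      = c * ∫ p, U p.1 ^ (2 / 3 : ℝ) * V (halfCorr p) ^ (2 / 3 : ℝ) *
          (A2 p.1 / U p.1 - 1 / 3 * ((A p.1 / U p.1) ^ 2
            - (A p.1 / U p.1) * (B (halfCorr p) / V (halfCorr p))))
        ∂(gaussianReal 0 1).prod (gaussianReal 0 1) := by
    rw [integral_prod_symm _ i1, integral_prod_symm _ i3, ← integral_const_mul]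
    refine integral_congr_ae (Filter.Eventually.of_forall fun z => ?_)
    simp only
    rw [← integral_const_mul]
    have hder : ∀ x, HasDerivAt
        (fun x => U x ^ (2 / 3 : ℝ) * V (halfCorr (x, z)) ^ (2 / 3 : ℝ) * (A x / U x))
        (c * (U x ^ (2 / 3 : ℝ) * V (halfCorr (x, z)) ^ (2 / 3 : ℝ) *
          (A2 x / U x - 1 / 3 * ((A x / U x) ^ 2
            - (A x / U x) * (B (halfCorr (x, z)) / V (halfCorr (x, z))))))) x := by
      intro x
      have h1 : HasDerivAt (fun x => halfCorr (x, z)) (1 / 2) x := by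
        have := ((hasDerivAt_id x).const_mul (1 / 2 : ℝ)).add_const (√3 / 2 * z)
        simpa [halfCorr] using this
      have h2 := (h'.deriv_zero (halfCorr (x, z))).comp x h1
      have h3 := hasDerivAt_rpow_mul_rpow (k := 2 / 3) (h.deriv_zero x) h2 (hU0 x) (hV0 _)
      have h4 := (h.deriv_one x).div (h.deriv_zero x) (hU0 x).ne'
      have h5 := h3.mul h4
      refine h5.congr_deriv ?_
      have := (hU0 x).ne'
      have := (hV0 (halfCorr (x, z))).ne'
      simp only [Function.comp, Pi.div_apply]
      field_simp
      ring
    rw [← integral_id_mul_gaussianReal hder (C := N * (K + K ^ 2 + K ^ 2)) fun x => ?_]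
    · refine integral_congr_ae (Filter.Eventually.of_forall fun x => ?_)
      simp only
      ring
    · rw [abs_mul, abs_mul]
      calc _ ≤ 1 * (N * (K + K ^ 2 + K ^ 2)) := by
            gcongr
            · exact hJ _ _
            · exact hbr _ _
        _ = _ := one_mul _
  calc _ = ∫ p, (-s * (U p.1 ^ (2 / 3 : ℝ) * V (halfCorr p) ^ (2 / 3 : ℝ) * (p.1 * A p.1 / U p.1))
          + c * s * (U p.1 ^ (2 / 3 : ℝ) * V (halfCorr p) ^ (2 / 3 : ℝ) * (A2 p.1 / U p.1)))
          ∂(gaussianReal 0 1).prod (gaussianReal 0 1) := by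
        refine integral_congr_ae (Filter.Eventually.of_forall fun p => ?_)
        simp only
        ring
    _ = c * s * ((∫ p, U p.1 ^ (2 / 3 : ℝ) * V (halfCorr p) ^ (2 / 3 : ℝ) * (A2 p.1 / U p.1)
          ∂(gaussianReal 0 1).prod (gaussianReal 0 1))
        - ∫ p, U p.1 ^ (2 / 3 : ℝ) * V (halfCorr p) ^ (2 / 3 : ℝ) *
          (A2 p.1 / U p.1 - 1 / 3 * ((A p.1 / U p.1) ^ 2
            - (A p.1 / U p.1) * (B (halfCorr p) / V (halfCorr p))))
        ∂(gaussianReal 0 1).prod (gaussianReal 0 1)) := by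
        rw [integral_add (i1.const_mul _) (i2.const_mul _), integral_const_mul, integral_const_mul,
          key]
        ring
    _ = _ := by
        rw [← integral_sub i2 i3, div_eq_mul_one_div (c * s), mul_assoc (c * s),
          ← integral_const_mul (1 / 3 : ℝ)]
        congr 2
        ext p
        ring

/-- The derivative along the flow of `𝔼[U(X)^(2/3) V(Y)^(2/3)]` is nonnegative. After integration by
parts it is a multiple of `𝔼[U(X)^(2/3) V(Y)^(2/3) (A(X)/U(X) - B(Y)/V(Y))²]`. The square is
completed because the exponent `2/3` and the correlation `1/2` satisfy `1 - 2/3 = 2/3 * 1/2`. -/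
theorem integral_flow_nonneg (h : IsFlowProfile c δ M U A A2) (h' : IsFlowProfile c δ M V B B2)
    (hδ : 0 < δ) (hc : |c| ≤ 1) {s : ℝ} (hcs : 0 ≤ c * s) :
    0 ≤ (∫ p, U p.1 ^ (2 / 3 : ℝ) * V (halfCorr p) ^ (2 / 3 : ℝ) *
          ((-s * (p.1 * A p.1) + c * s * A2 p.1) / U p.1)
        ∂(gaussianReal 0 1).prod (gaussianReal 0 1))
      + ∫ p, U p.1 ^ (2 / 3 : ℝ) * V (halfCorr p) ^ (2 / 3 : ℝ) *
          ((-s * (halfCorr p * B (halfCorr p)) + c * s * B2 (halfCorr p)) / V (halfCorr p))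
        ∂(gaussianReal 0 1).prod (gaussianReal 0 1) := by
  have hUm := h.measurable_zero
  have hVm := h'.measurable_zero
  have hAm := h.measurable_one
  have hBm := h'.measurable_one
  have hB2m := h'.measurable_two
  have hym := measurable_halfCorr
  have hAU := h.abs_div_le hδ
  have hBV := h'.abs_div_le hδ
  have hM := h.M_nonneg
  have hbd : ∀ {a b : ℝ}, |a| ≤ M / δ → |b| ≤ M / δ → |a ^ 2 - a * b| ≤ 2 * (M / δ) ^ 2 := by
    intro a b ha hb
    have hK0 : 0 ≤ M / δ := by positivity
    have h4 : |a ^ 2| ≤ (M / δ) ^ 2 := by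
      rw [abs_pow]; exact pow_le_pow_left₀ (abs_nonneg _) ha 2
    have h5 : |a * b| ≤ (M / δ) ^ 2 := by
      rw [abs_mul, sq]; exact mul_le_mul ha hb (abs_nonneg _) hK0
    rw [abs_le] at h4 h5 ⊢
    constructor <;> linarith
  have i1 := h.integrable_of_bounded_factor h' hδ (w := fun p => (A p.1 / U p.1) ^ 2
      - (A p.1 / U p.1) * (B (halfCorr p) / V (halfCorr p))) (by fun_prop)
      (fun p => hbd (hAU _) (hBV _))
  have i2 := h.integrable_of_bounded_factor h' hδ (w := fun p => (B (halfCorr p) / V (halfCorr p)) ^ 2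
      - (B (halfCorr p) / V (halfCorr p)) * (A p.1 / U p.1)) (by fun_prop)
      (fun p => hbd (hBV _) (hAU _))
  rw [h.integral_by_parts h' hδ hc s,
    integral_halfCorr_swap (q := fun p => U p.1 ^ (2 / 3 : ℝ) * V p.2 ^ (2 / 3 : ℝ) *
      ((-s * (p.2 * B p.2) + c * s * B2 p.2) / V p.2)) (by fun_prop)]
  have h1 := h'.integral_by_parts h hδ hc s
  simp_rw [mul_comm (V _ ^ (2 / 3 : ℝ)) (U _ ^ (2 / 3 : ℝ))] at h1
  rw [h1, ← integral_halfCorr_swap (q := fun p => U p.1 ^ (2 / 3 : ℝ) * V p.2 ^ (2 / 3 : ℝ) *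
      ((B p.2 / V p.2) ^ 2 - (B p.2 / V p.2) * (A p.1 / U p.1))) (by fun_prop), ← mul_add,
    ← integral_add i1 i2]
  refine mul_nonneg (by linarith) (integral_nonneg fun p => ?_)
  have h2 := Real.rpow_nonneg (h.pos hδ p.1).le (2 / 3)
  have h3 := Real.rpow_nonneg (h'.pos hδ (halfCorr p)).le (2 / 3)
  calc (0 : ℝ) ≤ U p.1 ^ (2 / 3 : ℝ) * V (halfCorr p) ^ (2 / 3 : ℝ) *
        (A p.1 / U p.1 - B (halfCorr p) / V (halfCorr p)) ^ 2 := by positivity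
    _ = _ := by ring

end IsFlowProfile

end OneDim

/-! ### The Ornstein–Uhlenbeck flow on the line -/

section OneDim

/-- The Mehler operator of correlation `cos θ` on the line, `w ↦ 𝔼[w(cos θ x + sin θ Z)]`. -/
noncomputable def circAvg (θ : ℝ) (w : ℝ → ℝ) (x : ℝ) : ℝ :=
  ∫ z, w (Real.cos θ * x + Real.sin θ * z) ∂gaussianReal 0 1

variable {w w' w'' : ℝ → ℝ} {δ M θ : ℝ}

theorem measurable_circAvg (hw : Measurable w) : Measurable (circAvg θ w) := by
  have : Measurable (fun p : ℝ × ℝ => w (Real.cos θ * p.1 + Real.sin θ * p.2)) := by fun_prop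
  exact this.stronglyMeasurable.integral_prod_right'.measurable

theorem integrable_circAvg (hw : Measurable w) (hM : ∀ x, |w x| ≤ M) (x : ℝ) :
    Integrable (fun z => w (Real.cos θ * x + Real.sin θ * z)) (gaussianReal 0 1) :=
  integrable_of_abs_le (by fun_prop) fun _ => hM _

theorem abs_circAvg_le (hM : ∀ x, |w x| ≤ M) (x : ℝ) : |circAvg θ w x| ≤ M := by
  have := norm_integral_le_of_norm_le_const (μ := gaussianReal 0 1) (C := M)
    (f := fun z => w (Real.cos θ * x + Real.sin θ * z)) (Filter.Eventually.of_forall fun z => hM _)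
  simpa [circAvg] using this

theorem measurable_of_hasDerivAt (hw : ∀ x, HasDerivAt w (w' x) x) : Measurable w' := by
  have : w' = deriv w := funext fun x => (hw x).deriv.symm
  rw [this]
  exact measurable_deriv w

theorem measurable_of_hasDerivAt' (hw : ∀ x, HasDerivAt w (w' x) x) : Measurable w :=
  (continuous_iff_continuousAt.2 fun x => (hw x).continuousAt).measurable

theorem hasDerivAt_circAvg (hw : ∀ x, HasDerivAt w (w' x) x) (hM : ∀ x, |w x| ≤ M)
    (hM' : ∀ x, |w' x| ≤ M) (x : ℝ) :
    HasDerivAt (circAvg θ w) (Real.cos θ * circAvg θ w' x) x := by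
  have hwm := measurable_of_hasDerivAt' hw
  have hwm' := measurable_of_hasDerivAt hw
  have h := hasDerivAt_integral_of_dominated_loc_of_deriv_le (μ := gaussianReal 0 1) (x₀ := x)
    (s := Set.univ) (bound := fun _ => M)
    (F := fun x z => w (Real.cos θ * x + Real.sin θ * z))
    (F' := fun x z => Real.cos θ * w' (Real.cos θ * x + Real.sin θ * z)) Filter.univ_mem
    (Filter.Eventually.of_forall fun x => Measurable.aestronglyMeasurable (by fun_prop))
    (integrable_circAvg hwm hM x) (Measurable.aestronglyMeasurable (by fun_prop))
    (Filter.Eventually.of_forall fun z y _ => by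
      rw [Real.norm_eq_abs, abs_mul]
      calc _ ≤ 1 * M := mul_le_mul (Real.abs_cos_le_one θ) (hM' _) (abs_nonneg _) zero_le_one
        _ = M := one_mul M)
    (integrable_const _)
    (Filter.Eventually.of_forall fun z y _ => by
      have h1 : HasDerivAt (fun y => Real.cos θ * y + Real.sin θ * z) (Real.cos θ) y := by
        simpa using ((hasDerivAt_id y).const_mul (Real.cos θ)).add_const (Real.sin θ * z)
      have h2 := (hw (Real.cos θ * y + Real.sin θ * z)).comp y h1
      exact h2.congr_deriv (mul_comm _ _))
  have h2 := h.2
  rw [integral_const_mul] at h2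
  exact h2

/-- The evolution equation of the flow: the angular derivative is expressed through the first two
space derivatives, by integration by parts in the averaged variable. -/
theorem hasDerivAt_circAvg_angle (hw : ∀ x, HasDerivAt w (w' x) x)
    (hw' : ∀ x, HasDerivAt w' (w'' x) x) (hM : ∀ x, |w x| ≤ M)
    (hM' : ∀ x, |w' x| ≤ M) (hM'' : ∀ x, |w'' x| ≤ M) (x : ℝ) :
    HasDerivAt (fun θ => circAvg θ w x)
      (-Real.sin θ * (x * circAvg θ w' x) + Real.cos θ * Real.sin θ * circAvg θ w'' x) θ := by
  have hwm := measurable_of_hasDerivAt' hw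
  have hwm' := measurable_of_hasDerivAt hw
  have hM0 : 0 ≤ M := (abs_nonneg _).trans (hM 0)
  have h := hasDerivAt_integral_of_dominated_loc_of_deriv_le (μ := gaussianReal 0 1) (x₀ := θ)
    (s := Set.univ) (bound := fun z => M * (|x| + |z|))
    (F := fun θ z => w (Real.cos θ * x + Real.sin θ * z))
    (F' := fun θ z => w' (Real.cos θ * x + Real.sin θ * z) * (-Real.sin θ * x + Real.cos θ * z))
    Filter.univ_mem
    (Filter.Eventually.of_forall fun x => Measurable.aestronglyMeasurable (by fun_prop))
    (integrable_circAvg hwm hM x) (Measurable.aestronglyMeasurable (by fun_prop))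
    (Filter.Eventually.of_forall fun z y _ => by
      rw [Real.norm_eq_abs, abs_mul]
      refine mul_le_mul (hM' _) ((abs_add_le _ _).trans ?_) (abs_nonneg _) hM0
      rw [abs_mul, abs_mul, abs_neg]
      have h1 := Real.abs_sin_le_one y
      have h2 := Real.abs_cos_le_one y
      have h3 := abs_nonneg x
      have h4 := abs_nonneg z
      nlinarith)
    (((integrable_const _).add integrable_id_gaussianReal.abs).const_mul M)
    (Filter.Eventually.of_forall fun z y _ => by
      have h1 : HasDerivAt (fun y => Real.cos y * x + Real.sin y * z)
          (-Real.sin y * x + Real.cos y * z) y :=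
        ((Real.hasDerivAt_cos y).mul_const x).add ((Real.hasDerivAt_sin y).mul_const z)
      exact (hw (Real.cos y * x + Real.sin y * z)).comp y h1)
  have h2 := h.2
  refine h2.congr_deriv ?_
  have i1 : Integrable (fun z => w' (Real.cos θ * x + Real.sin θ * z)) (gaussianReal 0 1) :=
    integrable_circAvg hwm' hM' x
  have i2 : Integrable (fun z => z * w' (Real.cos θ * x + Real.sin θ * z)) (gaussianReal 0 1) := by
    refine Integrable.mono' (integrable_id_gaussianReal.abs.mul_const M)
      (Measurable.aestronglyMeasurable (by fun_prop)) (Filter.Eventually.of_forall fun z => ?_)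
    rw [Real.norm_eq_abs, abs_mul]
    gcongr
    exact hM' _
  have h3 : ∫ z, z * w' (Real.cos θ * x + Real.sin θ * z) ∂gaussianReal 0 1
      = Real.sin θ * circAvg θ w'' x := by
    rw [integral_id_mul_gaussianReal
      (q' := fun z => Real.sin θ * w'' (Real.cos θ * x + Real.sin θ * z)) (C := M)]
    · rw [integral_const_mul]; rfl
    · intro z
      have h1 : HasDerivAt (fun z => Real.cos θ * x + Real.sin θ * z) (Real.sin θ) z := by
        simpa using ((hasDerivAt_id z).const_mul (Real.sin θ)).const_add (Real.cos θ * x)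
      exact ((hw' _).comp z h1).congr_deriv (mul_comm _ _)
    · intro z
      rw [abs_mul]
      calc _ ≤ 1 * M := mul_le_mul (Real.abs_sin_le_one θ) (hM'' _) (abs_nonneg _) zero_le_one
        _ = M := one_mul M
  calc _ = ∫ z, ((-Real.sin θ * x) * w' (Real.cos θ * x + Real.sin θ * z)
          + Real.cos θ * (z * w' (Real.cos θ * x + Real.sin θ * z))) ∂gaussianReal 0 1 := by
        congr 1; ext z; ring
    _ = _ := by
        rw [integral_add (i1.const_mul _) (i2.const_mul _), integral_const_mul, integral_const_mul,
          h3]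
        simp only [circAvg]
        ring

/-- A `C²`-type function, bounded below by `δ` and above by `M` with its first two derivatives. -/
structure IsSmoothPos (δ M : ℝ) (w w' w'' : ℝ → ℝ) : Prop where
  deriv_zero : ∀ x, HasDerivAt w (w' x) x
  deriv_one : ∀ x, HasDerivAt w' (w'' x) x
  lower : ∀ x, δ ≤ w x
  upper : ∀ x, w x ≤ M
  bound_one : ∀ x, |w' x| ≤ M
  bound_two : ∀ x, |w'' x| ≤ M

variable {v v' v'' : ℝ → ℝ}

namespace IsSmoothPos

theorem abs_le (h : IsSmoothPos δ M w w' w'') (hδ : 0 < δ) (x : ℝ) : |w x| ≤ M := by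
  rw [abs_of_pos (hδ.trans_le (h.lower x))]
  exact h.upper x

theorem circAvg_ge (h : IsSmoothPos δ M w w' w'') (hδ : 0 < δ) (x : ℝ) : δ ≤ circAvg θ w x := by
  have := integral_mono (μ := gaussianReal 0 1) (integrable_const δ)
    (integrable_circAvg (θ := θ) (measurable_of_hasDerivAt' h.deriv_zero) (h.abs_le hδ) x)
    (fun z => h.lower _)
  simpa [circAvg] using this

theorem isFlowProfile (h : IsSmoothPos δ M w w' w'') (hδ : 0 < δ) (θ : ℝ) :
    IsFlowProfile (Real.cos θ) δ M (circAvg θ w) (circAvg θ w') (circAvg θ w'') where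
  deriv_zero := hasDerivAt_circAvg h.deriv_zero (h.abs_le hδ) h.bound_one
  deriv_one := hasDerivAt_circAvg h.deriv_one h.bound_one h.bound_two
  measurable_two := measurable_circAvg (measurable_of_hasDerivAt h.deriv_one)
  lower := h.circAvg_ge hδ
  upper x := (le_abs_self _).trans (abs_circAvg_le (h.abs_le hδ) x)
  bound_one := abs_circAvg_le h.bound_one
  bound_two := abs_circAvg_le h.bound_two

theorem integrable_halfCorr : Integrable halfCorr ((gaussianReal 0 1).prod (gaussianReal 0 1)) :=
  ((integrable_id_gaussianReal.comp_fst (gaussianReal 0 1)).const_mul (1 / 2)).add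
    ((integrable_id_gaussianReal.comp_snd (gaussianReal 0 1)).const_mul (√3 / 2))

/-- Hypercontractivity on the line for smooth positive functions, in the exponent-free form
`𝔼[u(X)^(2/3) v(Y)^(2/3)] ≤ 𝔼[u(X)]^(2/3) 𝔼[v(Y)]^(2/3)` for `X, Y` of correlation `1/2`.
The quantity `𝔼[U_θ(X)^(2/3) V_θ(Y)^(2/3)]` is nondecreasing along the flow. -/
theorem integral_rpow_mul_rpow_le (h : IsSmoothPos δ M w w' w'') (h' : IsSmoothPos δ M v v' v'')
    (hδ : 0 < δ) :
    ∫ p, w p.1 ^ (2 / 3 : ℝ) * v (halfCorr p) ^ (2 / 3 : ℝ)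
        ∂(gaussianReal 0 1).prod (gaussianReal 0 1)
      ≤ (∫ x, w x ∂gaussianReal 0 1) ^ (2 / 3 : ℝ) * (∫ x, v x ∂gaussianReal 0 1) ^ (2 / 3 : ℝ) := by
  set Φ : ℝ → ℝ := fun θ => ∫ p, circAvg θ w p.1 ^ (2 / 3 : ℝ) *
    circAvg θ v (halfCorr p) ^ (2 / 3 : ℝ) ∂(gaussianReal 0 1).prod (gaussianReal 0 1) with hΦ
  set R : (ℝ → ℝ) → (ℝ → ℝ) → ℝ → ℝ → ℝ := fun w' w'' θ x =>
    -Real.sin θ * (x * circAvg θ w' x) + Real.cos θ * Real.sin θ * circAvg θ w'' x with hR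
  have hM0 : 0 ≤ M := (abs_nonneg _).trans (h.bound_one 0)
  have hym := measurable_halfCorr
  have hRb : ∀ {w w' w'' : ℝ → ℝ}, IsSmoothPos δ M w w' w'' → ∀ θ x,
      |R w' w'' θ x / circAvg θ w x| ≤ M / δ * (|x| + 1) := by
    intro w w' w'' h θ x
    rw [abs_div, abs_of_pos (hδ.trans_le (h.circAvg_ge hδ x)), div_mul_eq_mul_div]
    refine div_le_div₀ (by positivity) ?_ hδ (h.circAvg_ge hδ x)
    refine (abs_add_le _ _).trans ?_
    rw [abs_mul, abs_mul, abs_mul, abs_mul, abs_neg]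
    have h1 := Real.abs_sin_le_one θ
    have h2 := Real.abs_cos_le_one θ
    have h3 : |circAvg θ w' x| ≤ M := abs_circAvg_le h.bound_one x
    have h4 : |circAvg θ w'' x| ≤ M := abs_circAvg_le h.bound_two x
    calc |Real.sin θ| * (|x| * |circAvg θ w' x|) + |Real.cos θ| * |Real.sin θ| * |circAvg θ w'' x|
        ≤ 1 * (|x| * M) + 1 * 1 * M := by gcongr
      _ = M * (|x| + 1) := by ring
  have hJb : ∀ θ x y, |circAvg θ w x ^ (2 / 3 : ℝ) * circAvg θ v y ^ (2 / 3 : ℝ)|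
      ≤ M ^ (2 / 3 : ℝ) * M ^ (2 / 3 : ℝ) := fun θ x y =>
    (h.isFlowProfile hδ θ).abs_rpow_mul_le (h'.isFlowProfile hδ θ) hδ x y
  set N := M ^ (2 / 3 : ℝ) * M ^ (2 / 3 : ℝ)
  have hN0 : 0 ≤ N := by positivity
  have hwm : ∀ θ, Measurable (circAvg θ w) := fun θ => (h.isFlowProfile hδ θ).measurable_zero
  have hvm : ∀ θ, Measurable (circAvg θ v) := fun θ => (h'.isFlowProfile hδ θ).measurable_zero
  have hRm : ∀ {w w' w'' : ℝ → ℝ}, IsSmoothPos δ M w w' w'' → ∀ θ, Measurable (R w' w'' θ) := by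
    intro w w' w'' h θ
    have h1 := (h.isFlowProfile hδ θ).measurable_one
    have h2 := (h.isFlowProfile hδ θ).measurable_two
    simp only [hR]
    fun_prop
  have hRw := hRm h
  have hRv := hRm h'
  have hder : ∀ θ, HasDerivAt Φ (∫ p, 2 / 3 * (circAvg θ w p.1 ^ (2 / 3 : ℝ) *
      circAvg θ v (halfCorr p) ^ (2 / 3 : ℝ)) * (R w' w'' θ p.1 / circAvg θ w p.1
        + R v' v'' θ (halfCorr p) / circAvg θ v (halfCorr p))
      ∂(gaussianReal 0 1).prod (gaussianReal 0 1)) θ := by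
    intro θ
    refine (hasDerivAt_integral_of_dominated_loc_of_deriv_le (x₀ := θ)
      (s := Set.univ)
      (bound := fun p => N * (M / δ * (|p.1| + 1) + M / δ * (|halfCorr p| + 1)))
      (F' := fun θ p => 2 / 3 * (circAvg θ w p.1 ^ (2 / 3 : ℝ) *
      circAvg θ v (halfCorr p) ^ (2 / 3 : ℝ)) * (R w' w'' θ p.1 / circAvg θ w p.1
        + R v' v'' θ (halfCorr p) / circAvg θ v (halfCorr p)))
      Filter.univ_mem ?_ ?_ ?_ ?_ ?_ ?_).2
    · refine Filter.Eventually.of_forall fun θ => Measurable.aestronglyMeasurable ?_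
      have := hwm θ
      have := hvm θ
      fun_prop
    · have := hwm θ
      have := hvm θ
      exact integrable_of_abs_le (M := N) (by fun_prop) fun p => hJb _ _ _
    · have := hwm θ
      have := hvm θ
      have := hRw θ
      have := hRv θ
      exact Measurable.aestronglyMeasurable (by fun_prop)
    · refine Filter.Eventually.of_forall fun p θ _ => ?_
      rw [Real.norm_eq_abs, abs_mul, abs_mul, abs_of_pos (by norm_num : (0 : ℝ) < 2 / 3)]
      refine mul_le_mul ?_ ((abs_add_le _ _).trans (add_le_add (hRb h _ _) (hRb h' _ _)))
        (abs_nonneg _) hN0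
      have := hJb θ p.1 (halfCorr p)
      have := abs_nonneg (circAvg θ w p.1 ^ (2 / 3 : ℝ) * circAvg θ v (halfCorr p) ^ (2 / 3 : ℝ))
      linarith
    · have i1 := (integrable_id_gaussianReal.comp_fst (gaussianReal 0 1)).abs
      have i2 := integrable_halfCorr.abs
      exact (((i1.add (integrable_const 1)).const_mul _).add
        ((i2.add (integrable_const 1)).const_mul _)).const_mul N
    · refine Filter.Eventually.of_forall fun p θ _ => ?_
      exact hasDerivAt_rpow_mul_rpow
        (hasDerivAt_circAvg_angle h.deriv_zero h.deriv_one (h.abs_le hδ) h.bound_one h.bound_two _)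
        (hasDerivAt_circAvg_angle h'.deriv_zero h'.deriv_one (h'.abs_le hδ) h'.bound_one
          h'.bound_two _)
        (hδ.trans_le (h.circAvg_ge hδ _)) (hδ.trans_le (h'.circAvg_ge hδ _))
  have hmono : MonotoneOn Φ (Set.Icc 0 (Real.pi / 2)) := by
    refine monotoneOn_of_deriv_nonneg (convex_Icc _ _)
      (fun θ _ => (hder θ).continuousAt.continuousWithinAt)
      (fun θ _ => (hder θ).differentiableAt.differentiableWithinAt) fun θ hθ => ?_
    rw [interior_Icc] at hθ
    rw [(hder θ).deriv]
    have hc : 0 ≤ Real.cos θ :=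
      Real.cos_nonneg_of_mem_Icc ⟨by linarith [hθ.1, Real.pi_pos], hθ.2.le⟩
    have hs : 0 ≤ Real.sin θ :=
      Real.sin_nonneg_of_nonneg_of_le_pi hθ.1.le (by linarith [hθ.2, Real.pi_pos])
    have hmain := (h.isFlowProfile hδ θ).integral_flow_nonneg (h'.isFlowProfile hδ θ) hδ
      (Real.abs_cos_le_one θ) (mul_nonneg hc hs)
    have hint : ∀ {q : ℝ × ℝ → ℝ} {r : ℝ × ℝ → ℝ}, Measurable q →
        Integrable r ((gaussianReal 0 1).prod (gaussianReal 0 1)) →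
        (∀ p, |q p| ≤ M / δ * (|r p| + 1)) →
        Integrable (fun p => circAvg θ w p.1 ^ (2 / 3 : ℝ) *
          circAvg θ v (halfCorr p) ^ (2 / 3 : ℝ) * q p)
          ((gaussianReal 0 1).prod (gaussianReal 0 1)) := by
      intro q r hq hr hqr
      have := hwm θ
      have := hvm θ
      refine Integrable.mono' (((hr.abs.add (integrable_const 1)).const_mul (M / δ)).const_mul N)
        (Measurable.aestronglyMeasurable (by fun_prop)) (Filter.Eventually.of_forall fun p => ?_)
      rw [Real.norm_eq_abs, abs_mul]
      exact mul_le_mul (hJb _ _ _) (hqr p) (abs_nonneg _) hN0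
    have := hwm θ
    have := hvm θ
    have := hRw θ
    have := hRv θ
    have j1 := hint (q := fun p => R w' w'' θ p.1 / circAvg θ w p.1) (by fun_prop)
      (integrable_id_gaussianReal.comp_fst (gaussianReal 0 1)) (fun p => hRb h θ p.1)
    have j2 := hint (q := fun p => R v' v'' θ (halfCorr p) / circAvg θ v (halfCorr p)) (by fun_prop)
      integrable_halfCorr (fun p => hRb h' θ (halfCorr p))
    have heq : ∫ p, 2 / 3 * (circAvg θ w p.1 ^ (2 / 3 : ℝ) *
      circAvg θ v (halfCorr p) ^ (2 / 3 : ℝ)) * (R w' w'' θ p.1 / circAvg θ w p.1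
        + R v' v'' θ (halfCorr p) / circAvg θ v (halfCorr p))
        ∂(gaussianReal 0 1).prod (gaussianReal 0 1)
        = 2 / 3 * ((∫ p, circAvg θ w p.1 ^ (2 / 3 : ℝ) * circAvg θ v (halfCorr p) ^ (2 / 3 : ℝ) *
            (R w' w'' θ p.1 / circAvg θ w p.1) ∂(gaussianReal 0 1).prod (gaussianReal 0 1))
          + ∫ p, circAvg θ w p.1 ^ (2 / 3 : ℝ) * circAvg θ v (halfCorr p) ^ (2 / 3 : ℝ) *
            (R v' v'' θ (halfCorr p) / circAvg θ v (halfCorr p))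
            ∂(gaussianReal 0 1).prod (gaussianReal 0 1)) := by
      rw [← integral_add j1 j2, ← integral_const_mul]
      congr 1
      ext p
      ring
    rw [heq]
    exact mul_nonneg (by norm_num) hmain
  have h0 := hmono ⟨le_rfl, by positivity⟩ ⟨by positivity, le_rfl⟩
    (by positivity : (0 : ℝ) ≤ Real.pi / 2)
  simpa [hΦ, circAvg] using h0

end IsSmoothPos

end OneDim

/-! ### Mollification -/

section Mollify

open scoped Convolution

variable {E : Type*} [NormedAddCommGroup E] [NormedSpace ℝ E] [FiniteDimensional ℝ E]
  [MeasurableSpace E] [BorelSpace E]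

/-- A sequence of smooth bump functions whose supports shrink to the origin. -/
noncomputable def bumpSeq (E : Type*) [NormedAddCommGroup E] [NormedSpace ℝ E] (m : ℕ) :
    ContDiffBump (0 : E) where
  rIn := 1 / (m + 1)
  rOut := 2 / (m + 1)
  rIn_pos := by positivity
  rIn_lt_rOut := by gcongr; norm_num

theorem tendsto_bumpSeq_rOut :
    Filter.Tendsto (fun m => (bumpSeq E m).rOut) Filter.atTop (nhds 0) := by
  have h := (tendsto_one_div_add_atTop_nhds_zero_nat (𝕜 := ℝ)).const_mul 2
  simpa [bumpSeq, div_eq_mul_inv] using h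

/-- The `m`-th mollification of a function. -/
noncomputable def mollify (m : ℕ) (q : E → ℝ) (μ : Measure E) : E → ℝ :=
  (bumpSeq E m).normed μ ⋆[ContinuousLinearMap.lsmul ℝ ℝ, μ] q

variable {μ : Measure E} [μ.IsAddHaarMeasure] {q : E → ℝ} {M : ℝ}

theorem abs_convolution_le {k : E → ℝ} (hk : Integrable k μ) (hM : ∀ x, |q x| ≤ M) (x : E) :
    |(k ⋆[ContinuousLinearMap.lsmul ℝ ℝ, μ] q) x| ≤ (∫ t, |k t| ∂μ) * M := by
  rw [convolution_def, ← integral_mul_const, ← Real.norm_eq_abs]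
  refine norm_integral_le_of_norm_le (hk.abs.mul_const M) (Filter.Eventually.of_forall fun t => ?_)
  simp only [ContinuousLinearMap.lsmul_apply, smul_eq_mul, Real.norm_eq_abs, abs_mul]
  gcongr
  exact hM _

theorem abs_mollify_le (hM : ∀ x, |q x| ≤ M) (m : ℕ) (x : E) : |mollify m q μ x| ≤ M := by
  refine (abs_convolution_le (bumpSeq E m).integrable_normed hM x).trans_eq ?_
  simp_rw [abs_of_nonneg ((bumpSeq E m).nonneg_normed _), (bumpSeq E m).integral_normed, one_mul]

theorem mollify_nonneg (hq : ∀ x, 0 ≤ q x) (m : ℕ) (x : E) : 0 ≤ mollify m q μ x := by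
  rw [mollify, convolution_def]
  refine integral_nonneg fun t => ?_
  exact mul_nonneg ((bumpSeq E m).nonneg_normed _) (hq _)

theorem tendsto_mollify (hq : Continuous q) (x : E) :
    Filter.Tendsto (fun m => mollify m q μ x) Filter.atTop (nhds (q x)) :=
  ContDiffBump.convolution_tendsto_right_of_continuous tendsto_bumpSeq_rOut hq x

end Mollify

section OneDim

/-- Adding `δ` to a mollification of a nonnegative bounded function makes it smooth and positive. The
bound can be enlarged at will, so that two functions may share it. -/
theorem exists_isSmoothPos_mollify {w : ℝ → ℝ} {M δ : ℝ} (hw : Continuous w)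
    (h0 : ∀ x, 0 ≤ w x) (hM : ∀ x, w x ≤ M) (m : ℕ) :
    ∃ N w' w'', ∀ N' ≥ N, IsSmoothPos δ N' (fun x => mollify m w volume x + δ) w' w'' := by
  have habs : ∀ x, |w x| ≤ M := fun x => by rw [abs_of_nonneg (h0 x)]; exact hM x
  set k := (bumpSeq ℝ m).normed volume with hk
  have hk1 : HasCompactSupport k := (bumpSeq ℝ m).hasCompactSupport_normed
  have hk2 : ContDiff ℝ 2 k := (bumpSeq ℝ m).contDiff_normed
  have hk2' : ContDiff ℝ 1 (deriv k) := (contDiff_succ_iff_deriv.1 hk2).2.2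
  have hk3 : Continuous (deriv (deriv k)) := hk2'.continuous_deriv le_rfl
  have hloc : LocallyIntegrable w := hw.locallyIntegrable
  have d1 := hk1.hasDerivAt_convolution_left (ContinuousLinearMap.lsmul ℝ ℝ) (hk2.of_le one_le_two)
    hloc
  have d2 := hk1.deriv.hasDerivAt_convolution_left (ContinuousLinearMap.lsmul ℝ ℝ) hk2' hloc
  have b1 := abs_convolution_le (hk2'.continuous.integrable_of_hasCompactSupport hk1.deriv
    (μ := volume)) habs
  have b2 := abs_convolution_le (hk3.integrable_of_hasCompactSupport hk1.deriv.deriv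
    (μ := volume)) habs
  refine ⟨max (M + δ) (max ((∫ t, |deriv k t|) * M) ((∫ t, |deriv (deriv k) t|) * M)), _, _,
    fun N' hN' => ⟨fun x => (d1 x).add_const δ, d2, fun x => ?_, fun x => ?_, fun x => ?_,
      fun x => ?_⟩⟩
  · linarith [mollify_nonneg (μ := volume) h0 m x]
  · refine le_trans ?_ ((le_max_left _ _).trans hN')
    linarith [(le_abs_self _).trans (abs_mollify_le (μ := volume) habs m x)]
  · exact (b1 x).trans (((le_max_left _ _).trans (le_max_right _ _)).trans hN')
  · exact (b2 x).trans (((le_max_right _ _).trans (le_max_right _ _)).trans hN')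

/-- Hypercontractivity on the line for correlation `1/2`. -/
theorem integral_rpow_mul_rpow_halfCorr_le {u v : ℝ → ℝ} {M : ℝ} (hu : Continuous u)
    (hv : Continuous v) (hu0 : ∀ x, 0 ≤ u x) (hv0 : ∀ x, 0 ≤ v x) (huM : ∀ x, u x ≤ M)
    (hvM : ∀ x, v x ≤ M) :
    ∫ p, u p.1 ^ (2 / 3 : ℝ) * v (halfCorr p) ^ (2 / 3 : ℝ)
        ∂(gaussianReal 0 1).prod (gaussianReal 0 1)
      ≤ (∫ x, u x ∂gaussianReal 0 1) ^ (2 / 3 : ℝ) * (∫ x, v x ∂gaussianReal 0 1) ^ (2 / 3 : ℝ) := by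
  set a : (ℝ → ℝ) → ℕ → ℝ → ℝ := fun w m x => mollify m w volume x + 1 / ((m : ℝ) + 1) with ha
  have hpos : ∀ m : ℕ, (0 : ℝ) < 1 / ((m : ℝ) + 1) := fun m => by positivity
  have hle1 : ∀ m : ℕ, 1 / ((m : ℝ) + 1) ≤ 1 := fun m => by
    rw [div_le_one (by positivity)]; linarith [Nat.cast_nonneg (α := ℝ) m]
  have hlim : ∀ {w : ℝ → ℝ}, Continuous w → ∀ x,
      Filter.Tendsto (fun m => a w m x) Filter.atTop (nhds (w x)) := fun hw x => by
    simpa [ha] using (tendsto_mollify (μ := volume) hw x).add tendsto_one_div_add_atTop_nhds_zero_nat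
  have habs : ∀ {w : ℝ → ℝ}, (∀ x, 0 ≤ w x) → (∀ x, w x ≤ M) → ∀ x, |w x| ≤ M := fun h0 h1 x => by
    rw [abs_of_nonneg (h0 x)]; exact h1 x
  have hbd : ∀ {w : ℝ → ℝ}, (∀ x, 0 ≤ w x) → (∀ x, w x ≤ M) → ∀ m x, a w m x ≤ M + 1 :=
    fun h0 h1 m x => add_le_add
      ((le_abs_self _).trans (abs_mollify_le (habs h0 h1) m x)) (hle1 m)
  have hnn : ∀ {w : ℝ → ℝ}, (∀ x, 0 ≤ w x) → ∀ m x, 0 ≤ a w m x :=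
    fun h0 m x => add_nonneg (mollify_nonneg (μ := volume) h0 m x) (hpos m).le
  have hmeas : ∀ {w : ℝ → ℝ}, Continuous w → (∀ x, 0 ≤ w x) → (∀ x, w x ≤ M) → ∀ m,
      Measurable (a w m) := fun hw h0 h1 m => by
    obtain ⟨N, w', w'', h⟩ := exists_isSmoothPos_mollify (δ := 1 / ((m : ℝ) + 1)) hw h0 h1 m
    exact measurable_of_hasDerivAt' (h N le_rfl).deriv_zero
  have hM1 : 0 ≤ M + 1 := (hnn hu0 0 0).trans (hbd hu0 huM 0 0)
  have hum := hmeas hu hu0 huM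
  have hvm := hmeas hv hv0 hvM
  have hym := measurable_halfCorr
  have hstep : ∀ m, ∫ p, a u m p.1 ^ (2 / 3 : ℝ) * a v m (halfCorr p) ^ (2 / 3 : ℝ)
        ∂(gaussianReal 0 1).prod (gaussianReal 0 1)
      ≤ (∫ x, a u m x ∂gaussianReal 0 1) ^ (2 / 3 : ℝ)
        * (∫ x, a v m x ∂gaussianReal 0 1) ^ (2 / 3 : ℝ) := fun m => by
    obtain ⟨N, w', w'', h⟩ := exists_isSmoothPos_mollify hu hu0 huM m
    obtain ⟨N', v', v'', h'⟩ := exists_isSmoothPos_mollify hv hv0 hvM m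
    exact (h (max N N') (le_max_left _ _)).integral_rpow_mul_rpow_le (h' _ (le_max_right _ _))
      (hpos m)
  have hint : ∀ {w : ℝ → ℝ}, Continuous w → (∀ x, 0 ≤ w x) → (∀ x, w x ≤ M) →
      Filter.Tendsto (fun m => ∫ x, a w m x ∂gaussianReal 0 1) Filter.atTop
        (nhds (∫ x, w x ∂gaussianReal 0 1)) := fun hw h0 h1 =>
    tendsto_integral_of_dominated_convergence (fun _ => M + 1)
      (fun m => (hmeas hw h0 h1 m).aestronglyMeasurable) (integrable_const _)
      (fun m => Filter.Eventually.of_forall fun x => by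
        rw [Real.norm_eq_abs, abs_of_nonneg (hnn h0 m x)]; exact hbd h0 h1 m x)
      (Filter.Eventually.of_forall fun x => hlim hw x)
  refine le_of_tendsto_of_tendsto' ?_
    (((hint hu hu0 huM).rpow_const (Or.inr (by norm_num))).mul
      ((hint hv hv0 hvM).rpow_const (Or.inr (by norm_num)))) hstep
  refine tendsto_integral_of_dominated_convergence
    (fun _ => (M + 1) ^ (2 / 3 : ℝ) * (M + 1) ^ (2 / 3 : ℝ)) (fun m => ?_) (integrable_const _)
    (fun m => Filter.Eventually.of_forall fun p => ?_) (Filter.Eventually.of_forall fun p => ?_)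
  · have := hum m
    have := hvm m
    exact Measurable.aestronglyMeasurable (by fun_prop)
  · have h1 := hnn hu0 m p.1
    have h2 := hnn hv0 m (halfCorr p)
    rw [Real.norm_eq_abs, abs_of_nonneg (by positivity)]
    gcongr
    · exact hbd hu0 huM m _
    · exact hbd hv0 hvM m _
  · exact ((hlim hu _).rpow_const (Or.inr (by norm_num))).mul
      ((hlim hv _).rpow_const (Or.inr (by norm_num)))

end OneDim

/-! ### Hypercontractivity in any dimension, by tensorization -/

section Tensor

/-- The standard Gaussian measure on `ℝⁿ`. -/
noncomputable def stdGauss (n : ℕ) : Measure (Fin n → ℝ) :=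
  Measure.pi fun _ => gaussianReal 0 1

instance (n : ℕ) : IsProbabilityMeasure (stdGauss n) := by
  unfold stdGauss; infer_instance

instance (n : ℕ) : IsGaussian (stdGauss n) := by
  have h1 : iIndepFun (fun (i : Fin n) (x : Fin n → ℝ) => x i) (stdGauss n) :=
    iIndepFun_pi (X := fun _ x => x) fun _ => aemeasurable_id
  have h2 := iIndepFun.hasGaussianLaw (fun i => ?_) h1
  · have h3 := h2.isGaussian_map
    have : (stdGauss n).map (fun (x : Fin n → ℝ) i => x i) = stdGauss n := Measure.map_id
    rwa [this] at h3
  · have h4 := (measurePreserving_eval (fun _ : Fin n => gaussianReal 0 1) i).map_eq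
    refine ⟨?_⟩
    change IsGaussian ((stdGauss n).map (Function.eval i))
    rw [stdGauss, h4]
    infer_instance

theorem measurePreserving_stdGauss_eval {n : ℕ} (i : Fin n) :
    MeasurePreserving (fun x : Fin n → ℝ => x i) (stdGauss n) (gaussianReal 0 1) :=
  measurePreserving_eval (fun _ : Fin n => gaussianReal 0 1) i

theorem integral_id_stdGauss (n : ℕ) : ∫ x, x ∂stdGauss n = 0 := by
  ext i
  have h1 := ContinuousLinearMap.integral_comp_comm (ContinuousLinearMap.proj (R := ℝ) i)
    (IsGaussian.integrable_id (μ := stdGauss n))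
  simp only [ContinuousLinearMap.proj_apply, id] at h1
  have h2 := (measurePreserving_stdGauss_eval i).map_eq
  have h3 : ∫ x, x i ∂stdGauss n = ∫ y, y ∂gaussianReal 0 1 := by
    rw [← h2, integral_map (measurable_pi_apply i).aemeasurable (by fun_prop)]
  rw [← h1, h3]
  simp

theorem measurePreserving_insertNth {n : ℕ} (i : Fin (n + 1)) :
    MeasurePreserving (fun p : ℝ × (Fin n → ℝ) => (i.insertNth p.1 p.2 : Fin (n + 1) → ℝ))
      ((gaussianReal 0 1).prod (stdGauss n)) (stdGauss (n + 1)) :=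
  (measurePreserving_piFinSuccAbove (fun _ : Fin (n + 1) => gaussianReal 0 1) i).symm

theorem integral_stdGauss_succ {n : ℕ} (i : Fin (n + 1)) {q : (Fin (n + 1) → ℝ) → ℝ}
    (hq : Integrable q (stdGauss (n + 1))) :
    ∫ x, q x ∂stdGauss (n + 1)
      = ∫ x, ∫ a, q (i.insertNth a x) ∂gaussianReal 0 1 ∂stdGauss n := by
  have h := measurePreserving_insertNth (n := n) i
  rw [← h.map_eq, integral_map h.measurable.aemeasurable
    (by rw [h.map_eq]; exact hq.aestronglyMeasurable), integral_prod_symm]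
  exact h.integrable_comp_of_integrable hq

theorem measurePreserving_prod_comm_four {α β : Type*} [MeasurableSpace α] [MeasurableSpace β]
    (μ : Measure α) (ν : Measure β) [IsProbabilityMeasure μ] [IsProbabilityMeasure ν] :
    MeasurePreserving (fun p : (α × α) × (β × β) => ((p.1.1, p.2.1), (p.1.2, p.2.2)))
      ((μ.prod μ).prod (ν.prod ν)) ((μ.prod ν).prod (μ.prod ν)) := by
  have h1 := measurePreserving_prodAssoc μ μ (ν.prod ν)
  have h2 := (measurePreserving_prodAssoc μ ν ν).symm
  have h3 := (Measure.measurePreserving_swap (μ := μ) (ν := ν)).prod (MeasurePreserving.id ν)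
  have h4 := measurePreserving_prodAssoc ν μ ν
  have h5 := (measurePreserving_prodAssoc μ ν (μ.prod ν)).symm
  exact h5.comp (((MeasurePreserving.id μ).prod (h4.comp (h3.comp h2))).comp h1)

/-- Hypercontractivity of the Gaussian measure on `ℝⁿ`, for correlation `1/2`, by induction on the
dimension. -/
theorem integral_rpow_mul_rpow_le_stdGauss (n : ℕ) {u v : (Fin n → ℝ) → ℝ} {M : ℝ}
    (hu : Continuous u) (hv : Continuous v) (hu0 : ∀ x, 0 ≤ u x) (hv0 : ∀ x, 0 ≤ v x)
    (huM : ∀ x, u x ≤ M) (hvM : ∀ x, v x ≤ M) :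
    ∫ p, u p.1 ^ (2 / 3 : ℝ) * v ((1 / 2 : ℝ) • p.1 + (√3 / 2) • p.2) ^ (2 / 3 : ℝ)
        ∂(stdGauss n).prod (stdGauss n)
      ≤ (∫ x, u x ∂stdGauss n) ^ (2 / 3 : ℝ) * (∫ x, v x ∂stdGauss n) ^ (2 / 3 : ℝ) := by
  induction n with
  | zero =>
    have h : ∀ x : Fin 0 → ℝ, x = 0 := fun x => Subsingleton.elim _ _
    have h1 : ∀ q : (Fin 0 → ℝ) → ℝ, ∫ x, q x ∂stdGauss 0 = q 0 := fun q => by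
      have : q = fun _ => q 0 := by ext x; rw [h x]
      rw [this]; simp
    have h2 : ∀ p : (Fin 0 → ℝ) × (Fin 0 → ℝ),
        u p.1 ^ (2 / 3 : ℝ) * v ((1 / 2 : ℝ) • p.1 + (√3 / 2) • p.2) ^ (2 / 3 : ℝ)
          = u 0 ^ (2 / 3 : ℝ) * v 0 ^ (2 / 3 : ℝ) := fun p => by
      rw [h p.1, h ((1 / 2 : ℝ) • 0 + (√3 / 2) • p.2)]
    simp_rw [h1, h2]
    simp
  | succ n ih =>
    have hM : 0 ≤ M := (hu0 0).trans (huM 0)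
    have hcons : Continuous fun p : ℝ × (Fin n → ℝ) => (Fin.cons p.1 p.2 : Fin (n + 1) → ℝ) := by
      fun_prop
    have hcons1 : ∀ a : ℝ, Continuous fun x : Fin n → ℝ => (Fin.cons a x : Fin (n + 1) → ℝ) :=
      fun a => by fun_prop
    have hcons2 : ∀ x : Fin n → ℝ, Continuous fun a : ℝ => (Fin.cons a x : Fin (n + 1) → ℝ) :=
      fun x => by fun_prop
    -- the partial integrals in the first coordinate
    set pu : (Fin n → ℝ) → ℝ := fun x => ∫ a, u (Fin.cons a x) ∂gaussianReal 0 1 with hpu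
    set pv : (Fin n → ℝ) → ℝ := fun x => ∫ a, v (Fin.cons a x) ∂gaussianReal 0 1 with hpv
    have hpc : ∀ {w : (Fin (n + 1) → ℝ) → ℝ}, Continuous w → (∀ x, 0 ≤ w x) → (∀ x, w x ≤ M) →
        Continuous (fun x => ∫ a, w (Fin.cons a x) ∂gaussianReal 0 1) := by
      intro w hw h0 h1
      refine continuous_of_dominated (bound := fun _ => M)
        (fun x => (hw.comp (hcons2 x)).aestronglyMeasurable)
        (fun x => Filter.Eventually.of_forall fun a => ?_) (integrable_const _)
        (Filter.Eventually.of_forall fun a => hw.comp (hcons1 a))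
      rw [Real.norm_eq_abs, abs_of_nonneg (h0 _)]; exact h1 _
    have hpM : ∀ {w : (Fin (n + 1) → ℝ) → ℝ}, Continuous w → (∀ x, 0 ≤ w x) → (∀ x, w x ≤ M) →
        ∀ x, ∫ a, w (Fin.cons a x) ∂gaussianReal 0 1 ≤ M := by
      intro w hw h0 h1 x
      have := integral_mono (μ := gaussianReal 0 1) (f := fun a => w (Fin.cons a x))
        (g := fun _ => M) (integrable_of_abs_le (M := M) (hw.comp (hcons2 x)).measurable
          (fun a => by rw [abs_of_nonneg (h0 _)]; exact h1 _)) (integrable_const _) (fun a => h1 _)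
      simpa using this
    have hint : ∀ {w : (Fin (n + 1) → ℝ) → ℝ}, Continuous w → (∀ x, 0 ≤ w x) → (∀ x, w x ≤ M) →
        ∫ x, w x ∂stdGauss (n + 1)
          = ∫ x, ∫ a, w (Fin.cons a x) ∂gaussianReal 0 1 ∂stdGauss n := by
      intro w hw h0 h1
      rw [integral_stdGauss_succ 0]
      · simp only [Fin.insertNth_zero']
      · exact integrable_of_abs_le (M := M) hw.measurable
          fun x => by rw [abs_of_nonneg (h0 _)]; exact h1 _
    have hI := ih (hpc hu hu0 huM) (hpc hv hv0 hvM) (fun x => integral_nonneg fun a => hu0 _)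
      (fun x => integral_nonneg fun a => hv0 _) (hpM hu hu0 huM) (hpM hv hv0 hvM)
    rw [hint hu hu0 huM, hint hv hv0 hvM]
    refine le_trans ?_ hI
    have hmp : MeasurePreserving (fun p : (ℝ × ℝ) × ((Fin n → ℝ) × (Fin n → ℝ)) =>
        ((Fin.cons p.1.1 p.2.1 : Fin (n + 1) → ℝ), (Fin.cons p.1.2 p.2.2 : Fin (n + 1) → ℝ)))
        (((gaussianReal 0 1).prod (gaussianReal 0 1)).prod ((stdGauss n).prod (stdGauss n)))
        ((stdGauss (n + 1)).prod (stdGauss (n + 1))) := by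
      have h := measurePreserving_insertNth (n := n) 0
      simp only [Fin.insertNth_zero'] at h
      exact (h.prod h).comp (measurePreserving_prod_comm_four (gaussianReal 0 1) (stdGauss n))
    have hJm : Continuous fun p : (Fin (n + 1) → ℝ) × (Fin (n + 1) → ℝ) =>
        u p.1 ^ (2 / 3 : ℝ) * v ((1 / 2 : ℝ) • p.1 + (√3 / 2) • p.2) ^ (2 / 3 : ℝ) := by
      refine Continuous.mul ?_ ?_
      · exact (hu.comp continuous_fst).rpow_const fun _ => Or.inr (by norm_num)
      · exact (hv.comp (by fun_prop)).rpow_const fun _ => Or.inr (by norm_num)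
    have hJb : ∀ x y, |u x ^ (2 / 3 : ℝ) * v y ^ (2 / 3 : ℝ)|
        ≤ M ^ (2 / 3 : ℝ) * M ^ (2 / 3 : ℝ) := fun x y => by
      have h1 := hu0 x
      have h2 := hv0 y
      rw [abs_of_nonneg (by positivity)]
      gcongr
      · exact huM x
      · exact hvM y
    have hcomb : ∀ (a b : ℝ) (x z : Fin n → ℝ), (1 / 2 : ℝ) • (Fin.cons a x : Fin (n + 1) → ℝ)
        + (√3 / 2) • (Fin.cons b z : Fin (n + 1) → ℝ)
        = Fin.cons (halfCorr (a, b)) ((1 / 2 : ℝ) • x + (√3 / 2) • z) := by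
      intro a b x z
      ext i
      refine Fin.cases ?_ (fun j => ?_) i <;> simp [halfCorr]
    -- for fixed values of the other coordinates, use the inequality on the line in the first one
    rw [← hmp.map_eq, integral_map hmp.measurable.aemeasurable hJm.aestronglyMeasurable]
    simp only [hcomb]
    rw [integral_prod_symm]
    · refine integral_mono_of_nonneg (Filter.Eventually.of_forall fun q => ?_) ?_
        (Filter.Eventually.of_forall fun q => ?_)
      · refine integral_nonneg fun p => ?_
        exact mul_nonneg (Real.rpow_nonneg (hu0 _) _) (Real.rpow_nonneg (hv0 _) _)
      · have h1 := hpc hu hu0 huM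
        have h2 := hpc hv hv0 hvM
        refine integrable_of_abs_le (M := M ^ (2 / 3 : ℝ) * M ^ (2 / 3 : ℝ)) ?_ fun q => ?_
        · exact (h1.measurable.comp measurable_fst).pow_const _ |>.mul
            ((h2.measurable.comp (by fun_prop)).pow_const _)
        · have h3 : 0 ≤ pu q.1 := integral_nonneg fun a => hu0 _
          have h4 : 0 ≤ pv ((1 / 2 : ℝ) • q.1 + (√3 / 2) • q.2) := integral_nonneg fun a => hv0 _
          rw [abs_of_nonneg (by positivity)]
          gcongr
          · exact hpM hu hu0 huM _
          · exact hpM hv hv0 hvM _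
      · exact integral_rpow_mul_rpow_halfCorr_le (hu.comp (hcons2 q.1))
          (hv.comp (hcons2 ((1 / 2 : ℝ) • q.1 + (√3 / 2) • q.2))) (fun _ => hu0 _) (fun _ => hv0 _)
          (fun _ => huM _) (fun _ => hvM _)
    · refine integrable_of_abs_le (M := M ^ (2 / 3 : ℝ) * M ^ (2 / 3 : ℝ)) ?_ fun p => hJb _ _
      have := hJm.measurable.comp hmp.measurable
      simpa only [Function.comp_def, hcomb] using this

end Tensor

/-! ### Talagrand's `L¹`–`L²` inequality in Gauss space -/

section Talagrand

variable {n : ℕ}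

/-- Hypercontractivity combined with the Cauchy–Schwarz inequality
`(∫ |g|^(3/2))² ≤ ∫ |g| ∫ g²`. -/
theorem autocorr_half_le {g : (Fin n → ℝ) → ℝ} {M : ℝ} (hg : Continuous g) (hM : ∀ x, |g x| ≤ M)
    (hA : 0 < ∫ x, g x ^ 2 ∂stdGauss n) :
    autocorr (stdGauss n) g (1 / 2) ≤ (∫ x, g x ^ 2 ∂stdGauss n) *
      ((∫ x, |g x| ∂stdGauss n) / √(∫ x, g x ^ 2 ∂stdGauss n)) ^ (2 / 3 : ℝ) := by
  set A := ∫ x, g x ^ 2 ∂stdGauss n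
  set B := ∫ x, |g x| ∂stdGauss n
  have hB : 0 ≤ B := integral_nonneg fun x => abs_nonneg _
  have hM0 : 0 ≤ M := (abs_nonneg _).trans (hM 0)
  have hgm := hg.measurable
  have hsqrt : √(1 - (1 / 2 : ℝ) ^ 2) = √3 / 2 := by
    rw [show (1 : ℝ) - (1 / 2) ^ 2 = 3 / 2 ^ 2 by norm_num, Real.sqrt_div (by norm_num),
      Real.sqrt_sq (by norm_num)]
  set u : (Fin n → ℝ) → ℝ := fun x => |g x| ^ (3 / 2 : ℝ) with hu
  have hu0 : ∀ x, 0 ≤ u x := fun x => Real.rpow_nonneg (abs_nonneg _) _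
  have huc : Continuous u := hg.abs.rpow_const fun _ => Or.inr (by norm_num)
  have huM : ∀ x, u x ≤ M ^ (3 / 2 : ℝ) := fun x =>
    Real.rpow_le_rpow (abs_nonneg _) (hM x) (by norm_num)
  have hur : ∀ x, u x ^ (2 / 3 : ℝ) = |g x| := fun x => by
    simp only [hu]
    rw [← Real.rpow_mul (abs_nonneg _)]
    norm_num
  have hhyp := integral_rpow_mul_rpow_le_stdGauss n huc huc hu0 hu0 huM huM
  set I := ∫ x, u x ∂stdGauss n with hI
  have hI0 : 0 ≤ I := integral_nonneg hu0
  have hCS : I ^ 2 ≤ A * B := by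
    have h := sq_integral_mul_le (μ := stdGauss n) (p := fun x => |g x|)
      (q := fun x => |g x| ^ (1 / 2 : ℝ))
      (MemLp.of_bound hgm.abs.aestronglyMeasurable M
        (Filter.Eventually.of_forall fun x => by simpa using hM x))
      (MemLp.of_bound (hgm.abs.pow_const _).aestronglyMeasurable (M ^ (1 / 2 : ℝ))
        (Filter.Eventually.of_forall fun x => by
          rw [Real.norm_eq_abs, abs_of_nonneg (Real.rpow_nonneg (abs_nonneg _) _)]
          exact Real.rpow_le_rpow (abs_nonneg _) (hM x) (by norm_num)))
    have h1 : ∀ x, |g x| * |g x| ^ (1 / 2 : ℝ) = u x := fun x => by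
      simp only [hu]
      rw [show (3 / 2 : ℝ) = 1 + 1 / 2 by norm_num,
        Real.rpow_add_of_nonneg (abs_nonneg _) (by norm_num) (by norm_num), Real.rpow_one]
    have h2 : ∀ x, (|g x| ^ (1 / 2 : ℝ)) ^ 2 = |g x| := fun x => by
      rw [← Real.sqrt_eq_rpow, Real.sq_sqrt (abs_nonneg _)]
    simpa only [h1, h2, sq_abs] using h
  calc autocorr (stdGauss n) g (1 / 2)
      = ∫ p, g p.1 * g ((1 / 2 : ℝ) • p.1 + (√3 / 2) • p.2)
          ∂(stdGauss n).prod (stdGauss n) := by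
        rw [autocorr, integral_mul_mehler hgm hgm hM hM, hsqrt]
    _ ≤ ∫ p, u p.1 ^ (2 / 3 : ℝ) * u ((1 / 2 : ℝ) • p.1 + (√3 / 2) • p.2) ^ (2 / 3 : ℝ)
          ∂(stdGauss n).prod (stdGauss n) := by
        simp only [hur]
        have hb : ∀ x y, |g x| * |g y| ≤ M * M := fun x y =>
          mul_le_mul (hM x) (hM y) (abs_nonneg _) hM0
        refine integral_mono (integrable_of_abs_le (M := M * M) (by fun_prop) fun p => ?_)
          (integrable_of_abs_le (M := M * M) (by fun_prop) fun p => ?_) fun p => ?_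
        · rw [abs_mul]; exact hb _ _
        · rw [abs_mul, abs_abs, abs_abs]; exact hb _ _
        · exact (le_abs_self _).trans_eq (abs_mul _ _)
    _ ≤ I ^ (2 / 3 : ℝ) * I ^ (2 / 3 : ℝ) := hhyp
    _ = (I ^ 2) ^ (2 / 3 : ℝ) := by rw [← Real.mul_rpow hI0 hI0, sq]
    _ ≤ (A * B) ^ (2 / 3 : ℝ) := by gcongr
    _ = A * (B / √A) ^ (2 / 3 : ℝ) := by
        rw [Real.mul_rpow hA.le hB, Real.div_rpow hB (Real.sqrt_nonneg _), Real.sqrt_eq_rpow,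
          ← Real.rpow_mul hA.le, mul_div_assoc', mul_div_right_comm]
        congr 1
        rw [eq_div_iff (Real.rpow_pos_of_pos hA _).ne', ← Real.rpow_add hA]
        norm_num

/-- The contribution of one coordinate to Talagrand's inequality is controlled by an explicit
profile `ρ ↦ A (ρ ^ a + b)` whose integral over `[0, 1]` is at most `4 A / (1 + log (√A / B))`. -/
theorem exists_autocorr_profile {g : (Fin n → ℝ) → ℝ} {M : ℝ} (hg : Continuous g)
    (hM : ∀ x, |g x| ≤ M) :
    ∃ a b : ℝ, 0 ≤ a ∧
      (∀ ρ, 0 ≤ ρ → ρ ≤ 1 →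
        autocorr (stdGauss n) g ρ ≤ (∫ x, g x ^ 2 ∂stdGauss n) * (ρ ^ a + b)) ∧
      (∫ x, g x ^ 2 ∂stdGauss n) * (1 / (a + 1) + b)
        ≤ 4 * ((∫ x, g x ^ 2 ∂stdGauss n) * logFactor g (stdGauss n)) := by
  have hγ := integral_id_stdGauss n
  have hgm := hg.measurable
  have hM0 : 0 ≤ M := (abs_nonneg _).trans (hM 0)
  have hL2 : MemLp g 2 (stdGauss n) :=
    MemLp.of_bound hgm.aestronglyMeasurable M (Filter.Eventually.of_forall hM)
  have hA0 : 0 ≤ ∫ x, g x ^ 2 ∂stdGauss n := integral_nonneg fun x => sq_nonneg _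
  have hB0 : 0 ≤ ∫ x, |g x| ∂stdGauss n := integral_nonneg fun x => abs_nonneg _
  rcases hA0.eq_or_lt with hA | hA
  · refine ⟨0, 0, le_rfl, fun ρ h0 h1 => ?_, ?_⟩
    · rw [← hA, zero_mul, hA, ← autocorr_one]
      exact autocorr_mono hγ hgm hM h0 h1 le_rfl
    · simp [← hA]
  have hB : 0 < ∫ x, |g x| ∂stdGauss n := by
    refine hB0.lt_of_ne fun h => hA.ne ?_
    have h1 : ∫ x, g x ^ 2 ∂stdGauss n ≤ M * ∫ x, |g x| ∂stdGauss n := by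
      rw [← integral_const_mul]
      refine integral_mono hL2.integrable_sq ((hL2.integrable one_le_two).abs.const_mul M)
        fun x => ?_
      simp only
      rw [← sq_abs, sq]
      exact mul_le_mul_of_nonneg_right (hM x) (abs_nonneg _)
    rw [← h, mul_zero] at h1
    exact le_antisymm hA0 h1
  have hle : ∫ x, |g x| ∂stdGauss n ≤ √(∫ x, g x ^ 2 ∂stdGauss n) := by
    have h := sq_integral_mul_le (μ := stdGauss n) hL2.abs (memLp_const (1 : ℝ))
    refine Real.le_sqrt_of_sq_le ?_
    simpa using h
  have hhalf := autocorr_half_le hg hM hA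
  set A := ∫ x, g x ^ 2 ∂stdGauss n with hAdef
  set B := ∫ x, |g x| ∂stdGauss n with hBdef
  have hsA : 0 < √A := Real.sqrt_pos.2 hA
  have hr0 : 0 < B / √A := by positivity
  have hr1 : B / √A ≤ 1 := by rwa [div_le_one hsA]
  have hlog : 0 ≤ -Real.log (B / √A) := neg_nonneg.2 (Real.log_nonpos hr0.le hr1)
  have hlog2 : 0 < Real.log 2 := Real.log_pos one_lt_two
  refine ⟨-Real.log (B / √A) / (3 * Real.log 2), (B / √A) ^ (2 / 3 : ℝ), by positivity,
    fun ρ h0 h1 => ?_, ?_⟩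
  · exact autocorr_le_of_autocorr_half_le hγ hgm hM hr0 hr1 hhalf h0 h1
  · have hfac : logFactor g (stdGauss n) = (1 + -Real.log (B / √A))⁻¹ := by
      rw [logFactor, if_neg hB.ne', ← Real.log_inv, inv_div]
    rw [hfac]
    set l := -Real.log (B / √A) with hl
    -- the constant `4` is `5/2 + 3/2`, one term for each part of the profile
    have h1 : (B / √A) ^ (2 / 3 : ℝ) ≤ (3 / 2) * (1 + l)⁻¹ := by
      have h2 : (B / √A) ^ (2 / 3 : ℝ) = (Real.exp (2 / 3 * l))⁻¹ := by
        rw [Real.rpow_def_of_pos hr0, ← Real.exp_neg, hl]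
        ring_nf
      have h3 : (2 / 3) * (1 + l) ≤ Real.exp (2 / 3 * l) := by
        linarith [Real.add_one_le_exp (2 / 3 * l)]
      rw [h2]
      calc (Real.exp (2 / 3 * l))⁻¹ ≤ ((2 / 3) * (1 + l))⁻¹ := by gcongr
        _ = (3 / 2) * (1 + l)⁻¹ := by rw [mul_inv]; norm_num
    have h4 : 1 / (l / (3 * Real.log 2) + 1) ≤ (5 / 2) * (1 + l)⁻¹ := by
      have h5 : 3 * Real.log 2 ≤ 5 / 2 := by linarith [Real.log_two_lt_d9]
      have h6 : (2 / 5) * (1 + l) ≤ l / (3 * Real.log 2) + 1 := by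
        have h7 : (2 / 5) * l ≤ l / (3 * Real.log 2) := by
          rw [le_div_iff₀ (by positivity)]
          nlinarith
        linarith
      calc 1 / (l / (3 * Real.log 2) + 1) ≤ 1 / ((2 / 5) * (1 + l)) :=
            one_div_le_one_div_of_le (by positivity) h6
        _ = (5 / 2) * (1 + l)⁻¹ := by rw [one_div, mul_inv]; norm_num
    calc A * (1 / (l / (3 * Real.log 2) + 1) + (B / √A) ^ (2 / 3 : ℝ))
        ≤ A * ((5 / 2) * (1 + l)⁻¹ + (3 / 2) * (1 + l)⁻¹) := by gcongr
      _ = 4 * (A * (1 + l)⁻¹) := by ring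

section Smooth

variable {F : (Fin n → ℝ) → ℝ} {C : ℝ}

theorem abs_le_of_fderiv_le (hF : Differentiable ℝ F) (hC : ∀ x, ‖fderiv ℝ F x‖ ≤ C)
    (x : Fin n → ℝ) : |F x| ≤ |F 0| + C * ‖x‖ := by
  have h := (convex_univ (𝕜 := ℝ) (E := Fin n → ℝ)).norm_image_sub_le_of_norm_fderiv_le
    (f := F) (C := C) (fun y _ => hF y) (fun y _ => hC y) (Set.mem_univ 0) (Set.mem_univ x)
  simp only [Real.norm_eq_abs, sub_zero] at h
  have h2 := abs_sub_abs_le_abs_sub (F x) (F 0)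
  linarith

theorem integrable_norm_stdGauss : Integrable (fun x => ‖x‖) (stdGauss n) :=
  (IsGaussian.integrable_id (μ := stdGauss n)).norm

theorem integrable_norm_sq_stdGauss : Integrable (fun x => ‖x‖ ^ 2) (stdGauss n) :=
  (IsGaussian.memLp_two_id (μ := stdGauss n)).integrable_norm_pow (by norm_num)

theorem memLp_two_of_abs_le (hF : Measurable F) {a b : ℝ} (h : ∀ x, |F x| ≤ a + b * ‖x‖) :
    MemLp F 2 (stdGauss n) := by
  have hid : MemLp (fun x : Fin n → ℝ => ‖x‖) 2 (stdGauss n) :=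
    (IsGaussian.memLp_two_id (μ := stdGauss n)).norm
  have h1 : MemLp (fun x : Fin n → ℝ => b * ‖x‖) 2 (stdGauss n) := hid.const_mul b
  have h0 : MemLp (fun _ : Fin n → ℝ => a) 2 (stdGauss n) := memLp_const a
  refine (h0.add h1).mono hF.aestronglyMeasurable (Filter.Eventually.of_forall fun x => ?_)
  exact (h x).trans (le_abs_self _)

theorem integrable_eval_mul (hF : ContDiff ℝ 1 F) (hC : ∀ x, ‖fderiv ℝ F x‖ ≤ C) (k : Fin n) :
    Integrable (fun x => x k * F x) (stdGauss n) := by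
  have hFc := hF.continuous
  refine Integrable.mono' ((integrable_norm_stdGauss.const_mul |F 0|).add
    (integrable_norm_sq_stdGauss.const_mul C)) (by fun_prop) (Filter.Eventually.of_forall fun x => ?_)
  rw [Real.norm_eq_abs, abs_mul]
  calc |x k| * |F x| ≤ ‖x‖ * (|F 0| + C * ‖x‖) :=
        mul_le_mul (norm_le_pi_norm x k) (abs_le_of_fderiv_le (hF.differentiable one_ne_zero) hC x)
          (abs_nonneg _) (norm_nonneg _)
    _ = _ := by simp only [Pi.add_apply]; ring

/-- Gaussian integration by parts on `ℝⁿ`. -/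
theorem integral_eval_mul_stdGauss (hF : ContDiff ℝ 1 F) (hC : ∀ x, ‖fderiv ℝ F x‖ ≤ C)
    (k : Fin n) :
    ∫ x, x k * F x ∂stdGauss n = ∫ x, fderiv ℝ F x (Pi.single k 1) ∂stdGauss n := by
  cases n with
  | zero => exact k.elim0
  | succ n =>
    have hC0 : 0 ≤ C := (norm_nonneg _).trans (hC 0)
    have hsingle : ‖(Pi.single k 1 : Fin (n + 1) → ℝ)‖ = 1 := by simp [Pi.norm_single]
    have hb : ∀ x, |fderiv ℝ F x (Pi.single k 1)| ≤ C := fun x => by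
      have := (fderiv ℝ F x).le_of_opNorm_le (hC x) (Pi.single k 1)
      rwa [hsingle, mul_one] at this
    have hDc : Continuous fun x => fderiv ℝ F x (Pi.single k 1) :=
      (hF.continuous_fderiv one_ne_zero).clm_apply continuous_const
    rw [integral_stdGauss_succ k (integrable_eval_mul hF hC k),
      integral_stdGauss_succ k (integrable_of_abs_le hDc.measurable hb)]
    refine integral_congr_ae (Filter.Eventually.of_forall fun x => ?_)
    simp only [Fin.insertNth_apply_same]
    refine integral_id_mul_gaussianReal (C := C) (fun t => ?_) (fun t => hb _)
    have h1 : HasDerivAt (fun t : ℝ => (k.insertNth t x : Fin (n + 1) → ℝ))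
        (Pi.single k 1) t := by
      rw [hasDerivAt_pi]
      intro j
      refine Fin.succAboveCases k ?_ (fun i => ?_) j
      · simpa using hasDerivAt_id' t
      · simpa [Fin.succAbove_ne] using hasDerivAt_const t (x i)
    exact (hF.differentiable one_ne_zero _).hasFDerivAt.comp_hasDerivAt t h1

/-- The derivative of `θ ↦ 𝔼[F(X) F(cos θ X + sin θ Z)]` is
`- sin θ ∑ₖ 𝔼[∂ₖF(X) ∂ₖF(cos θ X + sin θ Z)]`. -/
theorem hasDerivAt_integral_mul_rotation (hF : ContDiff ℝ 1 F) (hC : ∀ x, ‖fderiv ℝ F x‖ ≤ C)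
    {θ : ℝ} (hs : 0 ≤ Real.sin θ) :
    HasDerivAt (fun θ => ∫ p, F p.1 * F (Real.cos θ • p.1 + Real.sin θ • p.2)
        ∂(stdGauss n).prod (stdGauss n))
      (-Real.sin θ * ∑ k, autocorr (stdGauss n) (fun x => fderiv ℝ F x (Pi.single k 1))
        (Real.cos θ)) θ := by
  have hγ := integral_id_stdGauss n
  have hFc := hF.continuous
  have hFd := hF.differentiable one_ne_zero
  have hDc := hF.continuous_fderiv one_ne_zero
  have hC0 : 0 ≤ C := (norm_nonneg _).trans (hC 0)
  have hgr := abs_le_of_fderiv_le hFd hC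
  have hrot : ∀ (θ : ℝ) (p : (Fin n → ℝ) × (Fin n → ℝ)),
      ‖Real.cos θ • p.1 + Real.sin θ • p.2‖ ≤ ‖p.1‖ + ‖p.2‖ := fun θ p => by
    refine (norm_add_le _ _).trans (add_le_add ?_ ?_)
    · rw [norm_smul]
      exact mul_le_of_le_one_left (norm_nonneg _) (Real.abs_cos_le_one θ)
    · rw [norm_smul]
      exact mul_le_of_le_one_left (norm_nonneg _) (Real.abs_sin_le_one θ)
  have hrot' : ∀ (θ : ℝ) (p : (Fin n → ℝ) × (Fin n → ℝ)),
      ‖-Real.sin θ • p.1 + Real.cos θ • p.2‖ ≤ ‖p.1‖ + ‖p.2‖ := fun θ p => by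
    refine (norm_add_le _ _).trans (add_le_add ?_ ?_)
    · rw [norm_smul, norm_neg]
      exact mul_le_of_le_one_left (norm_nonneg _) (Real.abs_sin_le_one θ)
    · rw [norm_smul]
      exact mul_le_of_le_one_left (norm_nonneg _) (Real.abs_cos_le_one θ)
  set γγ := (stdGauss n).prod (stdGauss n) with hγγ
  have i1 : Integrable (fun p : (Fin n → ℝ) × (Fin n → ℝ) => ‖p.1‖) γγ :=
    integrable_norm_stdGauss.comp_fst _
  have i2 : Integrable (fun p : (Fin n → ℝ) × (Fin n → ℝ) => ‖p.2‖) γγ :=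
    integrable_norm_stdGauss.comp_snd _
  have i11 : Integrable (fun p : (Fin n → ℝ) × (Fin n → ℝ) => ‖p.1‖ ^ 2) γγ :=
    integrable_norm_sq_stdGauss.comp_fst _
  have i22 : Integrable (fun p : (Fin n → ℝ) × (Fin n → ℝ) => ‖p.2‖ ^ 2) γγ :=
    integrable_norm_sq_stdGauss.comp_snd _
  -- a quadratic integrable function dominating everything below
  have hdom : ∀ a b : ℝ, Integrable (fun p : (Fin n → ℝ) × (Fin n → ℝ) =>
      (a + b * (‖p.1‖ + ‖p.2‖)) ^ 2) γγ := by
    intro a b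
    have i12 : Integrable (fun p : (Fin n → ℝ) × (Fin n → ℝ) => ‖p.1‖ * ‖p.2‖) γγ :=
      integrable_norm_stdGauss.mul_prod integrable_norm_stdGauss
    refine (((integrable_const (a ^ 2)).add ((i1.add i2).const_mul (2 * a * b))).add
      (((i11.add i22).add (i12.const_mul 2)).const_mul (b ^ 2))).congr
      (Filter.Eventually.of_forall fun p => ?_)
    simp only [Pi.add_apply]
    ring
  have hder := hasDerivAt_integral_of_dominated_loc_of_deriv_le (μ := γγ) (x₀ := θ)
    (s := Set.univ) (bound := fun p => (|F 0| + C * (‖p.1‖ + ‖p.2‖)) ^ 2)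
    (F := fun θ p => F p.1 * F (Real.cos θ • p.1 + Real.sin θ • p.2))
    (F' := fun θ p => F p.1 * fderiv ℝ F (Real.cos θ • p.1 + Real.sin θ • p.2)
      (-Real.sin θ • p.1 + Real.cos θ • p.2)) Filter.univ_mem
    (Filter.Eventually.of_forall fun θ => Continuous.aestronglyMeasurable (by fun_prop)) ?_
    (Continuous.aestronglyMeasurable ?_) (Filter.Eventually.of_forall fun p θ _ => ?_)
    (hdom _ _) (Filter.Eventually.of_forall fun p θ _ => ?_)
  rotate_left
  · refine Integrable.mono' (hdom |F 0| C) (Continuous.aestronglyMeasurable (by fun_prop))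
      (Filter.Eventually.of_forall fun p => ?_)
    rw [Real.norm_eq_abs, abs_mul, sq]
    refine mul_le_mul ((hgr _).trans ?_) ((hgr _).trans ?_) (abs_nonneg _) (by positivity)
    · gcongr; linarith [norm_nonneg p.2]
    · gcongr; exact hrot θ p
  · exact (hFc.comp continuous_fst).mul
      ((hDc.comp (by fun_prop)).clm_apply (by fun_prop))
  · rw [Real.norm_eq_abs, abs_mul, sq]
    refine mul_le_mul ((hgr _).trans ?_)
      (((fderiv ℝ F _).le_of_opNorm_le (hC _) _).trans ?_) (abs_nonneg _) (by positivity)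
    · gcongr; linarith [norm_nonneg p.2]
    · have h1 : C * ‖-Real.sin θ • p.1 + Real.cos θ • p.2‖ ≤ C * (‖p.1‖ + ‖p.2‖) := by
        gcongr; exact hrot' θ p
      linarith [abs_nonneg (F 0)]
  · have h1 : HasDerivAt (fun θ => Real.cos θ • p.1 + Real.sin θ • p.2)
        (-Real.sin θ • p.1 + Real.cos θ • p.2) θ :=
      ((Real.hasDerivAt_cos θ).smul_const p.1).add ((Real.hasDerivAt_sin θ).smul_const p.2)
    exact ((hFd _).hasFDerivAt.comp_hasDerivAt θ h1).const_mul (F p.1)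
  refine hder.2.congr_deriv ?_
  -- rotate so that the derivative falls on an independent variable, then integrate by parts
  set c := Real.cos θ with hc
  set s := Real.sin θ with hsdef
  have hcs : c ^ 2 + s ^ 2 = 1 := by rw [hc, hsdef]; exact Real.cos_sq_add_sin_sq θ
  have hsq : √(1 - c ^ 2) = s := by
    rw [show 1 - c ^ 2 = s ^ 2 by linarith, Real.sqrt_sq hs]
  have hR := measurePreserving_reflection hγ hs hcs
  set G : (Fin n → ℝ) × (Fin n → ℝ) → ℝ := fun q =>
    F (c • q.1 + s • q.2) * fderiv ℝ F q.1 (-q.2) with hG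
  have hGc : Continuous G :=
    (hFc.comp (by fun_prop)).mul ((hDc.comp continuous_fst).clm_apply (by fun_prop))
  have hGi : Integrable G γγ := by
    refine Integrable.mono' (hdom |F 0| C) hGc.aestronglyMeasurable
      (Filter.Eventually.of_forall fun p => ?_)
    rw [Real.norm_eq_abs, abs_mul, sq]
    refine mul_le_mul ((hgr _).trans ?_)
      (((fderiv ℝ F _).le_of_opNorm_le (hC _) _).trans ?_) (abs_nonneg _) (by positivity)
    · gcongr; exact hrot θ p
    · rw [norm_neg]
      have := norm_nonneg p.1
      have := abs_nonneg (F 0)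
      nlinarith
  have h1 : ∫ p, F p.1 * fderiv ℝ F (c • p.1 + s • p.2) (-s • p.1 + c • p.2) ∂γγ
      = ∫ q, G q ∂γγ := by
    conv_rhs => rw [hγγ, ← hR.map_eq]
    rw [integral_map hR.measurable.aemeasurable hGc.aestronglyMeasurable]
    refine integral_congr_ae (Filter.Eventually.of_forall fun p => ?_)
    simp only [hG]
    congr 2
    · have : c • (c • p.1 + s • p.2) + s • (s • p.1 - c • p.2) = (c ^ 2 + s ^ 2) • p.1 := by module
      rw [this, hcs, one_smul]
    · module
  rw [h1, hγγ, integral_prod _ hGi, Finset.mul_sum]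
  have hb : ∀ k x, |fderiv ℝ F x (Pi.single k 1)| ≤ C := fun k x => by
    have := (fderiv ℝ F x).le_of_opNorm_le (hC x) (Pi.single k 1)
    rwa [Pi.norm_single, norm_one, mul_one] at this
  have hgm : ∀ k, Measurable fun x => fderiv ℝ F x (Pi.single k 1) := fun k =>
    (hDc.clm_apply continuous_const).measurable
  have hcoord : ∀ a b : Fin n → ℝ, fderiv ℝ F a (-b)
      = -∑ k, b k * fderiv ℝ F a (Pi.single k 1) := by
    intro a b
    rw [map_neg]
    conv_lhs => rw [pi_eq_sum_univ' b]
    rw [map_sum]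
    simp_rw [map_smul, smul_eq_mul]
  have hdil : ∀ a, ContDiff ℝ 1 fun b : Fin n → ℝ => F (c • a + s • b) := fun a =>
    hF.comp (by fun_prop)
  have hdild : ∀ a b, fderiv ℝ (fun b : Fin n → ℝ => F (c • a + s • b)) b
      = s • fderiv ℝ F (c • a + s • b) := by
    intro a b
    have h2 : HasFDerivAt (fun b : Fin n → ℝ => c • a + s • b)
        (s • ContinuousLinearMap.id ℝ (Fin n → ℝ)) b :=
      ((hasFDerivAt_id b).const_smul s).const_add _
    have h3 : HasFDerivAt (fun b : Fin n → ℝ => F (c • a + s • b)) _ b :=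
      (hFd _).hasFDerivAt.comp b h2
    rw [h3.fderiv]
    ext v
    simp
  have hdilb : ∀ a b, ‖fderiv ℝ (fun b : Fin n → ℝ => F (c • a + s • b)) b‖ ≤ C := by
    intro a b
    rw [hdild, norm_smul]
    exact (mul_le_of_le_one_left (norm_nonneg _) (Real.abs_sin_le_one θ)).trans (hC _)
  have hinner : ∀ a, ∫ b, G (a, b) ∂stdGauss n
      = ∑ k, -s * (fderiv ℝ F a (Pi.single k 1) *
        mehler (stdGauss n) c (fun x => fderiv ℝ F x (Pi.single k 1)) a) := by
    intro a
    have h2 : ∀ b, G (a, b) = ∑ k, -fderiv ℝ F a (Pi.single k 1) * (b k * F (c • a + s • b)) := by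
      intro b
      simp only [hG, hcoord, mul_neg, Finset.mul_sum, ← Finset.sum_neg_distrib]
      refine Finset.sum_congr rfl fun k _ => ?_
      ring
    simp_rw [h2]
    rw [integral_finsetSum _ fun k _ => (integrable_eval_mul (hdil a) (hdilb a) k).const_mul _]
    refine Finset.sum_congr rfl fun k _ => ?_
    rw [integral_const_mul, integral_eval_mul_stdGauss (hdil a) (hdilb a) k]
    simp_rw [hdild, FunLike.coe_smul, Pi.smul_apply, smul_eq_mul]
    rw [integral_const_mul, mehler, hsq]
    ring
  simp_rw [hinner]
  rw [integral_finsetSum]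
  · refine Finset.sum_congr rfl fun k _ => ?_
    rw [integral_const_mul, autocorr]
  · intro k _
    refine Integrable.const_mul (integrable_of_abs_le (M := C * C)
      ((hgm k).mul (measurable_mehler (hgm k))) fun x => ?_) _
    rw [Pi.mul_apply, abs_mul]
    exact mul_le_mul (hb k x) (abs_mehler_le (hb k) x) (abs_nonneg _) hC0

/-- Talagrand's inequality for functions of class `C¹` with bounded derivative. The variance is the
decrease of `θ ↦ 𝔼[F(X) F(cos θ X + sin θ Z)]` between `0` and `π/2`, and its derivative is compared
with that of an explicit function. -/
theorem variance_le_of_contDiff (hF : ContDiff ℝ 1 F) (hC : ∀ x, ‖fderiv ℝ F x‖ ≤ C) :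
    Var[F; stdGauss n] ≤ 4 * ∑ k, (∫ x, fderiv ℝ F x (Pi.single k 1) ^ 2 ∂stdGauss n) *
      logFactor (fun x => fderiv ℝ F x (Pi.single k 1)) (stdGauss n) := by
  have hb : ∀ k x, |fderiv ℝ F x (Pi.single k 1)| ≤ C := fun k x => by
    have := (fderiv ℝ F x).le_of_opNorm_le (hC x) (Pi.single k 1)
    rwa [Pi.norm_single, norm_one, mul_one] at this
  have hDc : ∀ k, Continuous fun x => fderiv ℝ F x (Pi.single k 1) := fun k =>
    (hF.continuous_fderiv one_ne_zero).clm_apply continuous_const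
  choose a b ha hab hint using fun k => exists_autocorr_profile (hDc k) (hb k)
  set A : Fin n → ℝ := fun k => ∫ x, fderiv ℝ F x (Pi.single k 1) ^ 2 ∂stdGauss n with hA
  set Ψ : ℝ → ℝ := fun θ => ∫ p, F p.1 * F (Real.cos θ • p.1 + Real.sin θ • p.2)
        ∂(stdGauss n).prod (stdGauss n) with hΨ
  -- the profile bounds integrate explicitly in `θ`
  set W : ℝ → ℝ := fun θ => ∑ k, -(A k * (Real.cos θ ^ (a k + 1) / (a k + 1)
    + b k * Real.cos θ)) with hW
  have hWd : ∀ θ, HasDerivAt W (∑ k, Real.sin θ * (A k * (Real.cos θ ^ a k + b k))) θ := by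
    intro θ
    refine HasDerivAt.fun_sum fun k _ => ?_
    have hak : a k + 1 ≠ 0 := by linarith [ha k]
    have h1 := ((Real.hasDerivAt_cos θ).rpow_const (p := a k + 1)
      (Or.inr (by linarith [ha k]))).div_const (a k + 1)
    have h2 := ((h1.add ((Real.hasDerivAt_cos θ).const_mul (b k))).const_mul (A k)).neg
    refine h2.congr_deriv ?_
    rw [add_sub_cancel_right]
    field_simp
    ring
  have hsin : ∀ θ ∈ Set.Icc 0 (Real.pi / 2), 0 ≤ Real.sin θ := fun θ hθ =>
    Real.sin_nonneg_of_nonneg_of_le_pi hθ.1 (by linarith [hθ.2, Real.pi_pos])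
  have hcos : ∀ θ ∈ Set.Icc 0 (Real.pi / 2), 0 ≤ Real.cos θ := fun θ hθ =>
    Real.cos_nonneg_of_mem_Icc ⟨by linarith [hθ.1, Real.pi_pos], hθ.2⟩
  have hΨd : ∀ θ ∈ Set.Icc 0 (Real.pi / 2), HasDerivAt Ψ _ θ := fun θ hθ =>
    hasDerivAt_integral_mul_rotation hF hC (hsin θ hθ)
  have hmono : MonotoneOn (fun θ => Ψ θ + W θ) (Set.Icc 0 (Real.pi / 2)) := by
    refine monotoneOn_of_deriv_nonneg (convex_Icc _ _)
      (fun θ hθ => ((hΨd θ hθ).fun_add (hWd θ)).continuousAt.continuousWithinAt)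
      (fun θ hθ => ?_) fun θ hθ => ?_
    · exact ((hΨd θ (interior_subset hθ)).fun_add
        (hWd θ)).differentiableAt.differentiableWithinAt
    · have hθ' := interior_subset hθ
      rw [((hΨd θ hθ').fun_add (hWd θ)).deriv, Finset.mul_sum, ← Finset.sum_add_distrib]
      refine Finset.sum_nonneg fun k _ => ?_
      have h1 := hab k _ (hcos θ hθ') (Real.cos_le_one θ)
      have h2 := hsin θ hθ'
      nlinarith
  have h0 := hmono ⟨le_rfl, by positivity⟩ ⟨by positivity, le_rfl⟩
    (by positivity : (0 : ℝ) ≤ Real.pi / 2)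
  have hFc := hF.continuous
  have hL2 := memLp_two_of_abs_le hFc.measurable
    (abs_le_of_fderiv_le (hF.differentiable one_ne_zero) hC)
  have hΨ0 : Ψ 0 = ∫ x, F x ^ 2 ∂stdGauss n := by
    have h := (measurePreserving_fst (μ := stdGauss n) (ν := stdGauss n)).map_eq
    simp only [hΨ, Real.cos_zero, Real.sin_zero, one_smul, zero_smul, add_zero]
    rw [← h, integral_map measurable_fst.aemeasurable (by fun_prop), h]
    simp_rw [sq]
  have hΨ1 : Ψ (Real.pi / 2) = (∫ x, F x ∂stdGauss n) ^ 2 := by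
    simp only [hΨ, Real.cos_pi_div_two, Real.sin_pi_div_two, one_smul, zero_smul, zero_add]
    rw [integral_prod_mul, sq]
  have hW0 : W 0 = -∑ k, A k * (1 / (a k + 1) + b k) := by
    simp [hW]
  have hW1 : W (Real.pi / 2) = 0 := by
    simp only [hW, Real.cos_pi_div_two]
    refine Finset.sum_eq_zero fun k _ => ?_
    rw [Real.zero_rpow (by linarith [ha k])]
    simp
  rw [variance_eq_sub hL2]
  have h2 : ∑ k, A k * (1 / (a k + 1) + b k) ≤ ∑ k, 4 * (A k *
      logFactor (fun x => fderiv ℝ F x (Pi.single k 1)) (stdGauss n)) :=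
    Finset.sum_le_sum fun k _ => hint k
  rw [← Finset.mul_sum] at h2
  simp only [hΨ0, hΨ1, hW0, hW1] at h0
  simp only [Pi.pow_apply]
  linarith

end Smooth

end Talagrand

/-! ### Extension of Talagrand's inequality to Lipschitz functions -/

section LipschitzTalagrand

variable {n : ℕ}

theorem stdGauss_absolutelyContinuous (n : ℕ) : stdGauss n ≪ volume := by
  induction n with
  | zero =>
    rw [volume_pi]
    refine (Eq.le ?_).absolutelyContinuous
    rw [stdGauss, Measure.pi_of_empty, Measure.pi_of_empty]
  | succ n ih =>
    have h1 := (gaussianReal_absolutelyContinuous 0 one_ne_zero).prod ih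
    have h2 := (measurePreserving_insertNth (n := n) 0)
    have h3 : MeasurePreserving
        (fun p : ℝ × (Fin n → ℝ) => ((0 : Fin (n + 1)).insertNth p.1 p.2 : Fin (n + 1) → ℝ))
        (volume.prod volume) volume :=
      (volume_preserving_piFinSuccAbove (fun _ : Fin (n + 1) => ℝ) 0).symm
    have h4 := h1.map h2.measurable
    rwa [h2.map_eq, h3.map_eq] at h4

theorem logFactor_nonneg_and_le_one {α : Type*} [MeasurableSpace α] {μ : Measure α}
    [IsProbabilityMeasure μ] {X : α → ℝ} (hX : MemLp X 2 μ) :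
    0 ≤ logFactor X μ ∧ logFactor X μ ≤ 1 := by
  rw [logFactor]
  split_ifs with h
  · exact ⟨le_rfl, zero_le_one⟩
  · have hB0 : 0 ≤ ∫ x, |X x| ∂μ := integral_nonneg fun x => abs_nonneg _
    have hB : 0 < ∫ x, |X x| ∂μ := lt_of_le_of_ne hB0 (Ne.symm h)
    have hle : ∫ x, |X x| ∂μ ≤ √(∫ x, X x ^ 2 ∂μ) := by
      have h := sq_integral_mul_le (μ := μ) hX.abs (memLp_const (1 : ℝ))
      refine Real.le_sqrt_of_sq_le ?_
      simpa using h
    have h1 : 0 ≤ Real.log (√(∫ x, X x ^ 2 ∂μ) / ∫ x, |X x| ∂μ) :=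
      Real.log_nonneg ((one_le_div hB).2 hle)
    exact ⟨by positivity, inv_le_one_of_one_le₀ (by linarith)⟩

/-- The terms of Talagrand's inequality are continuous under convergence of the first two absolute
moments. Where the limit vanishes, this holds because the logarithmic factor is at most `1`. -/
theorem tendsto_integral_sq_mul_logFactor {α : Type*} [MeasurableSpace α] {μ : Measure α}
    [IsProbabilityMeasure μ] {X : ℕ → α → ℝ} {Y : α → ℝ} (hX : ∀ m, MemLp (X m) 2 μ)
    (hY : MemLp Y 2 μ)
    (h2 : Filter.Tendsto (fun m => ∫ x, X m x ^ 2 ∂μ) Filter.atTop (nhds (∫ x, Y x ^ 2 ∂μ)))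
    (h1 : Filter.Tendsto (fun m => ∫ x, |X m x| ∂μ) Filter.atTop (nhds (∫ x, |Y x| ∂μ))) :
    Filter.Tendsto (fun m => (∫ x, X m x ^ 2 ∂μ) * logFactor (X m) μ) Filter.atTop
      (nhds ((∫ x, Y x ^ 2 ∂μ) * logFactor Y μ)) := by
  by_cases hB : ∫ x, |Y x| ∂μ = 0
  · have hY0 : Y =ᵐ[μ] 0 := by
      rw [integral_eq_zero_iff_of_nonneg (fun x => abs_nonneg _)
        (hY.integrable one_le_two).abs] at hB
      filter_upwards [hB] with x hx
      simpa using hx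
    have hA : ∫ x, Y x ^ 2 ∂μ = 0 := by
      rw [integral_congr_ae (g := fun _ => 0)]
      · simp
      · filter_upwards [hY0] with x hx
        simp [hx]
    rw [hA, zero_mul]
    rw [hA] at h2
    refine squeeze_zero (fun m => ?_) (fun m => ?_) h2
    · exact mul_nonneg (integral_nonneg fun x => sq_nonneg _) (logFactor_nonneg_and_le_one (hX m)).1
    · exact mul_le_of_le_one_right (integral_nonneg fun x => sq_nonneg _)
        (logFactor_nonneg_and_le_one (hX m)).2
  · have hB0 : 0 ≤ ∫ x, |Y x| ∂μ := integral_nonneg fun x => abs_nonneg _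
    have hBpos : 0 < ∫ x, |Y x| ∂μ := lt_of_le_of_ne hB0 (Ne.symm hB)
    have hle : ∫ x, |Y x| ∂μ ≤ √(∫ x, Y x ^ 2 ∂μ) := by
      have h := sq_integral_mul_le (μ := μ) hY.abs (memLp_const (1 : ℝ))
      refine Real.le_sqrt_of_sq_le ?_
      simpa using h
    have hlog : 0 ≤ Real.log (√(∫ x, Y x ^ 2 ∂μ) / ∫ x, |Y x| ∂μ) :=
      Real.log_nonneg ((one_le_div hBpos).2 hle)
    refine h2.mul ?_
    have hev : ∀ᶠ m in Filter.atTop, (1 + Real.log (√(∫ x, X m x ^ 2 ∂μ) / ∫ x, |X m x| ∂μ))⁻¹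
        = logFactor (X m) μ := by
      filter_upwards [h1.eventually_ne hB] with m hm
      rw [logFactor, if_neg hm]
    refine Filter.Tendsto.congr' hev ?_
    rw [logFactor, if_neg hB]
    refine Filter.Tendsto.inv₀ (tendsto_const_nhds.add ?_) (by linarith)
    refine Filter.Tendsto.log (h2.sqrt.div h1 hB) ?_
    exact (div_pos (hBpos.trans_le hle) hBpos).ne'

variable {F : (Fin n → ℝ) → ℝ} {C : NNReal}

theorem lipschitzWith_mollify (hF : LipschitzWith C F) (m : ℕ) :
    LipschitzWith C (mollify m F volume) := by
  have hFc := hF.continuous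
  refine LipschitzWith.of_dist_le_mul fun x y => ?_
  have hφ := (bumpSeq (Fin n → ℝ) m).continuous_normed (μ := volume)
  have hsupp := (bumpSeq (Fin n → ℝ) m).hasCompactSupport_normed (μ := volume)
  have hint : ∀ x, Integrable fun t => (bumpSeq (Fin n → ℝ) m).normed volume t * F (x - t) :=
    fun x => (hφ.mul (hFc.comp (by fun_prop))).integrable_of_hasCompactSupport hsupp.mul_right
  simp only [mollify, convolution_def, ContinuousLinearMap.lsmul_apply, smul_eq_mul]
  rw [Real.dist_eq, ← integral_sub (hint x) (hint y)]
  calc |∫ t, ((bumpSeq (Fin n → ℝ) m).normed volume t * F (x - t)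
          - (bumpSeq (Fin n → ℝ) m).normed volume t * F (y - t))|
      ≤ ∫ t, (bumpSeq (Fin n → ℝ) m).normed volume t * (C * dist x y) := by
        rw [← Real.norm_eq_abs]
        refine norm_integral_le_of_norm_le
          ((bumpSeq (Fin n → ℝ) m).integrable_normed.mul_const _)
          (Filter.Eventually.of_forall fun t => ?_)
        rw [← mul_sub, norm_mul, Real.norm_of_nonneg ((bumpSeq (Fin n → ℝ) m).nonneg_normed t)]
        refine mul_le_mul_of_nonneg_left ?_ ((bumpSeq (Fin n → ℝ) m).nonneg_normed t)
        have := hF.dist_le_mul (x - t) (y - t)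
        rwa [dist_sub_right, Real.dist_eq, ← Real.norm_eq_abs] at this
    _ = C * dist x y := by
        rw [integral_mul_const, (bumpSeq (Fin n → ℝ) m).integral_normed, one_mul]

/-- Mollification commutes with the (almost everywhere defined) partial derivatives of a Lipschitz
function. -/
theorem lineDeriv_mollify (hF : LipschitzWith C F) (m : ℕ) (x v : Fin n → ℝ) :
    lineDeriv ℝ (mollify m F volume) x v = mollify m (fun y => lineDeriv ℝ F y v) volume x := by
  have hFc := hF.continuous
  have hφ := (bumpSeq (Fin n → ℝ) m).continuous_normed (μ := volume)
  have hsupp := (bumpSeq (Fin n → ℝ) m).hasCompactSupport_normed (μ := volume)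
  have hdm : Measurable fun y => lineDeriv ℝ F y v := measurable_lineDeriv hFc
  refine HasLineDerivAt.lineDeriv ?_
  have hae : ∀ᵐ t, HasLineDerivAt ℝ F (lineDeriv ℝ F (x - t) v) (x - t) v := by
    filter_upwards [(quasiMeasurePreserving_sub_left (volume : Measure (Fin n → ℝ)) x).ae
      (hF.ae_lineDifferentiableAt (μ := volume) v)] with t ht
    exact ht.hasLineDerivAt
  have h := hasDerivAt_integral_of_dominated_loc_of_lip (x₀ := (0 : ℝ)) (s := Set.univ)
    (μ := (volume : Measure (Fin n → ℝ)))
    (bound := fun t => (bumpSeq (Fin n → ℝ) m).normed volume t * (C * ‖v‖))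
    (F := fun s t => (bumpSeq (Fin n → ℝ) m).normed volume t * F (x + s • v - t))
    (F' := fun t => (bumpSeq (Fin n → ℝ) m).normed volume t * lineDeriv ℝ F (x - t) v)
    Filter.univ_mem
    (Filter.Eventually.of_forall fun s => Continuous.aestronglyMeasurable (by fun_prop))
    ((hφ.mul (hFc.comp (by fun_prop))).integrable_of_hasCompactSupport hsupp.mul_right)
    (Measurable.aestronglyMeasurable (hφ.measurable.mul (hdm.comp (by fun_prop))))
    (Filter.Eventually.of_forall fun t => ?_)
    ((bumpSeq (Fin n → ℝ) m).integrable_normed.mul_const _) ?_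
  · have h2 := h.2
    simpa only [HasLineDerivAt, mollify, convolution_def, ContinuousLinearMap.lsmul_apply,
      smul_eq_mul] using h2
  · have hnn := (bumpSeq (Fin n → ℝ) m).nonneg_normed (μ := volume) t
    refine LipschitzOnWith.of_dist_le_mul fun a _ b _ => ?_
    have h1 := hF.dist_le_mul (x + a • v - t) (x + b • v - t)
    rw [dist_sub_right, dist_add_left, dist_eq_norm (a • v), ← sub_smul, norm_smul, ← dist_eq_norm]
      at h1
    have hC : 0 ≤ (bumpSeq (Fin n → ℝ) m).normed volume t * (C * ‖v‖) :=
      mul_nonneg hnn (mul_nonneg C.2 (norm_nonneg v))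
    rw [Real.dist_eq, ← mul_sub, abs_mul, abs_of_nonneg hnn, Real.coe_nnabs,
      abs_of_nonneg hC, mul_assoc]
    refine mul_le_mul_of_nonneg_left ?_ hnn
    rw [← Real.dist_eq]
    linarith
  · filter_upwards [hae] with t ht
    have h1 : HasDerivAt (fun s : ℝ => F (x - t + s • v)) (lineDeriv ℝ F (x - t) v) 0 := ht
    have h2 : (fun s : ℝ => F (x + s • v - t)) = fun s : ℝ => F (x - t + s • v) := by
      ext s; congr 1; abel
    refine HasDerivAt.const_mul _ ?_
    rw [h2]
    exact h1

/-- Talagrand's `L¹`–`L²` inequality for Lipschitz functions on Gauss space. -/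
theorem variance_le_of_lipschitzWith (hF : LipschitzWith C F) :
    Var[F; stdGauss n] ≤ 4 * ∑ k, (∫ x, lineDeriv ℝ F x (Pi.single k 1) ^ 2 ∂stdGauss n) *
      logFactor (fun x => lineDeriv ℝ F x (Pi.single k 1)) (stdGauss n) := by
  have hFc := hF.continuous
  have hgm : ∀ k : Fin n, Measurable fun x => lineDeriv ℝ F x (Pi.single k 1) :=
    fun k => measurable_lineDeriv hFc
  have hgb : ∀ (k : Fin n) x, |lineDeriv ℝ F x (Pi.single k 1)| ≤ C := fun k x => by
    have := norm_lineDeriv_le_of_lipschitz ℝ (x₀ := x) (v := Pi.single k (1 : ℝ)) hF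
    simpa [Pi.norm_single] using this
  set Fm : ℕ → (Fin n → ℝ) → ℝ := fun m => mollify m F volume with hFm
  have hsm : ∀ m, ContDiff ℝ 1 (Fm m) := fun m =>
    (bumpSeq (Fin n → ℝ) m).hasCompactSupport_normed.contDiff_convolution_left _
      ((bumpSeq (Fin n → ℝ) m).contDiff_normed) hFc.locallyIntegrable
  have hlip : ∀ m, LipschitzWith C (Fm m) := fun m => lipschitzWith_mollify hF m
  have hfd : ∀ m k x, fderiv ℝ (Fm m) x (Pi.single k 1)
      = mollify m (fun y => lineDeriv ℝ F y (Pi.single k 1)) volume x := fun m k x => by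
    rw [← lineDeriv_mollify hF,
      ((hsm m).differentiable one_ne_zero x).lineDeriv_eq_fderiv]
  have hstep := fun m => variance_le_of_contDiff (hsm m) (C := C)
    (fun x => norm_fderiv_le_of_lipschitz ℝ (hlip m))
  simp only [hfd] at hstep
  -- growth of `F` and of its mollifications
  have hgrow : ∀ x, |F x| ≤ |F 0| + C * ‖x‖ := fun x => by
    have h := hF.dist_le_mul x 0
    rw [Real.dist_eq, dist_zero_right] at h
    have h2 := abs_sub_abs_le_abs_sub (F x) (F 0)
    linarith
  have hclose : ∀ m x, |Fm m x - F x| ≤ 2 * C := fun m x => by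
    have h := (ContDiffBump.dist_normed_convolution_le (φ := bumpSeq (Fin n → ℝ) m)
      (μ := volume) (g := F) (x₀ := x) (ε := 2 * C) hFc.aestronglyMeasurable fun y hy => ?_)
    · rwa [Real.dist_eq] at h
    · refine (hF.dist_le_mul y x).trans ?_
      have h1 : (bumpSeq (Fin n → ℝ) m).rOut ≤ 2 := by
        change (2 : ℝ) / (m + 1) ≤ 2
        exact div_le_self (by norm_num) (by linarith [Nat.cast_nonneg (α := ℝ) m])
      have h2 := (Metric.mem_ball.1 hy).le.trans h1
      have h3 : (0 : ℝ) ≤ C := C.2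
      nlinarith
  have hgrowm : ∀ m x, |Fm m x| ≤ (|F 0| + 2 * C) + C * ‖x‖ := fun m x => by
    have h1 := hgrow x
    have h2 := hclose m x
    have h3 := abs_sub_abs_le_abs_sub (Fm m x) (F x)
    linarith
  have hlimF : ∀ x, Filter.Tendsto (fun m => Fm m x) Filter.atTop (nhds (F x)) :=
    fun x => tendsto_mollify hFc x
  have hI1 : Filter.Tendsto (fun m => ∫ x, Fm m x ∂stdGauss n) Filter.atTop
      (nhds (∫ x, F x ∂stdGauss n)) :=
    tendsto_integral_of_dominated_convergence (fun x => (|F 0| + 2 * C) + C * ‖x‖)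
      (fun m => (hlip m).continuous.aestronglyMeasurable)
      ((integrable_const _).add (integrable_norm_stdGauss.const_mul _))
      (fun m => Filter.Eventually.of_forall fun x => hgrowm m x)
      (Filter.Eventually.of_forall fun x => hlimF x)
  have hI2 : Filter.Tendsto (fun m => ∫ x, Fm m x ^ 2 ∂stdGauss n) Filter.atTop
      (nhds (∫ x, F x ^ 2 ∂stdGauss n)) := by
    refine tendsto_integral_of_dominated_convergence
      (fun x => 2 * (|F 0| + 2 * C) ^ 2 + 2 * C ^ 2 * ‖x‖ ^ 2)
      (fun m => ((hlip m).continuous.pow 2).aestronglyMeasurable)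
      ((integrable_const _).add (integrable_norm_sq_stdGauss.const_mul _))
      (fun m => Filter.Eventually.of_forall fun x => ?_)
      (Filter.Eventually.of_forall fun x => (hlimF x).pow 2)
    rw [Real.norm_eq_abs, abs_pow]
    have h1 := pow_le_pow_left₀ (abs_nonneg _) (hgrowm m x) 2
    nlinarith [sq_nonneg ((|F 0| + 2 * C) - C * ‖x‖)]
  have hVm : ∀ m, Var[Fm m; stdGauss n]
      = ∫ x, Fm m x ^ 2 ∂stdGauss n - (∫ x, Fm m x ∂stdGauss n) ^ 2 := fun m =>
    variance_eq_sub (memLp_two_of_abs_le (hlip m).continuous.measurable (hgrowm m))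
  have hV : Var[F; stdGauss n] = ∫ x, F x ^ 2 ∂stdGauss n - (∫ x, F x ∂stdGauss n) ^ 2 :=
    variance_eq_sub (memLp_two_of_abs_le hFc.measurable hgrow)
  rw [hV]
  refine le_of_tendsto_of_tendsto' (hI2.sub (hI1.pow 2)) ?_ fun m => (hVm m).symm.trans_le (hstep m)
  refine Filter.Tendsto.const_mul _ (tendsto_finsetSum _ fun k _ => ?_)
  have hbm : ∀ m x, |mollify m (fun y => lineDeriv ℝ F y (Pi.single k 1)) volume x| ≤ C :=
    fun m x => abs_mollify_le (hgb k) m x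
  have hmm : ∀ m, Measurable (mollify m (fun y => lineDeriv ℝ F y (Pi.single k 1)) volume) :=
    fun m => by
      have h : mollify m (fun y => lineDeriv ℝ F y (Pi.single k 1)) volume
          = fun x => fderiv ℝ (Fm m) x (Pi.single k 1) := funext fun x => (hfd m k x).symm
      rw [h]
      exact (((hsm m).continuous_fderiv one_ne_zero).clm_apply continuous_const).measurable
  have hlim : ∀ᵐ x ∂stdGauss n, Filter.Tendsto
      (fun m => mollify m (fun y => lineDeriv ℝ F y (Pi.single k 1)) volume x) Filter.atTop
      (nhds (lineDeriv ℝ F x (Pi.single k 1))) := by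
    refine (stdGauss_absolutelyContinuous n).ae_le ?_
    refine ContDiffBump.ae_convolution_tendsto_right_of_locallyIntegrable (K := 2)
      tendsto_bumpSeq_rOut (Filter.Eventually.of_forall fun m => ?_) ?_
    · change (2 : ℝ) / (m + 1) ≤ 2 * (1 / (m + 1))
      rw [mul_one_div]
    · refine (locallyIntegrable_const (C : ℝ)).mono (hgm k).aestronglyMeasurable
        (Filter.Eventually.of_forall fun x => ?_)
      rw [Real.norm_eq_abs, Real.norm_eq_abs]
      exact (hgb k x).trans (le_abs_self _)
  refine tendsto_integral_sq_mul_logFactor (fun m => ?_) ?_ ?_ ?_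
  · exact MemLp.of_bound (hmm m).aestronglyMeasurable C (Filter.Eventually.of_forall (hbm m))
  · exact MemLp.of_bound (hgm k).aestronglyMeasurable C (Filter.Eventually.of_forall (hgb k))
  · refine tendsto_integral_of_dominated_convergence (fun _ => (C : ℝ) ^ 2)
      (fun m => ((hmm m).pow_const 2).aestronglyMeasurable) (integrable_const _)
      (fun m => Filter.Eventually.of_forall fun x => ?_) ?_
    · rw [Real.norm_eq_abs, abs_pow]
      exact pow_le_pow_left₀ (abs_nonneg _) (hbm m x) 2
    · filter_upwards [hlim] with x hx using hx.pow 2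
  · refine tendsto_integral_of_dominated_convergence (fun _ => (C : ℝ))
      (fun m => (hmm m).abs.aestronglyMeasurable) (integrable_const _)
      (fun m => Filter.Eventually.of_forall fun x => ?_) ?_
    · rw [Real.norm_eq_abs, abs_abs]
      exact hbm m x
    · filter_upwards [hlim] with x hx using hx.abs

end LipschitzTalagrand

namespace Torus

variable {d : ℕ} {R : Fin d → ℝ}

/-! ### Charts of the torus -/

theorem isOpenQuotientMap_proj (R : Fin d → ℝ) : IsOpenQuotientMap (proj R) := by
  have h1 : IsOpenQuotientMap (Pi.map fun (i : Fin d) (x : ℝ) =>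
      (x : AddCircle (2 * Real.pi * R i))) :=
    IsOpenQuotientMap.piMap fun i => QuotientAddGroup.isOpenQuotientMap_mk
  exact h1.comp (PiLp.homeomorph 2 fun _ : Fin d => ℝ).isOpenQuotientMap

theorem continuous_proj : Continuous (proj R) := (isOpenQuotientMap_proj R).continuous

theorem proj_surjective : Function.Surjective (proj R) := (isOpenQuotientMap_proj R).surjective

theorem proj_zero : proj R 0 = 0 := rfl

theorem proj_add (v w : EuclideanSpace ℝ (Fin d)) : proj R (v + w) = proj R v + proj R w := rfl

theorem proj_sub (v w : EuclideanSpace ℝ (Fin d)) : proj R (v - w) = proj R v - proj R w := rfl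

theorem continuous_of_comp_proj {F : Type*} [TopologicalSpace F] {g : Torus R → F}
    (hg : Continuous fun v => g (proj R v)) : Continuous g :=
  (isOpenQuotientMap_proj R).isQuotientMap.continuous_iff.2 hg

theorem chart_proj (u : C(Torus R, ℝ)) (v : EuclideanSpace ℝ (Fin d)) :
    chart u (proj R v) = fun w => chart u 0 (v + w) := by
  ext w
  simp [chart, proj_add]

theorem chart_add (u v : C(Torus R, ℝ)) (p : Torus R) : chart (u + v) p = chart u p + chart v p :=
  rfl

theorem chart_smul (c : ℝ) (u : C(Torus R, ℝ)) (p : Torus R) : chart (c • u) p = c • chart u p :=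
  rfl

theorem chart_apply_zero (u : C(Torus R, ℝ)) (p : Torus R) : chart u p 0 = u p := by
  simp [chart, proj_zero]

theorem contDiff_chart {u : C(Torus R, ℝ)} (hu : ContDiff ℝ 2 (chart u 0)) (p : Torus R) :
    ContDiff ℝ 2 (chart u p) := by
  obtain ⟨v, rfl⟩ := proj_surjective p
  rw [chart_proj]
  exact hu.comp (contDiff_const.add contDiff_id)

theorem fderiv_chart_proj (u : C(Torus R, ℝ)) (v : EuclideanSpace ℝ (Fin d)) :
    fderiv ℝ (chart u (proj R v)) = fun w => fderiv ℝ (chart u 0) (v + w) := by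
  ext1 w
  rw [chart_proj, fderiv_comp_add_left]

theorem fderiv_chart_proj_zero (u : C(Torus R, ℝ)) (v : EuclideanSpace ℝ (Fin d)) :
    fderiv ℝ (chart u (proj R v)) 0 = fderiv ℝ (chart u 0) v := by
  simp [fderiv_chart_proj]

theorem fderiv_chart (u : C(Torus R, ℝ)) (p : Torus R) (w : EuclideanSpace ℝ (Fin d)) :
    fderiv ℝ (chart u p) w = fderiv ℝ (chart u (p + proj R w)) 0 := by
  obtain ⟨v, rfl⟩ := proj_surjective p
  rw [← proj_add, fderiv_chart_proj_zero, fderiv_chart_proj]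

theorem continuous_fderiv_chart {u : C(Torus R, ℝ)} (hu : ContDiff ℝ 2 (chart u 0)) :
    Continuous fun p => fderiv ℝ (chart u p) 0 := by
  refine continuous_of_comp_proj ?_
  simp only [fderiv_chart_proj, add_zero]
  exact hu.continuous_fderiv two_ne_zero

theorem continuous_fderiv_fderiv_chart {u : C(Torus R, ℝ)} (hu : ContDiff ℝ 2 (chart u 0)) :
    Continuous fun p => fderiv ℝ (fderiv ℝ (chart u p)) 0 := by
  refine continuous_of_comp_proj ?_
  simp only [fderiv_chart_proj, fderiv_comp_add_left, add_zero]
  exact (hu.fderiv_right (m := 1) (by norm_num)).continuous_fderiv one_ne_zero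

theorem exists_norm_le_of_continuous [CompactSpace (Torus R)] {F : Type*} [NormedAddCommGroup F]
    {g : Torus R → F} (hg : Continuous g) : ∃ M : NNReal, ∀ p, ‖g p‖ ≤ M := by
  obtain ⟨M, hM⟩ := isCompact_univ.exists_bound_of_continuousOn hg.continuousOn
  exact ⟨M.toNNReal, fun p => (hM p trivial).trans (Real.le_coe_toNNReal M)⟩

/-- The differential of a function of class `C²` on the torus is Lipschitz, by compactness. -/
theorem exists_lipschitzWith_fderiv_chart [CompactSpace (Torus R)] {u : C(Torus R, ℝ)}
    (hu : ContDiff ℝ 2 (chart u 0)) : ∃ L : NNReal, LipschitzWith L (fderiv ℝ (chart u 0)) := by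
  obtain ⟨L, hL⟩ := exists_norm_le_of_continuous 
    (g := fun p => fderiv ℝ (fderiv ℝ (chart u p)) 0) (continuous_fderiv_fderiv_chart hu)
  refine ⟨L, lipschitzWith_of_nnnorm_fderiv_le
    ((hu.fderiv_right (m := 1) (by norm_num)).differentiable one_ne_zero) fun v => ?_⟩
  have h := hL (proj R v)
  rw [fderiv_chart_proj, fderiv_comp_add_left, add_zero] at h
  exact h

/-! ### The isotopy given by small gradient steps -/

/-- The gradient of `u` on the torus, the vector representing the differential in the flat chart. -/
noncomputable def grad (u : C(Torus R, ℝ)) (p : Torus R) : EuclideanSpace ℝ (Fin d) :=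
  (InnerProductSpace.toDual ℝ (EuclideanSpace ℝ (Fin d))).symm (fderiv ℝ (chart u p) 0)

theorem norm_grad (u : C(Torus R, ℝ)) (p : Torus R) : ‖grad u p‖ = ‖fderiv ℝ (chart u p) 0‖ :=
  LinearIsometryEquiv.norm_map _ _

theorem continuous_grad {u : C(Torus R, ℝ)} (hu : ContDiff ℝ 2 (chart u 0)) :
    Continuous (grad u) :=
  (LinearIsometryEquiv.continuous _).comp (continuous_fderiv_chart hu)

theorem dist_grad_proj_le {u : C(Torus R, ℝ)} {L : NNReal}
    (hL : LipschitzWith L (fderiv ℝ (chart u 0))) (v w : EuclideanSpace ℝ (Fin d)) :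
    dist (grad u (proj R v)) (grad u (proj R w)) ≤ L * dist v w := by
  rw [grad, grad, LinearIsometryEquiv.dist_map, fderiv_chart_proj_zero, fderiv_chart_proj_zero]
  exact hL.dist_le_mul v w

/-- A small gradient step on the torus is a bijection: its lift to `ℝ^d` is a perturbation of the
identity by a contraction. -/
theorem bijective_add_proj_smul_grad {u : C(Torus R, ℝ)} {L : NNReal}
    (hL : LipschitzWith L (fderiv ℝ (chart u 0))) {s : ℝ} (hs : |s| * L < 1) :
    Function.Bijective fun p => p + proj R (s • grad u p) := by
  have hcontr : ∀ y : EuclideanSpace ℝ (Fin d),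
      ContractingWith (Real.toNNReal (|s| * L)) fun v => y - s • grad u (proj R v) := by
    intro y
    refine ⟨Real.toNNReal_lt_one.2 hs, LipschitzWith.of_dist_le_mul fun v w => ?_⟩
    rw [Real.coe_toNNReal _ (by positivity), dist_sub_left, dist_smul₀, Real.norm_eq_abs,
      mul_assoc]
    exact mul_le_mul_of_nonneg_left (dist_grad_proj_le hL v w) (abs_nonneg s)
  have hlift : ∀ v : EuclideanSpace ℝ (Fin d), proj R v + proj R (s • grad u (proj R v))
      = proj R (v + s • grad u (proj R v)) := fun v => rfl
  constructor
  · intro p q hpq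
    obtain ⟨v, rfl⟩ := proj_surjective p
    obtain ⟨w, rfl⟩ := proj_surjective q
    simp only [hlift] at hpq
    -- translate `w` by a period so that the two lifted steps end at the same point
    set l := (v + s • grad u (proj R v)) - (w + s • grad u (proj R w)) with hl
    have hl0 : proj R l = 0 := by rw [hl, proj_sub, hpq, sub_self]
    have hw : proj R (w + l) = proj R w := by rw [proj_add, hl0, add_zero]
    have h1 : (v + s • grad u (proj R v)) - s • grad u (proj R (w + l)) = w + l := by
      rw [hw, hl]; abel
    have h2 : (v + s • grad u (proj R v)) - s • grad u (proj R v) = v := by abel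
    rw [← hw, (hcontr (v + s • grad u (proj R v))).fixedPoint_unique' h1 h2]
  · intro q
    obtain ⟨y, rfl⟩ := proj_surjective q
    have h := (hcontr y).fixedPoint_isFixedPt
    set v := ContractingWith.fixedPoint _ (hcontr y)
    refine ⟨proj R v, ?_⟩
    simp only [hlift]
    congr 1
    have h1 : y - s • grad u (proj R v) = v := h
    exact (sub_eq_iff_eq_add.1 h1).symm

/-- A small gradient step of size `s` decreases `u` by at least `s/2` times the squared gradient. -/
theorem apply_sub_grad_le {u : C(Torus R, ℝ)} (hu : ContDiff ℝ 2 (chart u 0)) {L : NNReal}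
    (hL : LipschitzWith L (fderiv ℝ (chart u 0))) {s : ℝ} (hs0 : 0 ≤ s) (hs : s * L ≤ 1 / 2)
    (p : Torus R) : u (p + proj R ((-s) • grad u p)) ≤ u p - s / 2 * ‖grad u p‖ ^ 2 := by
  obtain ⟨v, rfl⟩ := proj_surjective p
  set g := grad u (proj R v) with hg
  have hgd : ∀ w, fderiv ℝ (chart u 0) v w = inner ℝ g w := fun w => by
    rw [hg, grad, InnerProductSpace.toDual_symm_apply, fderiv_chart_proj_zero]
  have hU : ∀ w, u (proj R w) = chart u 0 w := fun w => by simp [chart]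
  rw [← proj_add, hU, hU]
  obtain ⟨z, hz, hmvt⟩ := domain_mvt (f := chart u 0) (s := Set.univ) (x := v)
    (y := v + (-s) • g) (f' := fderiv ℝ (chart u 0))
    (fun x _ => ((hu.differentiable two_ne_zero) x).hasFDerivAt.hasFDerivWithinAt) convex_univ
    trivial trivial
  have hzv : ‖z - v‖ ≤ s * ‖g‖ := by
    have h := norm_sub_le_of_mem_segment hz
    rw [add_sub_cancel_left, norm_smul, Real.norm_eq_abs, abs_neg, abs_of_nonneg hs0] at h
    exact h
  have h1 : |(fderiv ℝ (chart u 0) z - fderiv ℝ (chart u 0) v) ((-s) • g)|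
      ≤ 1 / 2 * ‖g‖ * (s * ‖g‖) := by
    have h := hL.dist_le_mul z v
    rw [dist_eq_norm, dist_eq_norm] at h
    refine ((fderiv ℝ (chart u 0) z - fderiv ℝ (chart u 0) v).le_opNorm _).trans ?_
    rw [norm_smul, Real.norm_eq_abs, abs_neg, abs_of_nonneg hs0]
    refine mul_le_mul_of_nonneg_right (h.trans ?_) (by positivity)
    calc (L : ℝ) * ‖z - v‖ ≤ L * (s * ‖g‖) := by gcongr
      _ = s * L * ‖g‖ := by ring
      _ ≤ 1 / 2 * ‖g‖ := by gcongr
  have h2 := hgd ((-s) • g)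
  rw [inner_smul_right, real_inner_self_eq_norm_sq] at h2
  rw [add_sub_cancel_left] at hmvt
  have h3 := (abs_le.1 h1).2
  rw [sub_apply, ← hmvt, h2] at h3
  nlinarith

/-- Small gradient steps form an isotopy, so that `u` and its composition with such a step have
isotopic excursion sets. -/
theorem isotopicTo_grad [CompactSpace (Torus R)] {u : C(Torus R, ℝ)}
    (hu : ContDiff ℝ 2 (chart u 0)) {L : NNReal} (hL : LipschitzWith L (fderiv ℝ (chart u 0)))
    {s : ℝ} (hs0 : 0 ≤ s) (hs : s * L < 1) (F : Set (Torus R)) :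
    IsotopicTo {p | p + proj R ((-s) • grad u p) ∈ F} F := by
  have hlt : ∀ t : unitInterval, |(-(t * s) : ℝ)| * L < 1 := fun t => by
    rw [abs_neg, abs_of_nonneg (mul_nonneg t.2.1 hs0)]
    refine lt_of_le_of_lt ?_ hs
    exact mul_le_mul_of_nonneg_right (mul_le_of_le_one_left hs0 t.2.2) L.2
  have hcont : Continuous fun z : unitInterval × Torus R =>
      z.2 + proj R ((-(z.1 * s) : ℝ) • grad u z.2) := by
    refine continuous_snd.add (continuous_proj.comp ?_)
    have hc : Continuous fun z : unitInterval × Torus R => (-(z.1 * s) : ℝ) := by fun_prop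
    exact hc.smul ((continuous_grad hu).comp continuous_snd)
  have hbij := fun t : unitInterval => bijective_add_proj_smul_grad (R := R) hL (hlt t)
  refine ⟨fun t => Continuous.homeoOfEquivCompactToT2 (f := Equiv.ofBijective _ (hbij t))
    (hcont.comp (Continuous.prodMk_right t)), hcont, fun x => ?_, ?_⟩
  · change x + proj R ((-(((0 : unitInterval) : ℝ) * s) : ℝ) • grad u x) = x
    simp [proj_zero]
  · have h1 : ∀ x, x + proj R ((-(((1 : unitInterval) : ℝ) * s) : ℝ) • grad u x)
        = x + proj R ((-s) • grad u x) := fun x => by simp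
    have hsurj := (hbij 1).2
    simp only [h1] at hsurj
    exact (congrArg (· '' _) (funext h1)).trans (Set.image_preimage_eq F hsurj)

end Torus

namespace Torus

variable {d : ℕ} {R : Fin d → ℝ} {A : Set C(Torus R, ℝ)}

/-! ### The threshold map of an admissible set -/

/-- Membership in an admissible set is monotone in the excursion set `{u ≥ 0}`. -/
theorem IsAdmissible.mem_of_nonneg_imp (hA : IsAdmissible A) {v w : C(Torus R, ℝ)} (hv : v ∈ A)
    (h : ∀ x, 0 ≤ v x → 0 ≤ w x) : w ∈ A := by
  refine hA.topological (v ⊔ w) (hA.increasing v hv _ le_sup_left) w ?_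
  refine ⟨fun _ => Homeomorph.refl _, continuous_snd, fun _ => rfl, ?_⟩
  ext x
  change x ∈ id '' {x | 0 ≤ w x} ↔ 0 ≤ v x ⊔ w x
  rw [Set.image_id, le_sup_iff]
  exact ⟨Or.inr, fun hx => hx.elim (h x) id⟩

theorem abs_apply_le_norm [CompactSpace (Torus R)] (u : C(Torus R, ℝ)) (x : Torus R) :
    |u x| ≤ ‖u‖ := u.norm_coe_le_norm x

theorem IsAdmissible.mem_of_nonneg (hA : IsAdmissible A) {w : C(Torus R, ℝ)} (h : ∀ x, 0 ≤ w x) :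
    w ∈ A := by
  obtain ⟨a, ha⟩ := hA.nonempty
  exact hA.mem_of_nonneg_imp ha fun x _ => h x

theorem IsAdmissible.exists_nonneg_of_mem (hA : IsAdmissible A) {w : C(Torus R, ℝ)} (hw : w ∈ A) :
    ∃ x, 0 ≤ w x := by
  obtain ⟨b, hb⟩ := hA.compl_nonempty
  by_contra! h
  exact hb (hA.mem_of_nonneg_imp hw fun x hx => absurd hx (h x).not_ge)

variable [CompactSpace (Torus R)]

theorem IsAdmissible.neg_norm_le (hA : IsAdmissible A) {u : C(Torus R, ℝ)} {l : ℝ}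
    (h : u + ContinuousMap.const (Torus R) l ∈ A) : -‖u‖ ≤ l := by
  obtain ⟨x, hx⟩ := hA.exists_nonneg_of_mem h
  have h1 := (abs_le.1 (abs_apply_le_norm u x)).2
  have h2 : 0 ≤ u x + l := hx
  linarith

theorem IsAdmissible.add_norm_mem (hA : IsAdmissible A) (u : C(Torus R, ℝ)) :
    u + ContinuousMap.const (Torus R) ‖u‖ ∈ A := by
  refine hA.mem_of_nonneg fun x => ?_
  have h1 := (abs_le.1 (abs_apply_le_norm u x)).1
  change 0 ≤ u x + ‖u‖
  linarith

theorem IsAdmissible.threshold_le_of_mem (hA : IsAdmissible A) {u : C(Torus R, ℝ)} {l : ℝ}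
    (h : u + ContinuousMap.const (Torus R) l ∈ A) : threshold A u ≤ l :=
  csInf_le ⟨-‖u‖, fun _ hl => hA.neg_norm_le hl⟩ h

theorem IsAdmissible.mem_of_threshold_lt (hA : IsAdmissible A) {u : C(Torus R, ℝ)} {l : ℝ}
    (h : threshold A u < l) : u + ContinuousMap.const (Torus R) l ∈ A := by
  obtain ⟨l', hl', hlt⟩ := exists_lt_of_csInf_lt ⟨‖u‖, hA.add_norm_mem u⟩ h
  refine hA.increasing _ hl' _ fun x => ?_
  change u x + l' ≤ u x + l
  linarith

theorem IsAdmissible.threshold_le_add_norm_sub (hA : IsAdmissible A) (u v : C(Torus R, ℝ)) :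
    threshold A v ≤ threshold A u + ‖u - v‖ := by
  refine le_of_forall_pos_le_add fun ε hε => ?_
  refine hA.threshold_le_of_mem (hA.increasing _
    (hA.mem_of_threshold_lt (lt_add_of_pos_right (threshold A u) hε)) _ fun x => ?_)
  change u x + (threshold A u + ε) ≤ v x + (threshold A u + ‖u - v‖ + ε)
  have h1 := (abs_le.1 (abs_apply_le_norm (u - v) x)).2
  rw [ContinuousMap.sub_apply] at h1
  linarith

theorem IsAdmissible.abs_threshold_sub_le (hA : IsAdmissible A) (u v : C(Torus R, ℝ)) :
    |threshold A u - threshold A v| ≤ ‖u - v‖ := by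
  have h1 := hA.threshold_le_add_norm_sub u v
  have h2 := hA.threshold_le_add_norm_sub v u
  rw [norm_sub_rev] at h2
  exact abs_le.2 ⟨by linarith, by linarith⟩

/-- The threshold is reached at a critical point. Otherwise the gradient of `u` would be bounded
below near the level `-T`, and a downhill gradient step, isotopic to the identity, would identify
the excursion set of a level slightly below `-T` with a subset of that of a level slightly above. -/
theorem IsAdmissible.exists_reachedAt (hA : IsAdmissible A) {u : C(Torus R, ℝ)}
    (hu : ContDiff ℝ 2 (chart u 0)) : ∃ p, ReachedAt A u p := by
  by_contra! hno
  set τ := threshold A u with hτ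
  obtain ⟨p₀, -, hp₀⟩ := isCompact_univ.exists_isMinOn (Set.univ_nonempty (α := Torus R))
    (f := fun p => ‖grad u p‖ + |u p + τ|)
    ((continuous_grad hu).norm.add (u.continuous.add continuous_const).abs).continuousOn
  set δ := ‖grad u p₀‖ + |u p₀ + τ| with hδ
  have hδ0 : 0 < δ := by
    refine lt_of_le_of_ne (by positivity) fun h0 => hno p₀ ?_
    have h1 : ‖grad u p₀‖ = 0 := by
      linarith [norm_nonneg (grad u p₀), abs_nonneg (u p₀ + τ)]
    have h2 : |u p₀ + τ| = 0 := by
      linarith [norm_nonneg (grad u p₀), abs_nonneg (u p₀ + τ)]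
    rw [norm_grad] at h1
    exact ⟨norm_eq_zero.1 h1, abs_eq_zero.1 h2⟩
  have hmin : ∀ p, δ ≤ ‖grad u p‖ + |u p + τ| := fun p => hp₀ (Set.mem_univ p)
  obtain ⟨L, hL⟩ := exists_lipschitzWith_fderiv_chart hu
  have hL0 : (0 : ℝ) ≤ L := L.2
  set s : ℝ := 1 / (2 * (L + 1)) with hs
  have hs0 : 0 < s := by positivity
  have hsL : s * L ≤ 1 / 2 := by
    rw [hs, div_mul_eq_mul_div, one_mul, div_le_div_iff₀ (by positivity) two_pos]
    linarith
  -- points within `ε` of the level have gradient at least `δ / 2`, and one step pushes them down by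
  -- at least `2 ε`
  set ε : ℝ := min (δ / 2) (s / 4 * (δ / 2) ^ 2) with hε
  have hε0 : 0 < ε := lt_min (by positivity) (by positivity)
  have hε1 : ε ≤ δ / 2 := min_le_left _ _
  have hε2 : ε ≤ s / 4 * (δ / 2) ^ 2 := min_le_right _ _
  have hpush : Continuous fun p => p + proj R ((-s) • grad u p) :=
    continuous_id.add (continuous_proj.comp ((continuous_grad hu).const_smul (-s)))
  set v : C(Torus R, ℝ) := ⟨fun p => u (p + proj R ((-s) • grad u p)) + (τ + ε),
    (u.continuous.comp hpush).add continuous_const⟩ with hv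
  have hvA : v ∈ A := hA.topological _ (hA.mem_of_threshold_lt (lt_add_of_pos_right τ hε0)) v
    (isotopicTo_grad hu hL hs0.le (by linarith) {x | 0 ≤ u x + (τ + ε)})
  have hlow : u + ContinuousMap.const (Torus R) (τ - ε) ∈ A := by
    refine hA.mem_of_nonneg_imp hvA fun p hp => ?_
    change 0 ≤ u (p + proj R ((-s) • grad u p)) + (τ + ε) at hp
    change 0 ≤ u p + (τ - ε)
    by_contra! hlt
    have hdec := apply_sub_grad_le hu hL hs0.le hsL p
    have hsq : 0 ≤ s / 2 * ‖grad u p‖ ^ 2 := by positivity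
    have habs : |u p + τ| ≤ ε := abs_le.2 ⟨by linarith, by linarith⟩
    have hg : δ / 2 ≤ ‖grad u p‖ := by linarith [hmin p]
    have hg2 : (δ / 2) ^ 2 ≤ ‖grad u p‖ ^ 2 := pow_le_pow_left₀ (by positivity) hg 2
    have h3 := mul_le_mul_of_nonneg_left hg2 (by positivity : 0 ≤ s / 2)
    linarith
  linarith [hA.threshold_le_of_mem hlow]

theorem IsAdmissible.existsUnique_reachedAt (hA : IsAdmissible A) {u : C(Torus R, ℝ)}
    (hu : IsPerfectMorse u) : ∃! p, ReachedAt A u p := by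
  obtain ⟨p, hp⟩ := hA.exists_reachedAt hu.contDiff
  refine ⟨p, hp, fun q hq => ?_⟩
  by_contra hne
  exact hu.values_ne q p hq.1 hp.1 hne (by linarith [hp.2, hq.2])

theorem IsAdmissible.reachedAt_saddle (hA : IsAdmissible A) {u : C(Torus R, ℝ)}
    (hu : IsPerfectMorse u) : ReachedAt A u (saddle A u) := by
  have h := hA.existsUnique_reachedAt hu
  rw [saddle, dif_pos h]
  exact h.choose_spec.1

theorem IsAdmissible.eq_saddle (hA : IsAdmissible A) {u : C(Torus R, ℝ)}
    (hu : IsPerfectMorse u) {p : Torus R} (hp : ReachedAt A u p) : p = saddle A u :=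
  (hA.existsUnique_reachedAt hu).unique hp (hA.reachedAt_saddle hu)

/-! ### The derivative of the threshold map -/

/-- A nonnegative function on a compact space with a single zero is small only near that zero. -/
theorem exists_forall_lt_imp_mem_nhds {X : Type*} [TopologicalSpace X] [CompactSpace X]
    {Q : X → ℝ} (hQ : Continuous Q) {x₀ : X} (hpos : ∀ x, x ≠ x₀ → 0 < Q x) {N : Set X}
    (hN : N ∈ nhds x₀) : ∃ ε > 0, ∀ x, Q x < ε → x ∈ N := by
  obtain ⟨U, hUN, hU, hx₀⟩ := mem_nhds_iff.1 hN
  rcases Uᶜ.eq_empty_or_nonempty with he | hne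
  · refine ⟨1, one_pos, fun x _ => hUN ?_⟩
    rw [Set.compl_empty_iff.1 he]
    trivial
  · obtain ⟨y, hy, hmin⟩ := hU.isClosed_compl.isCompact.exists_isMinOn hne hQ.continuousOn
    refine ⟨Q y, hpos y fun h => hy (h ▸ hx₀), fun x hx => ?_⟩
    by_contra hxN
    exact (hmin (show x ∈ Uᶜ from fun hxU => hxN (hUN hxU))).not_gt hx

/-- A map with injective derivative at a zero, from a finite-dimensional space, separates this
point from nearby points at least linearly. -/
theorem exists_norm_le_mul_norm_of_injective_fderiv {E F : Type*} [NormedAddCommGroup E]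
    [NormedSpace ℝ E] [FiniteDimensional ℝ E] [NormedAddCommGroup F] [NormedSpace ℝ F] {g : E → F}
    (hg : DifferentiableAt ℝ g 0) (h0 : g 0 = 0) (hinj : Function.Injective (fderiv ℝ g 0)) :
    ∃ C : ℝ, 0 < C ∧ ∀ᶠ h in nhds 0, ‖h‖ ≤ C * ‖g h‖ := by
  obtain ⟨K, hK0, hK⟩ := (fderiv ℝ g 0).toLinearMap.exists_antilipschitzWith
    (LinearMap.ker_eq_bot.2 hinj)
  have hK0' : (0 : ℝ) < K := hK0
  refine ⟨2 * K, by positivity, ?_⟩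
  have ho := hg.hasFDerivAt.isLittleO
  filter_upwards [ho.def (by positivity : (0 : ℝ) < 1 / (2 * K))] with h hh
  rw [h0, sub_zero, sub_zero] at hh
  have h1 := hK.le_mul_dist h 0
  rw [map_zero, dist_zero_right, dist_zero_right] at h1
  have h2 : ‖fderiv ℝ g 0 h‖ ≤ ‖g h‖ + ‖g h - fderiv ℝ g 0 h‖ := by
    have := norm_sub_le (g h) (g h - fderiv ℝ g 0 h)
    rwa [sub_sub_cancel] at this
  have h3 : ‖h‖ ≤ K * (‖g h‖ + 1 / (2 * K) * ‖h‖) :=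
    h1.trans (mul_le_mul_of_nonneg_left (h2.trans (by linarith)) hK0'.le)
  have h4 : (K : ℝ) * (1 / (2 * K) * ‖h‖) = ‖h‖ / 2 := by field_simp
  rw [mul_add, h4] at h3
  linarith

/-- The threshold map is differentiable at a perfect Morse function, and its differential is minus
the evaluation at the saddle point: the point where the threshold of `u + t v` is reached is at
distance `O(t)` from the saddle, which is a critical point of `u`. -/
theorem IsAdmissible.hasDerivAt_threshold (hA : IsAdmissible A) {u v : C(Torus R, ℝ)}
    (hu : IsPerfectMorse u) (hv : ContDiff ℝ 2 (chart v 0)) :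
    HasDerivAt (fun t : ℝ => threshold A (u + t • v)) (-v (saddle A u)) 0 := by
  set S := saddle A u with hS
  have hSr : ReachedAt A u S := hA.reachedAt_saddle hu
  have hut : ∀ t : ℝ, ContDiff ℝ 2 (chart (u + t • v) 0) := fun t => by
    rw [chart_add, chart_smul]
    exact hu.contDiff.add (hv.const_smul t)
  choose p hp using fun t => hA.exists_reachedAt (hut t)
  obtain ⟨M, hM⟩ := exists_norm_le_of_continuous
    (g := fun p => fderiv ℝ (chart v p) 0) (continuous_fderiv_chart hv)
  have hM0 : (0 : ℝ) ≤ M := M.2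
  have hcrit : ∀ t, fderiv ℝ (chart u (p t)) 0 = -(t • fderiv ℝ (chart v (p t)) 0) := fun t => by
    have h := (hp t).1
    rw [IsCritical, chart_add, chart_smul,
      fderiv_add ((contDiff_chart hu.contDiff _).differentiable two_ne_zero 0)
        (((contDiff_chart hv _).differentiable two_ne_zero 0).const_smul t),
      fderiv_const_smul ((contDiff_chart hv _).differentiable two_ne_zero 0)] at h
    exact eq_neg_of_add_eq_zero_left h
  have hval : ∀ t, u (p t) + t * v (p t) + threshold A (u + t • v) = 0 := fun t => (hp t).2
  have hnorm : ∀ t, ‖fderiv ℝ (chart u (p t)) 0‖ ≤ |t| * M := fun t => by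
    rw [hcrit, norm_neg, norm_smul, Real.norm_eq_abs]
    exact mul_le_mul_of_nonneg_left (hM _) (abs_nonneg t)
  -- the points `p t` converge to the saddle
  have hpt : Filter.Tendsto p (nhds 0) (nhds S) := by
    intro N hN
    obtain ⟨ε, hε, hεN⟩ := exists_forall_lt_imp_mem_nhds
      (Q := fun q => ‖fderiv ℝ (chart u q) 0‖ + |u q + threshold A u|)
      ((continuous_fderiv_chart hu.contDiff).norm.add (u.continuous.add continuous_const).abs)
      (x₀ := S) (fun q hq => by
        refine lt_of_le_of_ne (by positivity) fun h0 => hq (hA.eq_saddle hu ⟨?_, ?_⟩)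
        · refine norm_eq_zero.1 (le_antisymm ?_ (norm_nonneg _))
          linarith [abs_nonneg (u q + threshold A u)]
        · refine abs_eq_zero.1 (le_antisymm ?_ (abs_nonneg _))
          linarith [norm_nonneg (fderiv ℝ (chart u q) 0)]) hN
    have hlim : Filter.Tendsto (fun t : ℝ => |t| * (M + 2 * ‖v‖)) (nhds 0) (nhds 0) := by
      have : Continuous fun t : ℝ => |t| * (M + 2 * ‖v‖) := by fun_prop
      simpa using this.tendsto 0
    rw [Filter.mem_map]
    filter_upwards [hlim.eventually_lt_const hε] with t ht
    refine hεN _ (lt_of_le_of_lt ?_ ht)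
    have h1 := hA.abs_threshold_sub_le u (u + t • v)
    rw [sub_add_cancel_left, norm_neg, norm_smul, Real.norm_eq_abs] at h1
    have h2 : |t * v (p t)| ≤ |t| * ‖v‖ := by
      rw [abs_mul]
      exact mul_le_mul_of_nonneg_left (abs_apply_le_norm v _) (abs_nonneg t)
    have h3 : |u (p t) + threshold A u| ≤ 2 * (|t| * ‖v‖) := by
      have : u (p t) + threshold A u
          = (threshold A u - threshold A (u + t • v)) - t * v (p t) := by linarith [hval t]
      rw [this]
      exact (abs_sub _ _).trans (by linarith)
    have h4 := hnorm t
    linarith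
  obtain ⟨C, hC0, hC⟩ := exists_norm_le_mul_norm_of_injective_fderiv
    (((contDiff_chart hu.contDiff S).fderiv_right (m := 1) (by norm_num)).differentiable
      one_ne_zero 0) hSr.1 (hu.nondegenerate S hSr.1)
  have hd0 : HasFDerivAt (chart u S) (0 : EuclideanSpace ℝ (Fin d) →L[ℝ] ℝ) 0 := by
    have h := ((contDiff_chart hu.contDiff S).differentiable two_ne_zero 0).hasFDerivAt
    rwa [show fderiv ℝ (chart u S) 0 = 0 from hSr.1] at h
  rw [hasDerivAt_iff_isLittleO]
  refine Asymptotics.isLittleO_iff.2 fun ε hε => ?_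
  have hη : 0 < ε / (C * M + 1) := by positivity
  -- all the local estimates hold for lifts in a common neighbourhood of `0`
  have hN : {h | ‖h‖ ≤ C * ‖fderiv ℝ (chart u S) h‖ ∧
      |chart u S h - chart u S 0| ≤ ε / (C * M + 1) * ‖h‖} ∈ nhds 0 := by
    filter_upwards [hC, hd0.isLittleO.def hη] with h h1 h2
    refine ⟨h1, ?_⟩
    simpa using h2
  have hN' := (isOpenQuotientMap_proj R).isOpenMap.image_mem_nhds hN
  rw [proj_zero] at hN'
  have hpS : Filter.Tendsto (fun t => p t - S) (nhds 0) (nhds 0) := by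
    simpa using hpt.sub_const S
  have hvS : Filter.Tendsto (fun t => |v (p t) - v S|) (nhds 0) (nhds 0) := by
    have h := (((v.continuous.tendsto S).comp hpt).sub_const (v S)).abs
    simpa using h
  filter_upwards [hpS hN', hvS.eventually_le_const hη] with t ht htv
  obtain ⟨h, ⟨hh1, hh2⟩, hh3⟩ := ht
  have hpS' : p t = S + proj R h := by
    rw [hh3]
    exact (add_sub_cancel S (p t)).symm
  have h1 : ‖h‖ ≤ C * (|t| * M) := by
    refine hh1.trans (mul_le_mul_of_nonneg_left ?_ hC0.le)
    rw [fderiv_chart, ← hpS']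
    exact hnorm t
  have h2 : |u (p t) - u S| ≤ ε / (C * M + 1) * (C * (|t| * M)) := by
    rw [chart_apply_zero] at hh2
    rw [hpS']
    exact hh2.trans (mul_le_mul_of_nonneg_left h1 hη.le)
  have h3 : |t * (v (p t) - v S)| ≤ |t| * (ε / (C * M + 1)) := by
    rw [abs_mul]
    exact mul_le_mul_of_nonneg_left htv (abs_nonneg t)
  have hSv := hSr.2
  have h4 : threshold A (u + t • v) - threshold A (u + (0 : ℝ) • v) - (t - 0) • -v S
      = -(u (p t) - u S) - t * (v (p t) - v S) := by
    rw [zero_smul, add_zero, sub_zero, smul_eq_mul]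
    linear_combination hval t - hSv
  rw [h4, Real.norm_eq_abs, Real.norm_eq_abs, sub_zero]
  refine (abs_sub _ _).trans ?_
  rw [abs_neg]
  have h5 : ε / (C * M + 1) * (C * (|t| * M)) + |t| * (ε / (C * M + 1)) = ε * |t| := by
    field_simp
  linarith

end Torus

section GaussianCoordinates

variable {Ω T : Type*} [MeasurableSpace Ω] {μ : Measure Ω} {X : T → Ω → ℝ} {n : ℕ}

/-! ### Standard Gaussian coordinates given by an orthogonal basis of the Cameron–Martin space -/

theorem map_eq_stdGauss [IsProbabilityMeasure μ] {Ξ : Ω → Fin n → ℝ} (hG : HasGaussianLaw Ξ μ)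
    (hm : ∀ k, ∫ ω, Ξ ω k ∂μ = 0)
    (hc : ∀ j k, ∫ ω, Ξ ω j * Ξ ω k ∂μ = if j = k then 1 else 0) : μ.map Ξ = stdGauss n := by
  have hL2 : ∀ k, MemLp (fun ω => Ξ ω k) 2 μ := fun k =>
    (HasGaussianLaw.eval (X := fun k ω => Ξ ω k) hG k).memLp_two
  have hcov : ∀ j k, cov[fun ω => Ξ ω j, fun ω => Ξ ω k; μ] = if j = k then 1 else 0 := by
    intro j k
    rw [covariance_eq_sub (hL2 j) (hL2 k), hm, zero_mul, sub_zero, ← hc j k]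
    rfl
  have hind : iIndepFun (fun k ω => Ξ ω k) μ :=
    HasGaussianLaw.iIndepFun_of_covariance_eq_zero (X := fun k ω => Ξ ω k) hG
      fun i j hij => by rw [hcov, if_neg hij]
  have h1 := (iIndepFun_iff_map_fun_eq_pi_map fun k => (hL2 k).aemeasurable).1 hind
  have h2 : ∀ k, μ.map (fun ω => Ξ ω k) = gaussianReal 0 1 := fun k => by
    rw [(HasGaussianLaw.eval (X := fun k ω => Ξ ω k) hG k).map_eq_gaussianReal, hm,
      ← covariance_self (hL2 k).aemeasurable, hcov, if_pos rfl, Real.toNNReal_one]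
  simp only [h2] at h1
  exact h1

theorem coeFn_sum_smul {ι : Type*} (I : Finset ι) (r : ι → ℝ) {ζ : ι → Lp ℝ 2 μ}
    {Y : ι → Ω → ℝ} (h : ∀ i, ζ i =ᵐ[μ] Y i) :
    ((∑ i ∈ I, r i • ζ i : Lp ℝ 2 μ) : Ω → ℝ) =ᵐ[μ] fun ω => ∑ i ∈ I, r i * Y i ω := by
  classical
  induction I using Finset.induction_on with
  | empty =>
    simp only [Finset.sum_empty]
    exact Lp.coeFn_zero ℝ 2 μ
  | insert i I hi ih =>
    rw [Finset.sum_insert hi]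
    filter_upwards [ih, Lp.coeFn_add (r i • ζ i) (∑ i ∈ I, r i • ζ i),
      Lp.coeFn_smul (r i) (ζ i), h i] with ω h1 h2 h3 h4
    rw [h2, Pi.add_apply, h1, h3, Pi.smul_apply, smul_eq_mul, Finset.sum_insert hi, h4]

theorem gaussianSpace_eq_span (hf : IsGaussianProcess X μ)
    (b : Module.Basis (Fin n) ℝ (cameronMartin hf)) :
    gaussianSpace hf = Submodule.span ℝ (Set.range (gaussianVar hf)) := by
  have : FiniteDimensional ℝ (gaussianSpace hf) :=
    Module.Finite.of_basis (b.map (cmEquiv hf).symm)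
  have hle : Submodule.span ℝ (Set.range (gaussianVar hf)) ≤ gaussianSpace hf :=
    Submodule.le_topologicalClosure _
  have := Submodule.finiteDimensional_of_le hle
  exact (Submodule.closed_of_finiteDimensional
    (Submodule.span ℝ (Set.range (gaussianVar hf)))).submodule_topologicalClosure_eq

theorem gaussianVar_mem (hf : IsGaussianProcess X μ) (x : T) :
    gaussianVar hf x ∈ gaussianSpace hf :=
  Submodule.le_topologicalClosure _ (Submodule.subset_span ⟨x, rfl⟩)

/-- An orthogonal basis of the Cameron–Martin space expands the process in independent standard
Gaussian variables. -/
theorem exists_gaussian_coordinates [IsProbabilityMeasure μ] (hf : IsGaussianProcess X μ)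
    (hcent : ∀ x, ∫ ω, X x ω ∂μ = 0) (ψ : Module.Basis (Fin n) ℝ (cameronMartin hf))
    (hψ : ∀ j k, j ≠ k → cmInner hf (ψ j) (ψ k) = 0) :
    ∃ (c : Fin n → ℝ) (Ξ : Ω → Fin n → ℝ), (∀ k, 0 < c k) ∧ AEMeasurable Ξ μ ∧
      μ.map Ξ = stdGauss n ∧
      (∀ x, ∀ᵐ ω ∂μ, X x ω = ∑ k, c k * (ψ k : T → ℝ) x * Ξ ω k) ∧
      ∀ x, covKernel X μ x x = ∑ k, (c k * (ψ k : T → ℝ) x) ^ 2 := by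
  classical
  set b := ψ.map (cmEquiv hf).symm with hb
  have hbk : ∀ k, b k = (cmEquiv hf).symm (ψ k) := fun k => by rw [hb, Module.Basis.map_apply]
  have hbne : ∀ k, ‖b k‖ ≠ 0 := fun k => norm_ne_zero_iff.2 (b.ne_zero k)
  have hinner : ∀ j k, j ≠ k → inner ℝ (b j) (b k) = 0 := fun j k hjk => by
    rw [← hψ j k hjk, Submodule.coe_inner, L2.inner_def, cmInner, hbk, hbk]
    exact integral_congr_ae (Filter.Eventually.of_forall fun ω => mul_comm _ _)
  set c : Fin n → ℝ := fun k => ‖b k‖⁻¹ with hc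
  have hc0 : ∀ k, 0 < c k := fun k => inv_pos.2 (lt_of_le_of_ne (norm_nonneg _) (hbne k).symm)
  set b' := b.isUnitSMul (w := c) fun k => (hc0 k).ne'.isUnit with hb'
  have hb'k : ∀ k, b' k = c k • b k := fun k => Module.Basis.isUnitSMul_apply _ _
  have hb'inner : ∀ k y, inner ℝ (b' k) y = c k * inner ℝ (b k) y := fun k y => by
    rw [hb'k]
    exact real_inner_smul_left (b k) y (c k)
  have hon : Orthonormal ℝ b' := by
    refine ⟨fun k => ?_, fun j k hjk => ?_⟩
    · rw [hb'k, norm_smul, Real.norm_of_nonneg (hc0 k).le, hc]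
      exact inv_mul_cancel₀ (hbne k)
    · change inner ℝ (b' j) (b' k) = 0
      rw [hb'inner, real_inner_comm, hb'inner, real_inner_comm, hinner j k hjk, mul_zero, mul_zero]
  set B := b'.toOrthonormalBasis hon with hB
  have hBk : ∀ k, B k = b' k := fun k => by rw [hB, Module.Basis.coe_toOrthonormalBasis]
  have hcoe : ∀ k x, inner ℝ (b' k) ⟨gaussianVar hf x, gaussianVar_mem hf x⟩
      = c k * (ψ k : T → ℝ) x := fun k x => by
    have h1 : cmMap hf (b k) = ψ k := by
      have h : cmEquiv hf (b k) = ψ k := by rw [hbk, LinearEquiv.apply_symm_apply]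
      exact congrArg Subtype.val h
    rw [hb'inner, ← h1, Submodule.coe_inner, real_inner_comm]
    rfl
  -- the variables are finite linear combinations of values of the process
  have hspan : ∀ k, ∃ a : T →₀ ℝ, (a.sum fun x r => r • gaussianVar hf x) = (b' k : Lp ℝ 2 μ) :=
    fun k => Finsupp.mem_span_range_iff_exists_finsupp.1
      (gaussianSpace_eq_span hf ψ ▸ (b' k).2)
  choose a ha using hspan
  set I : Finset T := Finset.univ.biUnion fun k => (a k).support with hI
  have hsum : ∀ k, (∑ x ∈ I, a k x • gaussianVar hf x) = (b' k : Lp ℝ 2 μ) := fun k => by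
    rw [← ha k, Finsupp.sum_of_support_subset]
    · exact Finset.subset_biUnion_of_mem (fun k => (a k).support) (Finset.mem_univ k)
    · simp
  set L : (I → ℝ) →L[ℝ] (Fin n → ℝ) :=
    ContinuousLinearMap.pi fun k => ∑ x : I, a k x • ContinuousLinearMap.proj x with hL
  set Ξ : Ω → Fin n → ℝ := fun ω => L (I.restrict (X · ω)) with hΞ
  have hΞG : HasGaussianLaw Ξ μ := (hf.hasGaussianLaw I).map_fun L
  have hΞsum : ∀ k, (fun ω => Ξ ω k) = fun ω => ∑ x ∈ I, a k x * X x ω := fun k => by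
    ext ω
    simp only [hΞ, hL, ContinuousLinearMap.pi_apply, FunLike.coe_sum, Finset.sum_apply,
      FunLike.coe_smul, Pi.smul_apply, ContinuousLinearMap.proj_apply, smul_eq_mul,
      Finset.restrict]
    exact Finset.sum_coe_sort I fun x => a k x * X x ω
  have hΞk : ∀ k, (b' k : Lp ℝ 2 μ) =ᵐ[μ] fun ω => Ξ ω k := fun k => by
    have h := coeFn_sum_smul I (a k) fun x => (memLp_two_of_gaussian hf x).coeFn_toLp
    rw [hΞsum, ← hsum]
    exact h
  refine ⟨c, Ξ, hc0, hΞG.aemeasurable, map_eq_stdGauss hΞG (fun k => ?_) (fun j k => ?_),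
    fun x => ?_, fun x => ?_⟩
  · rw [hΞsum, integral_finsetSum _ fun x _ =>
      ((memLp_two_of_gaussian hf x).integrable one_le_two).const_mul _]
    simp only [integral_const_mul, hcent, mul_zero, Finset.sum_const_zero]
  · have h := orthonormal_iff_ite.1 hon j k
    rw [Submodule.coe_inner, L2.inner_def] at h
    rw [← h]
    refine integral_congr_ae ?_
    filter_upwards [hΞk j, hΞk k] with ω h1 h2
    rw [h1, h2, RCLike.inner_apply, conj_trivial, mul_comm]
  · have h := congrArg Subtype.val (B.sum_repr' ⟨gaussianVar hf x, gaussianVar_mem hf x⟩)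
    simp only [Submodule.coe_sum, Submodule.coe_smul, hcoe, hBk] at h
    have h1 := coeFn_sum_smul Finset.univ (fun k => c k * (ψ k : T → ℝ) x) hΞk
    rw [h] at h1
    filter_upwards [h1, (memLp_two_of_gaussian hf x).coeFn_toLp] with ω h2 h3
    rw [← h2, gaussianVar, h3]
  · have h := B.sum_sq_norm_inner_right ⟨gaussianVar hf x, gaussianVar_mem hf x⟩
    simp only [hBk, hcoe, Real.norm_eq_abs, sq_abs] at h
    rw [h, covKernel, covariance_eq_sub (memLp_two_of_gaussian hf x) (memLp_two_of_gaussian hf x),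
      hcent, zero_mul, sub_zero, Submodule.coe_norm, ← real_inner_self_eq_norm_sq, L2.inner_def]
    refine integral_congr_ae ?_
    filter_upwards [(memLp_two_of_gaussian hf x).coeFn_toLp] with ω h1
    rw [Pi.mul_apply, gaussianVar, h1]
    rfl

/-- A linear subspace that almost surely contains a standard Gaussian vector is everything. -/
theorem eq_top_of_ae_mem [IsProbabilityMeasure μ] {Ξ : Ω → Fin n → ℝ} (hΞ : AEMeasurable Ξ μ)
    (hlaw : μ.map Ξ = stdGauss n) (V : Submodule ℝ (Fin n → ℝ)) (hV : ∀ᵐ ω ∂μ, Ξ ω ∈ V) :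
    V = ⊤ := by
  by_contra hne
  have h0 : stdGauss n (V : Set (Fin n → ℝ)) = 0 :=
    stdGauss_absolutelyContinuous n (Measure.addHaar_submodule volume V hne)
  rw [← hlaw, Measure.map_apply_of_aemeasurable hΞ
    V.closed_of_finiteDimensional.measurableSet] at h0
  have h1 : ∀ᵐ ω ∂μ, ω ∉ Ξ ⁻¹' (V : Set (Fin n → ℝ)) := measure_eq_zero_iff_ae_notMem.1 h0
  obtain ⟨ω, h2, h3⟩ := (h1.and hV).exists
  exact h2 h3

/-- The coefficients of a sample-continuous process along a standard Gaussian vector are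
continuous. -/
theorem continuous_of_gaussian_expansion [TopologicalSpace T] [FirstCountableTopology T]
    [IsProbabilityMeasure μ] {Ξ : Ω → Fin n → ℝ} (hΞ : AEMeasurable Ξ μ)
    (hlaw : μ.map Ξ = stdGauss n) (hX : ∀ ω, Continuous fun x => X x ω) {e : Fin n → T → ℝ}
    (he : ∀ x, ∀ᵐ ω ∂μ, X x ω = ∑ k, e k x * Ξ ω k) (k : Fin n) : Continuous (e k) := by
  rw [continuous_iff_seqContinuous]
  intro x x₀ hx
  set V : Submodule ℝ (Fin n → ℝ) :=
    { carrier := {a | Filter.Tendsto (fun m => ∑ k, e k (x m) * a k) Filter.atTop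
        (nhds (∑ k, e k x₀ * a k))}
      add_mem' := fun {a b} ha hb => by
        have h := Filter.Tendsto.add ha hb
        simp only [← Finset.sum_add_distrib, ← mul_add] at h
        exact h
      zero_mem' := by simp
      smul_mem' := fun r a ha => by
        have h := Filter.Tendsto.const_mul r ha
        simp only [Finset.mul_sum] at h
        simp only [mul_left_comm r] at h
        exact h } with hV
  have hmem : ∀ᵐ ω ∂μ, Ξ ω ∈ V := by
    filter_upwards [he x₀, ae_all_iff.2 fun m => he (x m)] with ω h0 h1
    change Filter.Tendsto _ _ _
    rw [← h0]
    refine Filter.Tendsto.congr h1 ?_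
    exact ((hX ω).tendsto x₀).comp hx
  have htop := eq_top_of_ae_mem hΞ hlaw V hmem
  have h : Pi.single k (1 : ℝ) ∈ V := htop ▸ Submodule.mem_top
  have h' : Filter.Tendsto (fun m => ∑ j, e j (x m) * (Pi.single k (1 : ℝ) : Fin n → ℝ) j)
    Filter.atTop (nhds (∑ j, e j x₀ * (Pi.single k (1 : ℝ) : Fin n → ℝ) j)) := h
  simp only [Pi.single_apply, mul_ite, mul_one, mul_zero, Finset.sum_ite_eq', Finset.mem_univ,
    if_true] at h'
  exact h'

end GaussianCoordinates

/-! ### Invariance of the logarithmic factor -/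

section LogFactor

variable {Ω α : Type*} [MeasurableSpace Ω] [MeasurableSpace α] {μ : Measure Ω}

theorem logFactor_congr_ae {X Y : Ω → ℝ} (h : X =ᵐ[μ] Y) : logFactor X μ = logFactor Y μ := by
  have h1 : ∫ ω, |X ω| ∂μ = ∫ ω, |Y ω| ∂μ := integral_congr_ae (h.mono fun ω hω => by simp only [hω])
  have h2 : ∫ ω, X ω ^ 2 ∂μ = ∫ ω, Y ω ^ 2 ∂μ :=
    integral_congr_ae (h.mono fun ω hω => by simp only [hω])
  rw [logFactor, logFactor, h1, h2]

theorem logFactor_const_mul {r : ℝ} (hr : r ≠ 0) (X : Ω → ℝ) :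
    logFactor (fun ω => r * X ω) μ = logFactor X μ := by
  have hr' : |r| ≠ 0 := abs_ne_zero.2 hr
  have h1 : ∫ ω, |r * X ω| ∂μ = |r| * ∫ ω, |X ω| ∂μ := by
    rw [← integral_const_mul]
    simp only [abs_mul]
  have h2 : ∫ ω, (r * X ω) ^ 2 ∂μ = |r| ^ 2 * ∫ ω, X ω ^ 2 ∂μ := by
    rw [← integral_const_mul]
    simp only [mul_pow, sq_abs]
  rw [logFactor, logFactor, h1, h2, Real.sqrt_mul (sq_nonneg _), Real.sqrt_sq (abs_nonneg r),
    mul_div_mul_left _ _ hr']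
  simp only [mul_eq_zero, hr', false_or]

theorem logFactor_comp {Ξ : Ω → α} (hΞ : AEMeasurable Ξ μ) {g : α → ℝ} (hg : Measurable g) :
    logFactor (fun ω => g (Ξ ω)) μ = logFactor g (μ.map Ξ) := by
  rw [logFactor, logFactor, integral_map hΞ hg.abs.aestronglyMeasurable,
    integral_map hΞ (hg.pow_const 2).aestronglyMeasurable]

end LogFactor

namespace Torus

variable {d : ℕ} {R : Fin d → ℝ} {A : Set C(Torus R, ℝ)} {n : ℕ}

/-! ### The threshold of a finite-dimensional Gaussian field -/

theorem compactSpace (hR : ∀ i, 0 < R i) : CompactSpace (Torus R) := by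
  have : ∀ i, CompactSpace (AddCircle (2 * Real.pi * R i)) := fun i =>
    haveI : Fact (0 < 2 * Real.pi * R i) := ⟨mul_pos Real.two_pi_pos (hR i)⟩
    inferInstance
  infer_instance

variable [CompactSpace (Torus R)]

/-- The threshold of a linear combination is a Lipschitz function of the coefficients. -/
theorem IsAdmissible.exists_lipschitzWith_threshold_sum (hA : IsAdmissible A)
    (e : Fin n → C(Torus R, ℝ)) :
    ∃ C : NNReal, LipschitzWith C fun y : Fin n → ℝ => threshold A (∑ k, y k • e k) := by
  refine ⟨∑ k, ‖e k‖₊, LipschitzWith.of_dist_le_mul fun y z => ?_⟩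
  rw [Real.dist_eq]
  refine (hA.abs_threshold_sub_le _ _).trans ?_
  rw [← Finset.sum_sub_distrib, NNReal.coe_sum, Finset.sum_mul]
  refine (norm_sum_le _ _).trans (Finset.sum_le_sum fun k _ => ?_)
  rw [← sub_smul, norm_smul, mul_comm, coe_nnnorm]
  refine mul_le_mul_of_nonneg_left ?_ (norm_nonneg _)
  rw [← dist_eq_norm]
  exact dist_le_pi_dist y z k

theorem IsAdmissible.lineDeriv_threshold_sum (hA : IsAdmissible A) {e : Fin n → C(Torus R, ℝ)}
    (he : ∀ k, ContDiff ℝ 2 (chart (e k) 0)) {y : Fin n → ℝ}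
    (hy : IsPerfectMorse (∑ k, y k • e k)) (k : Fin n) :
    lineDeriv ℝ (fun y : Fin n → ℝ => threshold A (∑ k, y k • e k)) y (Pi.single k 1)
      = -e k (saddle A (∑ k, y k • e k)) := by
  refine HasLineDerivAt.lineDeriv ?_
  have h := hA.hasDerivAt_threshold hy (he k)
  have h1 : ∀ t : ℝ, ∑ j, (y + t • (Pi.single k 1 : Fin n → ℝ)) j • e j = ∑ j, y j • e j + t • e k := by
    intro t
    simp [add_smul, Finset.sum_add_distrib, Pi.single_apply, ite_smul]
  rw [HasLineDerivAt]
  simp only [h1]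
  exact h

/-- If a random function of class `C²` expands along a standard Gaussian vector, then so are the
coefficients of the expansion. -/
theorem contDiff_of_gaussian_expansion {Ω : Type*} [MeasurableSpace Ω] {μ : Measure Ω}
    [IsProbabilityMeasure μ] {Ξ : Ω → Fin n → ℝ} (hΞ : AEMeasurable Ξ μ)
    (hlaw : μ.map Ξ = stdGauss n) {f : Ω → C(Torus R, ℝ)} {e : Fin n → C(Torus R, ℝ)}
    (hf : ∀ᵐ ω ∂μ, f ω = ∑ k, Ξ ω k • e k) (hC2 : ∀ᵐ ω ∂μ, ContDiff ℝ 2 (chart (f ω) 0))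
    (k : Fin n) : ContDiff ℝ 2 (chart (e k) 0) := by
  set V : Submodule ℝ (Fin n → ℝ) :=
    { carrier := {a | ContDiff ℝ 2 (chart (∑ k, a k • e k) 0)}
      add_mem' := fun {a b} ha hb => by
        have h : ContDiff ℝ 2 (chart (∑ k, a k • e k + ∑ k, b k • e k) 0) := ContDiff.add
          (show ContDiff ℝ 2 (chart (∑ k, a k • e k) 0) from ha)
          (show ContDiff ℝ 2 (chart (∑ k, b k • e k) 0) from hb)
        rw [← Finset.sum_add_distrib] at h
        simp only [← add_smul] at h
        exact h
      zero_mem' := by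
        have h : chart (∑ k, (0 : Fin n → ℝ) k • e k) 0 = fun _ => 0 := by
          ext v
          simp [chart]
        change ContDiff ℝ 2 (chart (∑ k, (0 : Fin n → ℝ) k • e k) 0)
        rw [h]
        exact contDiff_const
      smul_mem' := fun r a ha => by
        have h : ContDiff ℝ 2 (chart (r • ∑ k, a k • e k) 0) := ContDiff.const_smul r
          (show ContDiff ℝ 2 (chart (∑ k, a k • e k) 0) from ha)
        rw [Finset.smul_sum] at h
        simp only [smul_smul] at h
        exact h } with hV
  have hmem : ∀ᵐ ω ∂μ, Ξ ω ∈ V := by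
    filter_upwards [hf, hC2] with ω h1 h2
    change ContDiff ℝ 2 (chart (∑ k, Ξ ω k • e k) 0)
    rwa [← h1]
  have htop := eq_top_of_ae_mem hΞ hlaw V hmem
  have h : Pi.single k (1 : ℝ) ∈ V := htop ▸ Submodule.mem_top
  have h' : ContDiff ℝ 2 (chart (∑ j, (Pi.single k (1 : ℝ) : Fin n → ℝ) j • e j) 0) := h
  simpa [Pi.single_apply, ite_smul] using h'

end Torus

theorem proposition2p5 :
    ∃ C : ℝ, ∀ (d : ℕ) (R : Fin d → ℝ) (_ : ∀ i, 0 < R i)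
      (A : Set C(Torus R, ℝ)) (_ : Torus.IsAdmissible A)
      (Ω : Type*) [MeasurableSpace Ω] (μ : Measure Ω) [IsProbabilityMeasure μ]
      -- `f` is a centered Gaussian field on the torus with covariance `K`
      (f : Ω → C(Torus R, ℝ)) (K : Torus R → Torus R → ℝ)
      (hf : IsGaussianProcess (fun (x : Torus R) (ω : Ω) => f ω x) μ)
      (_ : ∀ x, ∫ ω, f ω x ∂μ = 0)
      (_ : K = covKernel (fun (x : Torus R) (ω : Ω) => f ω x) μ)
      -- its Cameron-Martin space is not `{0}` and has a finite orthogonal basis `ψ`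
      (_ : cameronMartin hf ≠ ⊥)
      (n : ℕ) (ψ : Module.Basis (Fin n) ℝ (cameronMartin hf))
      (_ : ∀ j k, j ≠ k → cmInner hf (ψ j) (ψ k) = 0)
      -- `f` is almost surely a perfect Morse function
      (_ : ∀ᵐ ω ∂μ, Torus.IsPerfectMorse (f ω)),
      -- the saddle point is a.s. well defined, and all the moments below are finite
      (∀ᵐ ω ∂μ, ∃! p, Torus.ReachedAt A (f ω) p) ∧
      MemLp (fun ω => Torus.threshold A (f ω)) 2 μ ∧
      Integrable (fun ω => K (Torus.saddle A (f ω)) (Torus.saddle A (f ω))) μ ∧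
      (∀ k, MemLp (fun ω => (ψ k : Torus R → ℝ) (Torus.saddle A (f ω))) 2 μ) ∧
      -- the inequality
      Var[fun ω => Torus.threshold A (f ω); μ] ≤
        C * (∫ ω, K (Torus.saddle A (f ω)) (Torus.saddle A (f ω)) ∂μ) *
          ⨆ k : Fin n, logFactor (fun ω => (ψ k : Torus R → ℝ) (Torus.saddle A (f ω))) μ := by
  refine ⟨4, fun d R hR A hA Ω _ μ _ f K hf hcent hK _ n ψ hψ hM => ?_⟩
  have := Torus.compactSpace hR
  obtain ⟨c, Ξ, hc, hΞ, hlaw, hexp, hcov⟩ := exists_gaussian_coordinates hf hcent ψ hψ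
  have hcont := fun k => continuous_of_gaussian_expansion hΞ hlaw
    (fun ω => (f ω).continuous) (e := fun k x => c k * (ψ k : Torus R → ℝ) x) hexp k
  set e : Fin n → C(Torus R, ℝ) := fun k => ⟨_, hcont k⟩ with he
  have hek : ∀ k x, e k x = c k * (ψ k : Torus R → ℝ) x := fun _ _ => rfl
  -- the expansion holds simultaneously on a countable dense set, hence everywhere
  have hfe : ∀ᵐ ω ∂μ, f ω = ∑ k, Ξ ω k • e k := by
    obtain ⟨D, hDc, hD⟩ := TopologicalSpace.exists_countable_dense (Torus R)
    filter_upwards [(ae_ball_iff hDc).2 fun x _ => hexp x] with ω h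
    refine ContinuousMap.coe_injective
      ((f ω).continuous.ext_on hD (∑ k, Ξ ω k • e k).continuous fun x hx => ?_)
    rw [h x hx, ContinuousMap.sum_apply]
    refine Finset.sum_congr rfl fun k _ => ?_
    rw [ContinuousMap.smul_apply, hek, smul_eq_mul, mul_comm]
  have heC2 := Torus.contDiff_of_gaussian_expansion hΞ hlaw hfe
    (hM.mono fun ω h => h.contDiff)
  set F : (Fin n → ℝ) → ℝ := fun y => Torus.threshold A (∑ k, y k • e k) with hF
  obtain ⟨L, hL⟩ := hA.exists_lipschitzWith_threshold_sum e
  set g : Fin n → (Fin n → ℝ) → ℝ := fun k y => lineDeriv ℝ F y (Pi.single k 1) with hg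
  have hgm : ∀ k, Measurable (g k) := fun k => measurable_lineDeriv hL.continuous
  have hgb : ∀ k y, |g k y| ≤ L := fun k y => by
    have := norm_lineDeriv_le_of_lipschitz ℝ (x₀ := y) (v := Pi.single k (1 : ℝ)) hL
    simpa [Pi.norm_single] using this
  have hgL2 : ∀ k, MemLp (fun ω => g k (Ξ ω)) 2 μ := fun k =>
    MemLp.of_bound ((hgm k).comp_aemeasurable hΞ).aestronglyMeasurable L
      (Filter.Eventually.of_forall fun ω => hgb k _)
  have hgsq : ∀ k, Integrable (fun ω => g k (Ξ ω) ^ 2) μ := fun k => (hgL2 k).integrable_sq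
  have hT : (fun ω => Torus.threshold A (f ω)) =ᵐ[μ] fun ω => F (Ξ ω) :=
    hfe.mono fun ω h => congrArg (Torus.threshold A) h
  -- at the saddle the basis functions are, up to normalization, the partial derivatives of `F`
  have hψg : ∀ k, (fun ω => (ψ k : Torus R → ℝ) (Torus.saddle A (f ω)))
      =ᵐ[μ] fun ω => -(c k)⁻¹ * g k (Ξ ω) := fun k => by
    filter_upwards [hfe, hM] with ω h1 h2
    rw [h1] at h2
    have h3 : g k (Ξ ω) = -e k (Torus.saddle A (f ω)) := by
      rw [h1]
      exact hA.lineDeriv_threshold_sum heC2 h2 k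
    have hck := (hc k).ne'
    rw [h3, hek]
    field_simp
  have hKg : (fun ω => K (Torus.saddle A (f ω)) (Torus.saddle A (f ω)))
      =ᵐ[μ] fun ω => ∑ k, g k (Ξ ω) ^ 2 := by
    filter_upwards [ae_all_iff.2 hψg] with ω h
    rw [hK, hcov]
    refine Finset.sum_congr rfl fun k _ => ?_
    have hck := (hc k).ne'
    rw [h k]
    field_simp
  have hlog : ∀ k, logFactor (fun ω => (ψ k : Torus R → ℝ) (Torus.saddle A (f ω))) μ
      = logFactor (g k) (stdGauss n) := fun k => by
    rw [logFactor_congr_ae (hψg k), logFactor_const_mul (neg_ne_zero.2 (inv_ne_zero (hc k).ne')),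
      logFactor_comp hΞ (hgm k), hlaw]
  have hFL2 : MemLp F 2 (stdGauss n) := by
    refine memLp_two_of_abs_le hL.continuous.measurable (a := |F 0|) (b := L) fun y => ?_
    have h := hL.dist_le_mul y 0
    rw [Real.dist_eq, dist_zero_right] at h
    linarith [abs_sub_abs_le_abs_sub (F y) (F 0)]
  refine ⟨hM.mono fun ω h => hA.existsUnique_reachedAt h, ?_, ?_, fun k => ?_, ?_⟩
  · refine MemLp.ae_eq hT.symm ?_
    rw [← hlaw] at hFL2
    exact hFL2.comp_of_map hΞ
  · exact (integrable_finsetSum _ fun k _ => hgsq k).congr hKg.symm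
  · exact ((hgL2 k).const_mul _).ae_eq (hψg k).symm
  · have hvar : Var[fun ω => Torus.threshold A (f ω); μ] = Var[F; stdGauss n] := by
      rw [variance_congr hT, ← hlaw, variance_map hL.continuous.aemeasurable hΞ]
      rfl
    have hint : ∫ ω, K (Torus.saddle A (f ω)) (Torus.saddle A (f ω)) ∂μ
        = ∑ k, ∫ y, g k y ^ 2 ∂stdGauss n := by
      rw [integral_congr_ae hKg, integral_finsetSum _ fun k _ => hgsq k]
      refine Finset.sum_congr rfl fun k _ => ?_
      rw [← hlaw, integral_map hΞ ((hgm k).pow_const 2).aestronglyMeasurable]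
    rw [hvar, hint]
    simp only [hlog]
    refine (variance_le_of_lipschitzWith hL).trans ?_
    rw [mul_assoc, Finset.sum_mul]
    refine mul_le_mul_of_nonneg_left (Finset.sum_le_sum fun k _ => ?_) (by norm_num)
    exact mul_le_mul_of_nonneg_left
      (le_ciSup (f := fun k => logFactor (g k) (stdGauss n)) (Set.finite_range _).bddAbove k)
      (integral_nonneg fun y => sq_nonneg _)
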